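/- All multi-valued functions below are partial multi-valued functions $f:\subseteq X\rightrightarrows Y$ between represented spaces, where a representation of $X$ is a surjective partial map $\delta_X:\subseteq\mathbb N^{\mathbb N}\to X$. A realizer $F\vdash f$ is a partial $F:\subseteq\mathbb N^{\mathbb N}\to\mathbb N^{\mathbb N}$ with $\delta_YF(p)\in f(\delta_X(p))$ for all $p\in\operatorname{dom}(f\delta_X)$. We write $f\le_W g$ (Weihrauch reducibility) if there are computable $H,K:\subseteq\mathbb N^{\mathbb N}\to\mathbb N^{\mathbb N}$ such that $p\mapsto H\langle p,GK(p)\rangle$ is a realizer of $f$ for every realizer $G$ of $g$, and $f\mid_W g$ if neither $f\le_W g$ nor $g\le_W f$. The jump $f'$ of $f$ is $f$ with the input representation $\delta_X$ replaced by $\delta_X\circ\lim$, where $\lim\langle p_0,p_1,\dots\rangle=\lim_n p_n$ in $\mathbb N^{\mathbb N}$. Closed subsets of $\mathbb R$ and $[0,1]$ are represented by negative information (lists of open rational balls exhausting the complement), points of these spaces by rapidly converging sequences of rationals, $C([0,1],\mathbb R)$ by its standard (compact-open) representation, binary trees by their characteristic functions. Consider the following problems. - $\mathsf{IVT}$: given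 a continuous $f:[0,1]\to\mathbb R$ with $f(0)\cdot f(1)<0$, find $x\in[0,1]$ with $f(x)=0$. - $\mathsf{WWKL}$: given a binary tree $T\subseteq 2^*$ whose set $[T]\subseteq 2^{\mathbb N}$ of infinite paths has positive uniform measure, find a point of $[T]$. - $\mathsf{PC}_X$ for $X=\mathbb R$ or $X=[0,1]$: given a closed $A\subseteq X$ of positive Lebesgue measure, find a point of $A$. - $\mathsf{ConC}_{[0,1]}$: given a non-empty connected closed $A\subseteq[0,1]$, find a point of $A$. A multi-valued $f$ is Las Vegas computable over $R\subseteq\mathbb N^{\mathbb N}$ with Borel measure $\mu$ and with measure in $I$ if there are computable $F_1,F_2:\subseteq\mathbb N^{\mathbb N}\to\mathbb N^{\mathbb N}$ such that for every name $p$ of a point $x\in\operatorname{dom}(f)$: $F_2\langle p,r\rangle$ is defined for all $r\in R$; the set $S_p$ of those $r\in R$ for which $F_2\langle p,r\rangle$ is the zero sequence is non-empty with $\mu(S_p)\in I$; and $F_1\langle p,r\rangle$ is a name of an element of $f(x)$ for every $r\in S_p$. $f$ is Las Vegas computable if this holds for $R=2^{\mathbb N}$ with the uniform measure and $I=(0,1]$,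 and Las Vegas computable with finitely many mind changes if it holds for $R=\mathbb N\times 2^{\mathbb N}$ with the product of the counting and the uniform measure and $I=(0,\infty]$. Then: 1. $\mathsf{IVT}\mid_W\mathsf{WWKL}$; 2. $\mathsf{IVT}$ is not Las Vegas computable, and not even Las Vegas computable with finitely many mind changes; 3. $\mathsf{IVT}\le_W\mathsf{WWKL}'$; 4. $\mathsf{ConC}_{[0,1]}\mid_W\mathsf{PC}_{\mathbb R}$; 5. $\mathsf{ConC}_{[0,1]}\le_W\mathsf{PC}_{[0,1]}'$. -/

import Mathlib

namespace Weihrauch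

open MeasureTheory Filter Topology

/-! ### Computability on Baire space -/

/-- Baire space `ℕ^ℕ` (with the product topology). -/
abbrev Baire : Type := ℕ → ℕ

/-- The prefix of length `n` of an infinite sequence. -/
def pref {α : Type} (p : ℕ → α) (n : ℕ) : List α := (List.range n).map p

/-- A partial function `F :⊆ ℕ^ℕ → ℕ^ℕ` is computable if a (total) computable function `φ` on finite
words that is monotone for the prefix order approximates it: for every `p ∈ dom F` the words
`φ (p|m)` are prefixes of `F p` of unbounded length. (By monotonicity it is enough that every prefix
of `F p` is a prefix of some `φ (p|m)`.) As usual, restrictions of computable functions count as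
computable. -/
def IsComputable (F : Baire →. Baire) : Prop :=
  ∃ φ : List ℕ → List ℕ, Computable φ ∧
    (∀ u v : List ℕ, u <+: v → φ u <+: φ v) ∧
    ∀ p : Baire, ∀ q ∈ F p, ∀ n : ℕ, ∃ m : ℕ, pref q n <+: φ (pref p m)

/-- The pairing `⟨p, q⟩` of two sequences: `p` on the even and `q` on the odd positions. -/
def pair (p q : Baire) : Baire := fun n => if n % 2 = 0 then p (n / 2) else q (n / 2)

/-! ### Represented spaces, multi-valued functions, Weihrauch reducibility -/

/-- A representation of `X`, i.e. a surjective partial map `δ :⊆ ℕ^ℕ → X`, given by its graph: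
`IsName p x` means `δ(p) = x`. -/
structure Representation (X : Type) where
  IsName : Baire → X → Prop
  unique : ∀ p x y, IsName p x → IsName p y → x = y
  surj : ∀ x, ∃ p, IsName p x

/-- A partial multi-valued function `f :⊆ X ⇉ Y` between represented spaces;
`val x` is the set `f(x)`, which is empty outside the domain. -/
structure Problem (X Y : Type) where
  source : Representation X
  target : Representation Y
  val : X → Set Y

/-- The domain of a multi-valued function. -/
def Problem.dom {X Y : Type} (f : Problem X Y) : Set X := {x | (f.val x).Nonempty}

/-- `F ⊢ f`: the partial function `F` on Baire space is a realizer of `f`. -/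
def Realizes {X Y : Type} (F : Baire →. Baire) (f : Problem X Y) : Prop :=
  ∀ p x, f.source.IsName p x → x ∈ f.dom →
    ∃ q ∈ F p, ∃ y ∈ f.val x, f.target.IsName q y

/-- The partial function `p ↦ H⟨p, G(K(p))⟩`. -/
def reduct (H K G : Baire →. Baire) : Baire →. Baire :=
  fun p => (K p).bind fun k => (G k).bind fun q => H (pair p q)

/-- Weihrauch reducibility `f ≤_W g`: there are computable `H`, `K` such that `H⟨id, G K⟩` is a
realizer of `f` for every realizer `G` of `g`. -/
def Reducible {X Y Z W : Type} (f : Problem X Y) (g : Problem Z W) : Prop :=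
  ∃ H K : Baire →. Baire, IsComputable H ∧ IsComputable K ∧
    ∀ G : Baire →. Baire, Realizes G g → Realizes (reduct H K G) f

/-- Weihrauch incomparability. -/
def Incomparable {X Y Z W : Type} (f : Problem X Y) (g : Problem Z W) : Prop :=
  ¬ Reducible f g ∧ ¬ Reducible g f

/-- `lim p = q`, where `p = ⟨p₀, p₁, …⟩` codes a sequence of points of Baire space that
converges to `q`. -/
def IsLim (p q : Baire) : Prop :=
  Tendsto (fun i : ℕ => (fun j : ℕ => p (Nat.pair i j) : Baire)) atTop (𝓝 q)

/-- The jump `δ' = δ ∘ lim` of a representation. -/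
def Representation.jump {X : Type} (δ : Representation X) : Representation X where
  IsName p x := ∃ q, IsLim p q ∧ δ.IsName q x
  unique := by
    rintro p x y ⟨q, hq, hx⟩ ⟨r, hr, hy⟩
    obtain rfl := tendsto_nhds_unique hq hr
    exact δ.unique _ _ _ hx hy
  surj x := by
    obtain ⟨q, hq⟩ := δ.surj x
    refine ⟨fun n => q n.unpair.2, q, ?_, hq⟩
    simp only [IsLim, Nat.unpair_pair]
    exact tendsto_const_nhds

/-- The jump `f'` of `f`: the input representation is replaced by its jump. -/
def Problem.jump {X Y : Type} (f : Problem X Y) : Problem X Y :=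
  { f with source := f.source.jump }

/-! ### Las Vegas computability -/

/-- Las Vegas computability of `f` over a space `R` of random advices with measure in `I`.
Here `R ⊆ ℕ^ℕ` is given by a type `R` together with an embedding `e` into Baire space, `F₁` is the
computation function and `F₂` the failure recognition function; the advice `r` is successful if
`F₂⟨p, r⟩` is the zero sequence, i.e. the name of `0` in Sierpiński space. -/
def LasVegasOver {R : Type} [MeasurableSpace R] (e : R → Baire) (μ : Measure R) (I : Set ENNReal)
    {X Y : Type} (f : Problem X Y) : Prop :=
  ∃ F₁ F₂ : Baire →. Baire, IsComputable F₁ ∧ IsComputable F₂ ∧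
    ∀ p x, f.source.IsName p x → x ∈ f.dom →
      (∀ r : R, (F₂ (pair p (e r))).Dom) ∧
      {r : R | (fun _ => 0) ∈ F₂ (pair p (e r))}.Nonempty ∧
      μ {r : R | (fun _ => 0) ∈ F₂ (pair p (e r))} ∈ I ∧
      ∀ r : R, (fun _ => 0) ∈ F₂ (pair p (e r)) →
        ∃ q ∈ F₁ (pair p (e r)), ∃ y ∈ f.val x, f.target.IsName q y

/-- Cantor space `2^ℕ`. -/
abbrev Cantor : Type := ℕ → Bool

/-- Cantor space as a subset of Baire space. -/
def cantorCode (x : Cantor) : Baire := fun n => (x n).toNat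

/-- `ℕ × 2^ℕ` as a subset of Baire space: `(k, x)` is the sequence `k x(0) x(1) …`. -/
def natCantorCode (r : ℕ × Cantor) : Baire
  | 0 => r.1
  | n + 1 => cantorCode r.2 n

/-- The uniform (fair coin) measure on Cantor space. -/
noncomputable def cantorMeasure : Measure Cantor :=
  Measure.infinitePi fun _ : ℕ => (PMF.uniformOfFintype Bool).toMeasure

/-- Las Vegas computable: over `2^ℕ` with the uniform measure, success measure in `(0, 1]`. -/
def LasVegasComputable {X Y : Type} (f : Problem X Y) : Prop :=
  LasVegasOver cantorCode cantorMeasure (Set.Ioc 0 1) f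

/-- Las Vegas computable with finitely many mind changes: over `ℕ × 2^ℕ` with the product of the
counting measure and the uniform measure, success measure in `(0, ∞]`. -/
def LasVegasComputableFMC {X Y : Type} (f : Problem X Y) : Prop :=
  LasVegasOver natCantorCode (Measure.count.prod cantorMeasure) (Set.Ioi 0) f

/-! ### Weak Weak Kőnig's Lemma -/

/-- A binary tree: a set of finite binary words that is closed under prefixes. -/
structure BinTree where
  words : Set (List Bool)
  closed : ∀ u v : List Bool, u <+: v → v ∈ words → u ∈ words

/-- The set `[T]` of infinite paths of `T`. -/
def BinTree.paths (T : BinTree) : Set Cantor := {x | ∀ n, pref x n ∈ T.words}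

/-- A name of a tree is its characteristic function (on the codes of binary words). -/
def treeRep : Representation BinTree where
  IsName p T := ∀ w : List Bool,
    (w ∈ T.words → p (Encodable.encode w) = 1) ∧ (w ∉ T.words → p (Encodable.encode w) = 0)
  unique := by
    rintro p ⟨S, hS⟩ ⟨T, hT⟩ h k
    congr
    ext w
    have h1 := h w
    have h2 := k w
    simp only at h1 h2
    by_cases a : w ∈ S <;> by_cases b : w ∈ T <;> simp_all
  surj T := by
    classical
    refine ⟨fun n => if ∃ w ∈ T.words, Encodable.encode w = n then 1 else 0, fun w => ?_⟩
    simp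

/-- A point of Cantor space is its own name. -/
def cantorRep : Representation Cantor where
  IsName p x := p = cantorCode x
  unique := by
    rintro p x y rfl h
    funext n
    have := congrFun h n
    simp only [cantorCode] at this
    cases hx : x n <;> cases hy : y n <;> simp_all
  surj x := ⟨_, rfl⟩

/-- Weak Weak Kőnig's Lemma: given a binary tree whose set of paths has positive measure,
find a path. -/
noncomputable def WWKL : Problem BinTree Cantor where
  source := treeRep
  target := cantorRep
  val T := {x | 0 < cantorMeasure T.paths ∧ x ∈ T.paths}

/-! ### Separable metric spaces -/

/-- The rational number with code `⟨⟨a, b⟩, c⟩` is `(a - b) / (c + 1)`. -/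
def ratOf (n : ℕ) : ℚ :=
  ((n.unpair.1.unpair.1 : ℚ) - (n.unpair.1.unpair.2 : ℚ)) / ((n.unpair.2 : ℚ) + 1)

theorem ratOf_surjective : Function.Surjective ratOf := by
  intro q
  refine ⟨Nat.pair (Nat.pair q.num.toNat (-q.num).toNat) (q.den - 1), ?_⟩
  simp only [ratOf, Nat.unpair_pair]
  have h1 : ((q.num.toNat : ℚ) - ((-q.num).toNat : ℚ)) = (q.num : ℚ) := by
    have : ((q.num.toNat : ℤ) - ((-q.num).toNat : ℤ)) = q.num := by omega
    exact_mod_cast this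
  have h2 : (((q.den - 1 : ℕ) : ℚ) + 1) = (q.den : ℚ) := by
    have := q.den_pos
    have : q.den - 1 + 1 = q.den := by omega
    exact_mod_cast this
  rw [h1, h2, Rat.num_div_den]

/-- The Cauchy representation of a metric space with dense sequence `α`:
`p` is a name of `x` if `d(α(p(n)), x) ≤ 2⁻ⁿ` for all `n`. -/
def cauchyRep {X : Type} [MetricSpace X] (α : ℕ → X) (hα : DenseRange α) : Representation X where
  IsName p x := ∀ n : ℕ, dist (α (p n)) x ≤ (1 / 2 : ℝ) ^ n
  unique := by
    intro p x y hx hy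
    have h0 : Tendsto (fun n : ℕ => (1 / 2 : ℝ) ^ n) atTop (𝓝 0) :=
      tendsto_pow_atTop_nhds_zero_of_lt_one (by norm_num) (by norm_num)
    have h1 : Tendsto (fun n => α (p n)) atTop (𝓝 x) :=
      tendsto_iff_dist_tendsto_zero.mpr (squeeze_zero (fun _ => dist_nonneg) hx h0)
    have h2 : Tendsto (fun n => α (p n)) atTop (𝓝 y) :=
      tendsto_iff_dist_tendsto_zero.mpr (squeeze_zero (fun _ => dist_nonneg) hy h0)
    exact tendsto_nhds_unique h1 h2
  surj x := by
    have h : ∀ n : ℕ, ∃ k, dist x (α k) < (1 / 2 : ℝ) ^ n := fun n =>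
      hα.exists_dist_lt x (by positivity)
    choose p hp using h
    exact ⟨p, fun n => by rw [dist_comm]; exact (hp n).le⟩

/-- The `n`-th open rational ball: center `α(i)` and radius the rational coded by `j`,
for `n = ⟨i, j⟩` (empty if the radius is not positive). -/
def ratBall {X : Type} [MetricSpace X] (α : ℕ → X) (n : ℕ) : Set X :=
  Metric.ball (α n.unpair.1) (ratOf n.unpair.2 : ℝ)

/-- The representation `ψ₋` of the closed subsets of a metric space with dense sequence `α` by
negative information: a name of `A` is a list of open rational balls whose union is the complement
of `A`. -/
def closedRep {X : Type} [MetricSpace X] (α : ℕ → X) (hα : DenseRange α) :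
    Representation (TopologicalSpace.Closeds X) where
  IsName p A := (A : Set X)ᶜ = ⋃ i : ℕ, ratBall α (p i)
  unique := by
    intro p A B hA hB
    exact TopologicalSpace.Closeds.ext (compl_injective (hA.trans hB.symm))
  surj A := by
    obtain ⟨z, hz⟩ := ratOf_surjective 0
    have hne : {n : ℕ | ratBall α n ⊆ (A : Set X)ᶜ}.Nonempty :=
      ⟨Nat.pair 0 z, by simp [ratBall, hz]⟩
    obtain ⟨p, hp⟩ := (Set.to_countable {n : ℕ | ratBall α n ⊆ (A : Set X)ᶜ}).exists_eq_range hne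
    refine ⟨p, ?_⟩
    apply Set.Subset.antisymm
    · intro x hx
      obtain ⟨ε, hε, hb⟩ := Metric.isOpen_iff.mp A.isClosed.isOpen_compl x hx
      obtain ⟨q, hq0, hq⟩ := exists_rat_btwn (half_pos hε)
      obtain ⟨j, rfl⟩ := ratOf_surjective q
      obtain ⟨i, hi⟩ := hα.exists_dist_lt x hq0
      have hmem : Nat.pair i j ∈ {n : ℕ | ratBall α n ⊆ (A : Set X)ᶜ} := by
        intro y hy
        simp only [ratBall, Nat.unpair_pair, Metric.mem_ball] at hy
        apply hb
        rw [Metric.mem_ball]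
        have := dist_triangle y (α i) x
        rw [dist_comm (α i) x] at this
        linarith
      rw [hp] at hmem
      obtain ⟨n, hn⟩ := hmem
      refine Set.mem_iUnion.mpr ⟨n, ?_⟩
      rw [hn]
      simpa [ratBall] using hi
    · refine Set.iUnion_subset fun i => ?_
      have : p i ∈ {n : ℕ | ratBall α n ⊆ (A : Set X)ᶜ} := hp ▸ Set.mem_range_self i
      exact this

/-- Probabilistic (positive) choice `PC_X`: given a closed set of positive measure by negative
information, find a point in it. -/
def positiveChoice {X : Type} [MetricSpace X] [MeasurableSpace X] (μ : Measure X)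
    (α : ℕ → X) (hα : DenseRange α) : Problem (TopologicalSpace.Closeds X) X where
  source := closedRep α hα
  target := cauchyRep α hα
  val A := {x | 0 < μ (A : Set X) ∧ x ∈ A}

/-- Connected choice `ConC_X`: given a (non-empty) connected closed set by negative information,
find a point in it. -/
def connectedChoice {X : Type} [MetricSpace X]
    (α : ℕ → X) (hα : DenseRange α) : Problem (TopologicalSpace.Closeds X) X where
  source := closedRep α hα
  target := cauchyRep α hα
  val A := {x | IsConnected (A : Set X) ∧ x ∈ A}

/-! ### The real line and the unit interval -/

/-- The dense sequence of the rational numbers in `ℝ`. -/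
def realSeq (n : ℕ) : ℝ := (ratOf n : ℝ)

theorem denseRange_realSeq : DenseRange realSeq :=
  DenseRange.comp (Rat.isDenseEmbedding_coe_real.dense)
    ratOf_surjective.denseRange Rat.continuous_coe_real

/-- The dense sequence of the rational numbers in `[0, 1]`: rationals outside are moved to the
nearest end point. -/
noncomputable def unitSeq (n : ℕ) : unitInterval := Set.projIcc (0 : ℝ) 1 zero_le_one (realSeq n)

theorem denseRange_unitSeq : DenseRange unitSeq :=
  DenseRange.comp (Set.projIcc_surjective zero_le_one).denseRange
    denseRange_realSeq continuous_projIcc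

/-- `PC_ℝ`, with Lebesgue measure. -/
noncomputable def PCReal : Problem (TopologicalSpace.Closeds ℝ) ℝ :=
  positiveChoice volume realSeq denseRange_realSeq

/-- `PC_[0,1]`, with Lebesgue measure. -/
noncomputable def PCUnit : Problem (TopologicalSpace.Closeds unitInterval) unitInterval :=
  positiveChoice volume unitSeq denseRange_unitSeq

/-- `ConC_[0,1]`. -/
noncomputable def ConCUnit : Problem (TopologicalSpace.Closeds unitInterval) unitInterval :=
  connectedChoice unitSeq denseRange_unitSeq

/-! ### The Intermediate Value Theorem -/

/-- For `k = ⟨⟨a, b⟩, ⟨c, d⟩⟩` (codes of rationals): `f` maps `[a, b] ∩ [0, 1]` into `(c, d)`. -/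
def MapsBox (f : C(unitInterval, ℝ)) (k : ℕ) : Prop :=
  ∀ x : unitInterval, realSeq k.unpair.1.unpair.1 ≤ x → (x : ℝ) ≤ realSeq k.unpair.1.unpair.2 →
    realSeq k.unpair.2.unpair.1 < f x ∧ f x < realSeq k.unpair.2.unpair.2

/-- The compact-open representation of the continuous functions `f : [0, 1] → ℝ`: a name of `f`
enumerates all pairs of a compact interval `[a, b]` and an open interval `(c, d)` with rational
end points such that `f` maps `[a, b] ∩ [0, 1]` into `(c, d)`. -/
def contRep : Representation C(unitInterval, ℝ) where
  IsName p f := Set.range p = {k | MapsBox f k}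
  unique := by
    have key : ∀ f g : C(unitInterval, ℝ), {k | MapsBox f k} = {k | MapsBox g k} →
        ∀ x, f x ≤ g x := by
      intro f g h x
      by_contra hlt
      push Not at hlt
      obtain ⟨q, hq1, hq2⟩ := exists_rat_btwn hlt
      have hU : IsOpen {y : unitInterval | (q : ℝ) < f y} :=
        isOpen_lt continuous_const f.continuous
      obtain ⟨ε, hε, hb⟩ := Metric.isOpen_iff.mp hU x hq2
      obtain ⟨a, ha1, ha2⟩ := exists_rat_btwn (show (x : ℝ) - ε < x by linarith)
      obtain ⟨b, hb1, hb2⟩ := exists_rat_btwn (show (x : ℝ) < x + ε by linarith)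
      obtain ⟨D, hD⟩ := exists_rat_gt ‖f‖
      obtain ⟨ca, rfl⟩ := ratOf_surjective a
      obtain ⟨cb, rfl⟩ := ratOf_surjective b
      obtain ⟨cq, rfl⟩ := ratOf_surjective q
      obtain ⟨cD, rfl⟩ := ratOf_surjective D
      have hm : Nat.pair (Nat.pair ca cb) (Nat.pair cq cD) ∈ {k | MapsBox f k} := by
        intro y hy1 hy2
        simp only [Nat.unpair_pair, realSeq] at hy1 hy2 ⊢
        refine ⟨hb ?_, lt_of_le_of_lt ((le_abs_self _).trans (f.norm_coe_le_norm y)) hD⟩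
        rw [Metric.mem_ball, Subtype.dist_eq, Real.dist_eq, abs_lt]
        constructor <;> linarith
      rw [h] at hm
      have := hm x
      simp only [Nat.unpair_pair, realSeq] at this
      have := (this ha2.le hb1.le).1
      linarith
    intro p f g hf hg
    have h := hf.symm.trans hg
    ext x
    exact le_antisymm (key f g h x) (key g f h.symm x)
  surj f := by
    obtain ⟨a, ha⟩ := ratOf_surjective 1
    obtain ⟨b, hb⟩ := ratOf_surjective 0
    have hne : {k | MapsBox f k}.Nonempty := by
      refine ⟨Nat.pair (Nat.pair a b) 0, fun x h1 h2 => ?_⟩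
      simp only [Nat.unpair_pair, realSeq, ha, hb] at h1 h2
      push_cast at h1 h2
      linarith
    obtain ⟨p, hp⟩ := (Set.to_countable {k | MapsBox f k}).exists_eq_range hne
    exact ⟨p, hp.symm⟩

/-- The Intermediate Value Theorem: given a continuous `f : [0, 1] → ℝ` with `f(0) · f(1) < 0`,
find a zero of `f`. -/
noncomputable def IVT : Problem C(unitInterval, ℝ) unitInterval where
  source := contRep
  target := cauchyRep unitSeq denseRange_unitSeq
  val f := {x | f 0 * f 1 < 0 ∧ f x = 0}

end Weihrauch

namespace Weihrauch

open MeasureTheory Filter Topology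

/-! ### Prefixes and monotone approximations -/

/-! All negative statements are topological: a reduction is used only through the prefix-monotone
word functions that approximate it (`Reducible.exists_approximations`).

`IVT` and `ConC_[0,1]` can encode a nested sequence of rational intervals, revealed step by step, so
that all solutions lie in the intersection (`CodesNested`). This defeats every random algorithm.
Wait until all but a small measure of the advices that have not failed have announced a precise
approximation of their result. Of many separated subintervals, one was announced by few advices, by
pigeonhole; shrink to that one (`RandomSolver.exists_refinement`). Iteration drives the measure of
successful advices to `0` (`RandomSolver.false_of_codesNested`). Las Vegas algorithms are random
algorithms by definition, and reductions to `WWKL` or `PC_ℝ` become such because a point of a set of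
positive measure can be guessed. Only null sets matter, so infinite measures are replaced by
equivalent finite ones.

Conversely, an instance of `WWKL` or `PC_ℝ` stays valid while sets of small total measure are
removed from it, and any announced result can be removed at arbitrarily small cost (`Erodible`). An
instance of `IVT` or `ConC_[0,1]` can be bisected, the current interval being kept by a finite part
of the name, unless a midpoint is a solution (`Bisectable`). If the former reduced to the latter,
removing the result computed from a solution `y` would force all solutions away from a neighbourhood
of `y`. So bisection can be continued by removing midpoints, and the limit of the intervals is a
solution that can be neither removed nor avoided (`not_reducible_of_erodible`).

For the positive statements, run a bisection that halves the interval whenever one half is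
confirmed. It either reaches all levels or stops at a level `k`, and then the midpoint is a
solution. The levels form a sequence of instances that converges to a code of `k` or to a code of
"never". The jump accepts this sequence, and its solution tells when to output the midpoint
(`BisectTest.reducible_jump`). What remains is to realise these codes by sets of positive measure
(`stuckAdvice_WWKL`, `stuckAdvice_PCUnit`). -/

@[simp] theorem length_pref {α : Type} (p : ℕ → α) (n : ℕ) : (pref p n).length = n := by
  simp [pref]

theorem getElem?_pref {α : Type} (p : ℕ → α) {n i : ℕ} (h : i < n) :
    (pref p n)[i]? = some (p i) := by
  simp [pref, h]

theorem pref_eq_iff {α : Type} {p q : ℕ → α} {n : ℕ} :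
    pref p n = pref q n ↔ ∀ i < n, p i = q i := by
  simp [pref]

theorem take_pref {α : Type} (p : ℕ → α) {m n : ℕ} (h : m ≤ n) :
    (pref p n).take m = pref p m := by
  simp [pref, ← List.map_take, List.take_range, h]

theorem pref_prefix {α : Type} (p : ℕ → α) {m n : ℕ} (h : m ≤ n) : pref p m <+: pref p n :=
  take_pref p h ▸ List.take_prefix _ _

theorem pref_eq_of_le {α : Type} {p q : ℕ → α} {m n : ℕ} (h : pref p n = pref q n) (hm : m ≤ n) :
    pref p m = pref q m :=
  pref_eq_iff.2 fun i hi => pref_eq_iff.1 h i (hi.trans_le hm)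

theorem eq_pref_of_prefix {α : Type} {p : ℕ → α} {l : List α} {n : ℕ} (h : l <+: pref p n) :
    l = pref p l.length := by
  have h1 := List.prefix_iff_eq_take.1 h
  have h2 : l.length ≤ n := by simpa using h.length_le
  rwa [take_pref p h2] at h1

theorem getElem?_of_prefix {α : Type} {l l' : List α} (h : l <+: l') {i : ℕ} {a : α}
    (hi : l[i]? = some a) : l'[i]? = some a := by
  obtain ⟨t, rfl⟩ := h
  rw [List.getElem?_append_left (List.getElem?_eq_some_iff.1 hi).1, hi]

/-- Word functions that are monotone for the prefix order. -/
def PrefixMono (φ : List ℕ → List ℕ) : Prop := ∀ u v : List ℕ, u <+: v → φ u <+: φ v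

/-- The words `φ (p|m)` exhaust the sequence `q`. -/
def Approximates (φ : List ℕ → List ℕ) (p q : Baire) : Prop :=
  ∀ n : ℕ, ∃ m : ℕ, pref q n <+: φ (pref p m)

/-- By monotonicity `φ (p|m)` and a prefix of `q` of the same length are both prefixes of one later
output word. Hence no output is ever revised. -/
theorem Approximates.eq_pref {φ : List ℕ → List ℕ} (hφ : PrefixMono φ) {p q : Baire}
    (h : Approximates φ p q) (m : ℕ) : φ (pref p m) = pref q (φ (pref p m)).length := by
  obtain ⟨m', hm'⟩ := h (φ (pref p m)).length
  have h1 := hφ _ _ (pref_prefix p (le_max_left m m'))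
  have h2 := hm'.trans (hφ _ _ (pref_prefix p (le_max_right m m')))
  exact (List.prefix_of_prefix_length_le h1 h2 (by simp)).eq_of_length (by simp)

theorem Approximates.continuity {φ : List ℕ → List ℕ} (hφ : PrefixMono φ) {p q : Baire}
    (h : Approximates φ p q) (n : ℕ) : ∃ m, ∀ p', pref p' m = pref p m → ∀ q',
      Approximates φ p' q' → pref q' n = pref q n := by
  obtain ⟨m, hm⟩ := h n
  refine ⟨m, fun p' hp' q' hq' => ?_⟩
  have h1 := hq'.eq_pref hφ m
  rw [hp'] at h1
  have h2 : n ≤ (φ (pref p m)).length := by simpa using hm.length_le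
  rw [h1] at hm
  have h3 := eq_pref_of_prefix hm
  simp only [length_pref] at h3
  exact h3.symm

theorem pref_pair_eq {p p' q q' : Baire} {n : ℕ} (hp : pref p n = pref p' n)
    (hq : pref q n = pref q' n) : pref (pair p q) (2 * n) = pref (pair p' q') (2 * n) := by
  rw [pref_eq_iff] at *
  intro i hi
  simp only [pair]
  split_ifs
  · exact hp _ (by omega)
  · exact hq _ (by omega)

/-- The topological content of a Weihrauch reduction. -/
theorem Reducible.exists_approximations {X Y Z W : Type} {f : Problem X Y} {g : Problem Z W}
    (h : Reducible f g) : ∃ φ ψ : List ℕ → List ℕ, PrefixMono φ ∧ PrefixMono ψ ∧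
      ∀ p x, f.source.IsName p x → x ∈ f.dom → ∃ k z, Approximates ψ p k ∧
        g.source.IsName k z ∧ z ∈ g.dom ∧ ∀ q, ∀ y ∈ g.val z, g.target.IsName q y →
          ∃ o, Approximates φ (pair p q) o ∧ ∃ v ∈ f.val x, f.target.IsName o v := by
  classical
  obtain ⟨H, K, ⟨φ, -, hφ, hH⟩, ⟨ψ, -, hψ, hK⟩, hG⟩ := h
  refine ⟨φ, ψ, hφ, hψ, fun p x hp hx => ?_⟩
  have sol : ∀ k : Baire, (∃ z, g.source.IsName k z ∧ z ∈ g.dom) →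
      ∃ q, ∃ z, g.source.IsName k z ∧ ∃ y ∈ g.val z, g.target.IsName q y := by
    rintro k ⟨z, hz, y, hy⟩
    obtain ⟨q, hq⟩ := g.target.surj y
    exact ⟨q, z, hz, y, hy, hq⟩
  -- Realizers need not be computable, so a choice of solutions is one. It is only used to learn
  -- that the query `k` exists.
  let G : Baire →. Baire := fun k => ⟨∃ z, g.source.IsName k z ∧ z ∈ g.dom,
    fun hk => (sol k hk).choose⟩
  have hGr : Realizes G g := by
    intro k z hz hd
    refine ⟨_, ⟨⟨z, hz, hd⟩, rfl⟩, ?_⟩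
    obtain ⟨z', hz', y, hy, hq⟩ := (sol k ⟨z, hz, hd⟩).choose_spec
    obtain rfl := g.source.unique _ _ _ hz hz'
    exact ⟨y, hy, hq⟩
  obtain ⟨o, ho, -⟩ := hG G hGr p x hp hx
  simp only [reduct, Part.mem_bind_iff] at ho
  obtain ⟨k, hk, q, ⟨⟨z, hz, hd⟩, -⟩, -⟩ := ho
  refine ⟨k, z, hK p k hk, hz, hd, fun q y hy hq => ?_⟩
  -- Changing the realizer at the single query `k` keeps it a realizer, so the reduction has to cope
  -- with every name of every solution.
  let G' : Baire →. Baire := fun k' => if k' = k then Part.some q else G k'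
  have hGr' : Realizes G' g := by
    intro k' z' hz' hd'
    by_cases hkk : k' = k
    · subst hkk
      obtain rfl := g.source.unique _ _ _ hz hz'
      exact ⟨q, by simp [G'], y, hy, hq⟩
    · simpa [G', hkk] using hGr k' z' hz' hd'
  obtain ⟨o, ho, v, hv, hov⟩ := hG G' hGr' p x hp hx
  simp only [reduct, Part.mem_bind_iff] at ho
  obtain ⟨k', hk', q', hq', ho⟩ := ho
  obtain rfl := Part.mem_unique hk hk'
  simp only [G', if_true, Part.mem_some_iff] at hq'
  subst hq'
  exact ⟨o, hH _ _ ho, v, hv, hov⟩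

/-! ### Problems that encode nested intervals have no random solutions -/

/-- Nested sequences of compact rational intervals inside `(0, 1)`. -/
def Nested (s : ℕ → ℚ × ℚ) : Prop :=
  ∀ n, 0 < (s n).1 ∧ (s n).1 ≤ (s n).2 ∧ (s n).2 < 1 ∧
    (s n).1 ≤ (s (n + 1)).1 ∧ (s (n + 1)).2 ≤ (s n).2

/-- `T` continuously maps nested sequences of intervals to names of instances of `f` all solutions
of which lie in the intersection of the intervals. -/
def CodesNested {X : Type} (f : Problem X unitInterval) (T : (ℕ → ℚ × ℚ) → Baire) : Prop :=
  (∀ s t n, pref s n = pref t n → pref (T s) n = pref (T t) n) ∧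
  ∀ s, Nested s → ∃ x ∈ f.dom, f.source.IsName (T s) x ∧
    ∀ y ∈ f.val x, ∀ n, ((s n).1 : ℝ) ≤ y ∧ (y : ℝ) ≤ (s n).2

/-- A continuous random algorithm for `f`: the advice `r` is successful on `p` if it belongs to
`U (p|n)` for all `n`, and then the words `Φ (p|n) r` exhaust the name of a solution. -/
structure RandomSolver {X Y : Type} (f : Problem X Y) {R : Type} [MeasurableSpace R]
    (μ : Measure R) where
  U : List ℕ → Set R
  Φ : List ℕ → R → List ℕ
  measurable_U : ∀ u, MeasurableSet (U u)
  measurable_Φ : ∀ u v, MeasurableSet {r | Φ u r = v}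
  anti_U : ∀ u v, u <+: v → U v ⊆ U u
  mono_Φ : ∀ u v r, u <+: v → Φ u r <+: Φ v r
  pos : ∀ p x, f.source.IsName p x → x ∈ f.dom → μ (⋂ n, U (pref p n)) ≠ 0
  correct : ∀ p x, f.source.IsName p x → x ∈ f.dom → ∀ r ∈ ⋂ n, U (pref p n),
    ∃ q, ∃ y ∈ f.val x, f.target.IsName q y ∧ ∀ n, ∃ m, pref q n <+: Φ (pref p m) r

theorem measurableSet_of_countable_fibers {R S : Type} [MeasurableSpace R] [Countable S]
    {g : R → S} (hg : ∀ v, MeasurableSet {r | g r = v}) (P : S → Prop) :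
    MeasurableSet {r | P (g r)} := by
  have : {r | P (g r)} = ⋃ v : {v // P v}, {r | g r = v} := by
    ext r; simp
  rw [this]
  exact MeasurableSet.iUnion fun v => hg v

namespace RandomSolver

variable {X : Type} {f : Problem X unitInterval} {R : Type} [MeasurableSpace R] {μ : Measure R}

/-- The advices that have not failed but have written at most `i` symbols decrease with the stage.
One belonging to all stages would be successful with a finite output, which `correct` forbids.
Finiteness of `μ` gives continuity from above. -/
theorem exists_small_stage [IsFiniteMeasure μ] (A : RandomSolver f μ) {p : Baire} {x : X}
    (hp : f.source.IsName p x) (hx : x ∈ f.dom) (i : ℕ) {ε : ENNReal} (hε : 0 < ε) :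
    ∃ N, ∀ n ≥ N, μ {r | r ∈ A.U (pref p n) ∧ (A.Φ (pref p n) r).length ≤ i} < ε := by
  set B : ℕ → Set R := fun n => {r | r ∈ A.U (pref p n) ∧ (A.Φ (pref p n) r).length ≤ i}
  have hB : ∀ n, MeasurableSet (B n) := fun n =>
    (A.measurable_U _).inter
      (measurableSet_of_countable_fibers (A.measurable_Φ (pref p n)) fun v => v.length ≤ i)
  have hanti : Antitone B := by
    intro m n hmn r hr
    have h := pref_prefix p hmn
    exact ⟨A.anti_U _ _ h hr.1, ((A.mono_Φ _ _ r h).length_le).trans hr.2⟩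
  have hempty : ⋂ n, B n = ∅ := by
    by_contra hne
    obtain ⟨r, hr⟩ := Set.nonempty_iff_ne_empty.2 hne
    rw [Set.mem_iInter] at hr
    obtain ⟨q, y, hy, hq, happ⟩ := A.correct p x hp hx r (Set.mem_iInter.2 fun n => (hr n).1)
    obtain ⟨m, hm⟩ := happ (i + 1)
    have h1 := hm.length_le
    have h2 := (hr m).2
    simp only [length_pref] at h1
    omega
  have ht := tendsto_measure_iInter_atTop (μ := μ) (fun n => (hB n).nullMeasurableSet) hanti
    ⟨0, measure_ne_top _ _⟩
  rw [hempty, measure_empty] at ht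
  exact eventually_atTop.1 (ht.eventually_lt_const hε)

/-- The pigeonhole principle: with `M * ε` above the total mass, `M` disjoint sets cannot all have
measure more than `ε`. -/
theorem exists_le_of_disjoint [IsFiniteMeasure μ] {ε : ENNReal} (hε : 0 < ε) : ∃ M : ℕ, 0 < M ∧
    ∀ C : Fin M → Set R, (∀ j, MeasurableSet (C j)) → Pairwise (Function.onFun Disjoint C) →
      ∃ j, μ (C j) ≤ ε := by
  obtain ⟨M, hM⟩ := ENNReal.exists_nat_mul_gt hε.ne' (measure_ne_top μ Set.univ)
  have hM0 : 0 < M := by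
    rcases Nat.eq_zero_or_pos M with rfl | h
    · simp at hM
    · exact h
  refine ⟨M, hM0, fun C hC hd => ?_⟩
  by_contra! hlt
  have h1 : ∑ j : Fin M, μ (C j) ≤ μ Set.univ := by
    rw [← tsum_fintype (L := .unconditional _), ← measure_iUnion hd hC]
    exact measure_mono (Set.subset_univ _)
  have h2 : (M : ENNReal) * ε ≤ ∑ j : Fin M, μ (C j) := by
    calc (M : ENNReal) * ε = ∑ j : Fin M, ε := by simp
      _ ≤ _ := Finset.sum_le_sum fun j _ => (hlt j).le
  exact absurd (h2.trans h1) (not_le.2 hM)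

/-- Switching from the sequence `s` to the constant sequence `I` at position `n`. -/
def switch (s : ℕ → ℚ × ℚ) (n : ℕ) (I : ℚ × ℚ) : ℕ → ℚ × ℚ := fun i => if i < n then s i else I

theorem nested_switch {s : ℕ → ℚ × ℚ} (hs : Nested s) {N n : ℕ} (hNn : N < n)
    (hc : ∀ m ≥ N, s m = s N) {I : ℚ × ℚ} (h1 : (s N).1 ≤ I.1) (h2 : I.1 ≤ I.2)
    (h3 : I.2 ≤ (s N).2) : Nested (switch s n I) := by
  intro m
  have hN := hs N
  have hm := hs m
  unfold switch
  rcases lt_trichotomy (m + 1) n with h | h | h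
  · rw [if_pos h, if_pos (by omega)]; exact hm
  · rw [if_neg (show ¬ m + 1 < n by omega), if_pos (show m < n by omega), hc m (by omega)]
    exact ⟨hN.1, hN.2.1, hN.2.2.1, h1, h3⟩
  · rw [if_neg (by omega), if_neg (by omega)]
    exact ⟨hN.1.trans_le h1, h2, h3.trans_lt hN.2.2.1, le_rfl, le_rfl⟩

/-- The adversary's move. Half of `ε` pays for the advices that are still too slow at stage `n`, the
other half for those whose announced approximation fits the chosen subinterval. All other advices
that have not failed have committed themselves to a value that is now wrong. -/
theorem exists_refinement [IsFiniteMeasure μ] (A : RandomSolver f μ)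
    (hf : f.target = cauchyRep unitSeq denseRange_unitSeq) {T : (ℕ → ℚ × ℚ) → Baire}
    (hT : CodesNested f T) {s : ℕ → ℚ × ℚ} (hs : Nested s) {N : ℕ} (hc : ∀ m ≥ N, s m = s N)
    (hlt : (s N).1 < (s N).2) {ε : ENNReal} (hε : 0 < ε) :
    ∃ n > N, ∃ I : ℚ × ℚ, I.1 < I.2 ∧ Nested (switch s n I) ∧
      ∀ t, Nested t → pref t (n + 1) = pref (switch s n I) (n + 1) →
        μ (⋂ n, A.U (pref (T t) n)) ≤ ε := by
  obtain ⟨x, hx, hp, -⟩ := hT.2 s hs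
  set p := T s
  have hε2 : 0 < ε / 2 := ENNReal.half_pos hε.ne'
  obtain ⟨M, hM, hpig⟩ := exists_le_of_disjoint (μ := μ) hε2
  set a := (s N).1
  set b := (s N).2
  set d : ℚ := (b - a) / (3 * M)
  have hMq : (0 : ℚ) < M := by exact_mod_cast hM
  have hd : 0 < d := div_pos (by linarith) (by positivity)
  have hdM : d * (3 * M) = b - a := by simp only [d]; field_simp
  -- Subintervals of length `d` with gaps `2 * d`. Values of precision less than `d / 2` are
  -- compatible with at most one of them.
  let J : Fin M → ℚ × ℚ := fun j => (a + d * (3 * j + 1), a + d * (3 * j + 2))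
  obtain ⟨i, hi⟩ : ∃ i : ℕ, (1 / 2 : ℝ) ^ i < (d : ℝ) / 2 :=
    exists_pow_lt_of_lt_one (by positivity) (by norm_num)
  obtain ⟨n₀, hn₀⟩ := A.exists_small_stage hp hx i hε2
  set n := max n₀ (N + 1)
  have hn := hn₀ n (le_max_left _ _)
  set B := {r | r ∈ A.U (pref p n) ∧ (A.Φ (pref p n) r).length ≤ i}
  -- The `i`-th output symbol is compatible with some point of `J j`.
  let P : Fin M → List ℕ → Prop := fun j v => ∃ c, v[i]? = some c ∧
    ∃ y : ℝ, ((J j).1 : ℝ) ≤ y ∧ y ≤ (J j).2 ∧ |(unitSeq c : ℝ) - y| ≤ (1 / 2 : ℝ) ^ i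
  have hPd : ∀ j k : Fin M, j < k → ∀ v, P j v → P k v → False := by
    rintro j k hjk v ⟨c, hc, y, -, hy, hcy⟩ ⟨c', hc', y', hy', -, hcy'⟩
    rw [hc] at hc'
    obtain rfl := Option.some.inj hc'
    rw [abs_le] at hcy hcy'
    simp only [J] at hy hy'
    push_cast at hy hy'
    have h1 : ((j : ℕ) : ℝ) + 1 ≤ (k : ℕ) := by exact_mod_cast hjk
    have h2 : (0 : ℝ) < d := by exact_mod_cast hd
    nlinarith
  obtain ⟨j, hj⟩ := hpig (fun j => {r | P j (A.Φ (pref p n) r)})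
    (fun j => measurableSet_of_countable_fibers (A.measurable_Φ _) (P j)) (by
      intro j k hjk
      rw [Function.onFun, Set.disjoint_left]
      intro r h1 h2
      rcases lt_or_gt_of_ne hjk with h | h
      · exact hPd j k h _ h1 h2
      · exact hPd k j h _ h2 h1)
  have hjM : ((j : ℕ) : ℚ) + 1 ≤ M := by exact_mod_cast j.2
  have hj0 : (0 : ℚ) ≤ ((j : ℕ) : ℚ) := by positivity
  refine ⟨n, lt_of_lt_of_le (Nat.lt_succ_self N) (le_max_right _ _), J j, ?_,
    nested_switch hs (lt_of_lt_of_le (Nat.lt_succ_self N) (le_max_right _ _)) hc ?_ ?_ ?_, ?_⟩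
  · simp only [J]; nlinarith
  · simp only [J]; change a ≤ _; nlinarith
  · simp only [J]; nlinarith
  · simp only [J]; change _ ≤ b; nlinarith
  intro t ht htp
  obtain ⟨x', hx', hp', hsol⟩ := hT.2 t ht
  -- The switch happens at position `n`, which the first `n` symbols of the name do not yet reflect;
  -- the random algorithm cannot have noticed it.
  have hagree : pref (T t) n = pref p n := by
    apply hT.1
    rw [pref_eq_iff] at htp ⊢
    intro k hk
    rw [htp k (by omega), switch, if_pos hk]
  have htn : t n = J j := by
    rw [pref_eq_iff.1 htp n (by omega), switch, if_neg (lt_irrefl n)]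
  have hsub : ⋂ n, A.U (pref (T t) n) ⊆ B ∪ {r | P j (A.Φ (pref p n) r)} := by
    intro r hr
    have hrn := Set.mem_iInter.1 hr n
    rw [hagree] at hrn
    by_cases hlen : (A.Φ (pref p n) r).length ≤ i
    · exact Or.inl ⟨hrn, hlen⟩
    · right
      push Not at hlen
      obtain ⟨q, y, hy, hq, happ⟩ := A.correct _ _ hp' hx' r hr
      have hyJ := hsol y hy n
      rw [htn] at hyJ
      rw [hf] at hq
      have hqi := hq i
      refine ⟨q i, ?_, y, hyJ.1, hyJ.2, hqi⟩
      obtain ⟨m, hm⟩ := happ (i + 1)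
      have h1 := A.mono_Φ _ _ r (pref_prefix (T t) (le_max_left n m))
      have h2 := hm.trans (A.mono_Φ _ _ r (pref_prefix (T t) (le_max_right n m)))
      -- The word written at stage `n` is longer than `i`, so its `i`-th symbol is already the final
      -- one, `q i`.
      have h3 := List.prefix_of_prefix_length_le h2 h1 (by rw [hagree]; simpa using hlen)
      rw [hagree] at h3
      exact getElem?_of_prefix h3 (getElem?_pref q (Nat.lt_succ_self i))
  calc μ (⋂ n, A.U (pref (T t) n)) ≤ μ (B ∪ {r | P j (A.Φ (pref p n) r)}) := measure_mono hsub
    _ ≤ μ B + μ {r | P j (A.Φ (pref p n) r)} := measure_union_le _ _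
    _ ≤ ε / 2 + ε / 2 := add_le_add hn.le hj
    _ = ε := ENNReal.add_halves ε

/-- Gluing a sequence of sequences that agree on longer and longer prefixes. -/
theorem exists_limit_sequence {α : Type} {s : ℕ → ℕ → α} {N : ℕ → ℕ} (hN : ∀ k, N k < N (k + 1))
    (h : ∀ k, pref (s (k + 1)) (N k) = pref (s k) (N k)) :
    ∃ t : ℕ → α, ∀ k, pref t (N k) = pref (s k) (N k) := by
  have hmono : StrictMono N := strictMono_nat_of_lt_succ hN
  have hstab : ∀ k j, pref (s (k + j)) (N k) = pref (s k) (N k) := by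
    intro k j
    induction j with
    | zero => rfl
    | succ j ih =>
      rw [← ih, ← Nat.add_assoc]
      exact pref_eq_of_le (h (k + j)) (hmono.monotone (Nat.le_add_right _ _))
  refine ⟨fun i => s (i + 1) i, fun k => pref_eq_iff.2 fun i hi => ?_⟩
  have hi' : i < N (i + 1) := (Nat.lt_succ_self i).trans_le (hmono.id_le (i + 1))
  rcases le_total k (i + 1) with hk | hk
  · obtain ⟨j, hj⟩ := Nat.exists_eq_add_of_le hk
    simp only [hj]
    exact pref_eq_iff.1 (hstab k j) i hi
  · obtain ⟨j, rfl⟩ := Nat.exists_eq_add_of_le hk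
    exact (pref_eq_iff.1 (hstab (i + 1) j) i hi').symm

/-- Refining with `ε = 2⁻ᵏ` for `k = 0, 1, …` and gluing gives one nested sequence on which the
successful advices have measure at most `2⁻ᵏ` for all `k`, against `pos`. -/
theorem false_of_codesNested [IsFiniteMeasure μ] (A : RandomSolver f μ)
    (hf : f.target = cauchyRep unitSeq denseRange_unitSeq) {T : (ℕ → ℚ × ℚ) → Baire}
    (hT : CodesNested f T) : False := by
  let State := {a : (ℕ → ℚ × ℚ) × ℕ //
    Nested a.1 ∧ (∀ m ≥ a.2, a.1 m = a.1 a.2) ∧ (a.1 a.2).1 < (a.1 a.2).2}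
  have hstep : ∀ (k : ℕ) (a : State), ∃ b : State, a.1.2 < b.1.2 ∧
      pref b.1.1 (a.1.2 + 1) = pref a.1.1 (a.1.2 + 1) ∧
      ∀ t, Nested t → pref t (b.1.2 + 1) = pref b.1.1 (b.1.2 + 1) →
        μ (⋂ n, A.U (pref (T t) n)) ≤ (2⁻¹ : ENNReal) ^ k := by
    rintro k ⟨⟨s, N⟩, hs, hc, hlt⟩
    obtain ⟨n, hn, I, hI, hnest, hsmall⟩ := A.exists_refinement hf hT hs hc hlt
      (ε := (2⁻¹ : ENNReal) ^ k) (ENNReal.pow_pos (by simp) k)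
    refine ⟨⟨(switch s n I, n), hnest, fun m hm => ?_, ?_⟩, hn, ?_, hsmall⟩
    · simp only [switch, if_neg (lt_irrefl n), if_neg (not_lt.2 hm)]
    · simpa only [switch, if_neg (lt_irrefl n)] using hI
    · refine pref_eq_iff.2 fun i hi => ?_
      simp only at hi hn ⊢
      rw [switch, if_pos (by omega)]
  choose next hnext1 hnext2 hnext3 using hstep
  let start : State := ⟨(fun _ => (1 / 3, 2 / 3), 0),
    fun n => by norm_num, fun _ _ => rfl, by norm_num⟩
  let st : ℕ → State := fun k => Nat.rec start next k
  obtain ⟨t, ht⟩ := exists_limit_sequence (s := fun k => (st k).1.1) (N := fun k => (st k).1.2 + 1)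
    (fun k => Nat.succ_lt_succ (hnext1 k (st k))) (fun k => hnext2 k (st k))
  -- Hence the glued sequence agrees with stage `n + 1` at positions `n` and `n + 1` and inherits
  -- nestedness from it.
  have hNk : ∀ k, k ≤ (st k).1.2 := by
    intro k
    induction k with
    | zero => exact Nat.zero_le _
    | succ k ih => exact lt_of_le_of_lt ih (hnext1 k (st k))
  have htn : Nested t := by
    intro n
    have h1 := pref_eq_iff.1 (ht (n + 1))
    have h2 := hNk (n + 1)
    rw [h1 n (by omega), h1 (n + 1) (by omega)]
    exact (st (n + 1)).2.1 n
  obtain ⟨x, hx, hp, -⟩ := hT.2 t htn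
  refine A.pos _ _ hp hx (le_antisymm (ge_of_tendsto' (ENNReal.tendsto_pow_atTop_nhds_zero_of_lt_one
    (r := 2⁻¹) (by simp)) fun k => ?_) zero_le)
  exact hnext3 k (st k) t htn (ht (k + 1))

end RandomSolver

/-! ### Connected choice and the intermediate value theorem encode nested intervals -/

/-- A code of a rational number. -/
noncomputable def ratCode (q : ℚ) : ℕ := Function.surjInv ratOf_surjective q

@[simp] theorem ratOf_ratCode (q : ℚ) : ratOf (ratCode q) = q := Function.surjInv_eq _ q

@[simp] theorem realSeq_ratCode (q : ℚ) : realSeq (ratCode q) = q := by simp [realSeq]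

theorem coe_unitSeq (n : ℕ) : (unitSeq n : ℝ) = max 0 (min 1 (realSeq n)) := rfl

namespace Nested

variable {s : ℕ → ℚ × ℚ}

theorem fst_le_snd (hs : Nested s) (m n : ℕ) : (s m).1 ≤ (s n).2 := by
  have h1 : Monotone fun n => (s n).1 := monotone_nat_of_le_succ fun n => (hs n).2.2.2.1
  have h2 : Antitone fun n => (s n).2 := antitone_nat_of_succ_le fun n => (hs n).2.2.2.2
  exact (h1 (le_max_left m n)).trans ((hs (max m n)).2.1.trans (h2 (le_max_right m n)))

theorem exists_mem (hs : Nested s) :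
    ∃ y : unitInterval, ∀ n, ((s n).1 : ℝ) ≤ y ∧ (y : ℝ) ≤ (s n).2 := by
  have hle : ∀ m n, ((s m).1 : ℝ) ≤ (s n).2 := fun m n => by exact_mod_cast hs.fst_le_snd m n
  have hb : BddAbove (Set.range fun n => ((s n).1 : ℝ)) :=
    ⟨_, by rintro _ ⟨m, rfl⟩; exact hle m 0⟩
  have h1 : ∀ n, ((s n).1 : ℝ) ≤ ⨆ n, ((s n).1 : ℝ) := fun n => le_ciSup hb n
  have h2 : ∀ n, ⨆ n, ((s n).1 : ℝ) ≤ (s n).2 := fun n => ciSup_le fun m => hle m n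
  have h3 : (0 : ℝ) < (s 0).1 := by exact_mod_cast (hs 0).1
  have h4 : ((s 0).2 : ℝ) < 1 := by exact_mod_cast (hs 0).2.2.1
  exact ⟨⟨⨆ n, ((s n).1 : ℝ), (h3.le.trans (h1 0)), ((h2 0).trans h4.le)⟩, fun n => ⟨h1 n, h2 n⟩⟩

end Nested

/-- The list of the complements of the intervals, as balls centered at the end points. -/
noncomputable def nestedBalls (s : ℕ → ℚ × ℚ) : Baire := fun n =>
  if n % 2 = 0 then Nat.pair (ratCode 0) (ratCode (s (n / 2)).1)
  else Nat.pair (ratCode 1) (ratCode (1 - (s (n / 2)).2))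

theorem ratBall_left (q : ℚ) : ratBall unitSeq (Nat.pair (ratCode 0) (ratCode q)) =
    {y : unitInterval | (y : ℝ) < q} := by
  ext y
  have := y.2.1
  simp [ratBall, Subtype.dist_eq, coe_unitSeq, abs_of_nonneg this]

theorem ratBall_right (q : ℚ) : ratBall unitSeq (Nat.pair (ratCode 1) (ratCode q)) =
    {y : unitInterval | 1 - (y : ℝ) < q} := by
  ext y
  have := y.2.2
  simp [ratBall, Subtype.dist_eq, coe_unitSeq, Real.dist_eq, abs_sub_comm (y : ℝ),
    abs_of_nonneg (sub_nonneg.2 this)]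

/-- An intersection of intervals is order convex, hence connected. Its complement is the union of
the listed balls, and symbol `n` depends only on interval `n / 2`. -/
theorem codesNested_ConCUnit : CodesNested ConCUnit nestedBalls := by
  refine ⟨fun s t n h => ?_, fun s hs => ?_⟩
  · rw [pref_eq_iff] at h ⊢
    intro i hi
    simp only [nestedBalls, h (i / 2) (by omega)]
  · let A : TopologicalSpace.Closeds unitInterval :=
      ⟨⋂ n, {y : unitInterval | ((s n).1 : ℝ) ≤ y ∧ (y : ℝ) ≤ (s n).2},
        isClosed_iInter fun n => (isClosed_le continuous_const continuous_subtype_val).inter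
          (isClosed_le continuous_subtype_val continuous_const)⟩
    have hA : ∀ y, y ∈ (A : Set unitInterval) ↔ ∀ n, ((s n).1 : ℝ) ≤ y ∧ (y : ℝ) ≤ (s n).2 :=
      fun y => Set.mem_iInter
    obtain ⟨y₀, hy₀⟩ := hs.exists_mem
    have hconn : IsConnected (A : Set unitInterval) := by
      refine ⟨⟨y₀, (hA y₀).2 hy₀⟩, Set.OrdConnected.isPreconnected ⟨?_⟩⟩
      intro x hx y hy z hz
      rw [hA] at *
      have h1 : (x : ℝ) ≤ z := hz.1
      have h2 : (z : ℝ) ≤ y := hz.2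
      exact fun n => ⟨(hx n).1.trans h1, h2.trans (hy n).2⟩
    refine ⟨A, ⟨y₀, hconn, (hA y₀).2 hy₀⟩, ?_, fun y hy => (hA y).1 hy.2⟩
    change (A : Set unitInterval)ᶜ = _
    ext y
    rw [Set.mem_compl_iff, hA, Set.mem_iUnion]
    simp only [not_forall, not_and_or, not_le]
    constructor
    · rintro ⟨n, h | h⟩
      · refine ⟨2 * n, ?_⟩
        rw [nestedBalls, if_pos (by omega), ratBall_left]
        simpa using h
      · refine ⟨2 * n + 1, ?_⟩
        rw [nestedBalls, if_neg (by omega), ratBall_right]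
        have : (2 * n + 1) / 2 = n := by omega
        simpa [this] using h
    · rintro ⟨n, h⟩
      refine ⟨n / 2, ?_⟩
      unfold nestedBalls at h
      split_ifs at h
      · rw [ratBall_left] at h
        exact Or.inl h
      · rw [ratBall_right] at h
        right
        simpa using h

/-! ### Continuous functions that vanish exactly on an intersection of nested intervals -/

/-- The piecewise linear function with zero set `[a, b]`. -/
noncomputable def plateau (I : ℚ × ℚ) (x : ℝ) : ℝ := min (x - I.1) 0 + max (x - I.2) 0

theorem continuous_plateau (I : ℚ × ℚ) : Continuous (plateau I) := by
  unfold plateau; fun_prop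

theorem abs_plateau_le {s : ℕ → ℚ × ℚ} (hs : Nested s) (n : ℕ) (x : unitInterval) :
    |plateau (s n) x| ≤ 1 := by
  obtain ⟨h1, h2, h3, -⟩ := hs n
  have g1 : (0 : ℝ) < (s n).1 := by exact_mod_cast h1
  have g2 : ((s n).1 : ℝ) ≤ (s n).2 := by exact_mod_cast h2
  have g3 : ((s n).2 : ℝ) < 1 := by exact_mod_cast h3
  have := x.2.1
  have := x.2.2
  unfold plateau
  rw [abs_le]
  constructor <;>
  rcases min_cases ((x : ℝ) - (s n).1) 0 with h | h <;>
  rcases max_cases ((x : ℝ) - (s n).2) 0 with h' | h' <;> rw [h.1, h'.1] <;> linarith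

theorem norm_term_le {s : ℕ → ℚ × ℚ} (hs : Nested s) (n : ℕ) (x : unitInterval) :
    ‖(1 / 2 : ℝ) ^ n * plateau (s n) x‖ ≤ (1 / 2 : ℝ) ^ n := by
  rw [norm_mul, Real.norm_eq_abs, Real.norm_eq_abs, abs_of_nonneg (by positivity)]
  exact mul_le_of_le_one_right (by positivity) (abs_plateau_le hs n x)

theorem summable_term {s : ℕ → ℚ × ℚ} (hs : Nested s) (x : unitInterval) :
    Summable fun n => (1 / 2 : ℝ) ^ n * plateau (s n) x :=
  Summable.of_norm_bounded summable_geometric_two fun n => norm_term_le hs n x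

/-- The continuous function whose zero set is the intersection of the intervals. -/
noncomputable def plateauSum {s : ℕ → ℚ × ℚ} (hs : Nested s) : C(unitInterval, ℝ) where
  toFun x := ∑' n, (1 / 2 : ℝ) ^ n * plateau (s n) x
  continuous_toFun := continuous_tsum
    (fun n => continuous_const.mul ((continuous_plateau (s n)).comp continuous_subtype_val))
    summable_geometric_two fun n x => norm_term_le hs n x

theorem plateauSum_tail_le {s : ℕ → ℚ × ℚ} (hs : Nested s) (k : ℕ) (x : unitInterval) :
    |plateauSum hs x - ∑ n ∈ Finset.range k, (1 / 2 : ℝ) ^ n * plateau (s n) x| ≤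
      2 * (1 / 2 : ℝ) ^ k := by
  have h1 := (summable_term hs x).sum_add_tsum_nat_add k
  have h2 : plateauSum hs x - ∑ n ∈ Finset.range k, (1 / 2 : ℝ) ^ n * plateau (s n) x =
      ∑' n, (1 / 2 : ℝ) ^ (n + k) * plateau (s (n + k)) x := by
    change (∑' n, (1 / 2 : ℝ) ^ n * plateau (s n) x) - _ = _
    rw [← h1]; ring
  rw [h2, ← Real.norm_eq_abs]
  refine tsum_of_norm_bounded (g := fun n => (1 / 2 : ℝ) ^ (n + k)) ?_
    fun n => norm_term_le hs (n + k) x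
  simp only [pow_add]
  exact hasSum_geometric_two.mul_right _

theorem plateauSum_sub_le {s t : ℕ → ℚ × ℚ} (hs : Nested s) (ht : Nested t) {k : ℕ}
    (h : pref t k = pref s k) (x : unitInterval) :
    |plateauSum ht x - plateauSum hs x| ≤ 4 * (1 / 2 : ℝ) ^ k := by
  have h1 := plateauSum_tail_le hs k x
  have h2 := plateauSum_tail_le ht k x
  have h3 : ∑ n ∈ Finset.range k, (1 / 2 : ℝ) ^ n * plateau (t n) x =
      ∑ n ∈ Finset.range k, (1 / 2 : ℝ) ^ n * plateau (s n) x :=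
    Finset.sum_congr rfl fun n hn => by rw [pref_eq_iff.1 h n (Finset.mem_range.1 hn)]
  rw [h3] at h2
  rw [abs_le] at *
  constructor <;> linarith [h1.1, h1.2, h2.1, h2.2]

/-- A point left of one interval is left of the right end point of every interval, so no term of the
sum is positive and the `n`-th is negative. `plateauSum_pos` is the mirror image. -/
theorem plateauSum_neg {s : ℕ → ℚ × ℚ} (hs : Nested s) {x : unitInterval} {n : ℕ}
    (h : (x : ℝ) < (s n).1) : plateauSum hs x < 0 := by
  have hle : ∀ m, plateau (s m) x ≤ 0 := by
    intro m
    have : ((s n).1 : ℝ) ≤ (s m).2 := by exact_mod_cast hs.fst_le_snd n m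
    rw [plateau, max_eq_right (by linarith), add_zero]
    exact min_le_right _ _
  have hlt : plateau (s n) x < 0 := by
    have : ((s n).1 : ℝ) ≤ (s n).2 := by exact_mod_cast hs.fst_le_snd n n
    rw [plateau, max_eq_right (by linarith), add_zero]
    exact (min_le_left _ _).trans_lt (by linarith)
  have := Summable.tsum_lt_tsum (f := fun n => (1 / 2 : ℝ) ^ n * plateau (s n) x)
    (g := fun _ => (0 : ℝ)) (i := n)
    (fun m => mul_nonpos_of_nonneg_of_nonpos (by positivity) (hle m))
    (mul_neg_of_pos_of_neg (by positivity) hlt) (summable_term hs x) summable_zero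
  rwa [tsum_zero] at this

theorem plateauSum_pos {s : ℕ → ℚ × ℚ} (hs : Nested s) {x : unitInterval} {n : ℕ}
    (h : ((s n).2 : ℝ) < x) : 0 < plateauSum hs x := by
  have hle : ∀ m, 0 ≤ plateau (s m) x := by
    intro m
    have : ((s m).1 : ℝ) ≤ (s n).2 := by exact_mod_cast hs.fst_le_snd m n
    rw [plateau, min_eq_right (by linarith), zero_add]
    exact le_max_right _ _
  have hlt : 0 < plateau (s n) x := by
    have : ((s n).1 : ℝ) ≤ (s n).2 := by exact_mod_cast hs.fst_le_snd n n
    rw [plateau, min_eq_right (by linarith), zero_add]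
    exact lt_max_of_lt_left (by linarith)
  have := Summable.tsum_lt_tsum (f := fun _ => (0 : ℝ))
    (g := fun n => (1 / 2 : ℝ) ^ n * plateau (s n) x) (i := n)
    (fun m => mul_nonneg (by positivity) (hle m))
    (mul_pos (by positivity) hlt) summable_zero (summable_term hs x)
  rwa [tsum_zero] at this

theorem plateauSum_eq_zero {s : ℕ → ℚ × ℚ} (hs : Nested s) {x : unitInterval}
    (h : ∀ n, ((s n).1 : ℝ) ≤ x ∧ (x : ℝ) ≤ (s n).2) : plateauSum hs x = 0 := by
  change ∑' n, (1 / 2 : ℝ) ^ n * plateau (s n) x = 0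
  have : ∀ n, plateau (s n) x = 0 := by
    intro n
    rw [plateau, min_eq_right (by linarith [(h n).1]), max_eq_right (by linarith [(h n).2]),
      add_zero]
  simp [this]

/-- Box inclusions on compact intervals are stable under small perturbations. -/
theorem MapsBox.exists_margin {f : C(unitInterval, ℝ)} {k : ℕ} (h : MapsBox f k) :
    ∃ ε > 0, ∀ g : C(unitInterval, ℝ), (∀ x, |g x - f x| < ε) → MapsBox g k := by
  have hK : IsCompact {x : unitInterval | realSeq k.unpair.1.unpair.1 ≤ x ∧
      (x : ℝ) ≤ realSeq k.unpair.1.unpair.2} :=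
    ((isClosed_le continuous_const continuous_subtype_val).inter
      (isClosed_le continuous_subtype_val continuous_const)).isCompact
  obtain ⟨ε, hε, hb⟩ := hK.exists_forall_le' (a := 0)
    (f := fun x => min (f x - realSeq k.unpair.2.unpair.1) (realSeq k.unpair.2.unpair.2 - f x))
    (Continuous.continuousOn (by fun_prop)) (fun x hx => by
      have := h x hx.1 hx.2
      exact lt_min (by linarith) (by linarith))
  refine ⟨ε, hε, fun g hg x h1 h2 => ?_⟩
  have h3 := hb x ⟨h1, h2⟩
  rw [le_min_iff] at h3
  have h4 := abs_lt.1 (hg x)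
  constructor <;> linarith [h3.1, h3.2, h4.1, h4.2]

/-- The code of a box with empty base, which is valid for every function. -/
noncomputable def emptyBox : ℕ := Nat.pair (Nat.pair (ratCode 1) (ratCode 0)) 0

theorem mapsBox_emptyBox (f : C(unitInterval, ℝ)) : MapsBox f emptyBox := by
  intro x h1 h2
  simp only [emptyBox, Nat.unpair_pair, realSeq_ratCode] at h1 h2
  push_cast at h1 h2
  linarith

open Classical in
/-- The list of the boxes that are forced by finitely many of the intervals. -/
noncomputable def nestedBoxes (s : ℕ → ℚ × ℚ) : Baire := fun n =>
  if ∀ t, ∀ ht : Nested t, pref t n.unpair.1 = pref s n.unpair.1 →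
    MapsBox (plateauSum ht) n.unpair.2 then n.unpair.2 else emptyBox

/-- Listing only boxes forced by the first `n.unpair.1 ≤ n` intervals makes the name depend
continuously on `s`. No valid box is lost: it is valid with a margin by compactness, and fixing `i`
intervals fixes the function up to `4 * 2⁻ⁱ`. -/
theorem codesNested_IVT : CodesNested IVT nestedBoxes := by
  refine ⟨fun s t n h => ?_, fun s hs => ?_⟩
  · refine pref_eq_iff.2 fun i hi => ?_
    have : pref s i.unpair.1 = pref t i.unpair.1 :=
      pref_eq_of_le h ((Nat.unpair_left_le i).trans hi.le)
    unfold nestedBoxes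
    rw [this]
  · obtain ⟨y, hy⟩ := hs.exists_mem
    have h0 : plateauSum hs 0 < 0 :=
      plateauSum_neg hs (n := 0) (by have := (hs 0).1; simpa using this)
    have h1 : 0 < plateauSum hs 1 :=
      plateauSum_pos hs (n := 0) (by have := (hs 0).2.2.1; simpa using mod_cast this)
    refine ⟨plateauSum hs, ⟨y, mul_neg_of_neg_of_pos h0 h1, plateauSum_eq_zero hs hy⟩, ?_, ?_⟩
    · change Set.range (nestedBoxes s) = _
      ext k
      constructor
      · rintro ⟨n, rfl⟩
        unfold nestedBoxes
        split_ifs with h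
        · exact h s hs rfl
        · exact mapsBox_emptyBox _
      · intro hk
        obtain ⟨ε, hε, hm⟩ := MapsBox.exists_margin hk
        obtain ⟨i, hi⟩ : ∃ i : ℕ, (1 / 2 : ℝ) ^ i < ε / 4 :=
          exists_pow_lt_of_lt_one (by positivity) (by norm_num)
        refine ⟨Nat.pair i k, ?_⟩
        unfold nestedBoxes
        rw [if_pos]
        · simp
        · intro t ht htp
          simp only [Nat.unpair_pair] at htp ⊢
          exact hm _ fun x => (plateauSum_sub_le hs ht htp x).trans_lt (by linarith)
    · rintro y ⟨-, hy⟩ n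
      constructor
      · by_contra! h
        exact (plateauSum_neg hs h).ne hy
      · by_contra! h
        exact (plateauSum_pos hs h).ne' hy

/-! ### Random algorithms from Las Vegas computability and from probabilistic choice -/

/-- The infinite sequence that starts with `u` and continues with zeros. -/
def pad (u : List ℕ) : Baire := fun i => u.getD i 0

theorem pref_pad {u v : List ℕ} (h : u <+: v) : pref (pad u) u.length = pref (pad v) u.length := by
  refine pref_eq_iff.2 fun i hi => ?_
  obtain ⟨t, rfl⟩ := h
  simp [pad, List.getElem?_append_left hi]

theorem pref_pad_pref (p : Baire) (n : ℕ) : pref (pad (pref p n)) n = pref p n := by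
  refine pref_eq_iff.2 fun i hi => ?_
  simp [pad, getElem?_pref p hi]

/-- The word of length `2|u|` that interleaves `u` and `q`. -/
def zipPref (u : List ℕ) (q : Baire) : List ℕ := pref (pair (pad u) q) (2 * u.length)

theorem zipPref_pref (p q : Baire) (n : ℕ) : zipPref (pref p n) q = pref (pair p q) (2 * n) := by
  rw [zipPref, length_pref]
  exact pref_pair_eq (pref_pad_pref p n) rfl

theorem zipPref_prefix {u v : List ℕ} (q : Baire) (h : u <+: v) : zipPref u q <+: zipPref v q := by
  rw [zipPref, pref_pair_eq (pref_pad h) rfl]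
  exact pref_prefix _ (by have := h.length_le; omega)

theorem measurableSet_pref_eq {R S : Type} [MeasurableSpace R] [MeasurableSpace S]
    [MeasurableSingletonClass S] {e : R → ℕ → S} (he : Measurable e) (n : ℕ) (v : List S) :
    MeasurableSet {r | pref (e r) n = v} := by
  have : {r | pref (e r) n = v} =
      if v.length = n then ⋂ i : Fin v.length, {r | e r i = v[i]} else ∅ := by
    ext r
    split_ifs with h
    · simp only [Set.mem_ofPred_eq, Set.mem_iInter]
      constructor
      · rintro rfl i
        rw [Fin.getElem_fin]
        simp [pref]
      · intro hr
        refine List.ext_getElem (by simp [h]) fun i h1 h2 => ?_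
        simpa [pref] using hr ⟨i, h2⟩
    · simp only [Set.mem_ofPred_eq, Set.mem_empty_iff_false, iff_false]
      rintro rfl
      simp at h
  rw [this]
  split_ifs
  · exact MeasurableSet.iInter fun i =>
      ((measurable_pi_apply (i : ℕ)).comp he) (measurableSet_singleton v[i])
  · exact MeasurableSet.empty

theorem measurableSet_zipPref {R : Type} [MeasurableSpace R] {e : R → Baire} (he : Measurable e)
    (u : List ℕ) (P : List ℕ → Prop) : MeasurableSet {r | P (zipPref u (e r))} := by
  refine measurableSet_of_countable_fibers (fun v => measurableSet_pref_eq ?_ _ v) P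
  refine measurable_pi_iff.2 fun n => ?_
  unfold pair
  split_ifs
  · exact measurable_const
  · exact (measurable_pi_apply _).comp he

theorem approximates_zipPref {φ : List ℕ → List ℕ} (hφ : PrefixMono φ) {p q o : Baire}
    (h : Approximates φ (pair p q) o) (n : ℕ) : ∃ m, pref o n <+: φ (zipPref (pref p m) q) := by
  obtain ⟨m, hm⟩ := h n
  refine ⟨m, ?_⟩
  rw [zipPref_pref]
  exact hm.trans (hφ _ _ (pref_prefix _ (by omega)))

/-- Failure of an advice is visible as a nonzero symbol of `F₂` at a finite stage, so the advices
without such a symbol form the sets `U`. Since `F₂` is defined for all advices, never seeing a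
nonzero symbol means that its value is the zero sequence. -/
theorem exists_randomSolver_of_lasVegasOver {X Y : Type} {f : Problem X Y} {R : Type}
    [MeasurableSpace R] {e : R → Baire} (he : Measurable e) {μ : Measure R} {I : Set ENNReal}
    (hI : 0 ∉ I) (h : LasVegasOver e μ I f) : Nonempty (RandomSolver f μ) := by
  obtain ⟨F₁, F₂, ⟨φ₁, -, hφ₁, h₁⟩, ⟨φ₂, -, hφ₂, h₂⟩, h⟩ := h
  have key : ∀ p x, f.source.IsName p x → x ∈ f.dom → ∀ r,
      (r ∈ ⋂ n, {r | ∀ c ∈ φ₂ (zipPref (pref p n) (e r)), c = 0}) ↔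
        (fun _ => 0) ∈ F₂ (pair p (e r)) := by
    intro p x hp hx r
    obtain ⟨q, hq⟩ := Part.dom_iff_mem.1 ((h p x hp hx).1 r)
    have ha : Approximates φ₂ (pair p (e r)) q := h₂ _ q hq
    have hq0 : (fun _ => 0) ∈ F₂ (pair p (e r)) ↔ ∀ n, q n = 0 :=
      ⟨fun h0 n => congrFun (Part.mem_unique hq h0) n, fun h0 => by
        convert hq using 1; exact (funext h0).symm⟩
    rw [hq0, Set.mem_iInter]
    constructor
    · intro hr n
      obtain ⟨m, hm⟩ := approximates_zipPref hφ₂ ha (n + 1)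
      exact hr m _ (List.mem_of_getElem? (getElem?_of_prefix hm (getElem?_pref q n.lt_succ_self)))
    · intro h0 n c hc
      rw [zipPref_pref, ha.eq_pref hφ₂] at hc
      simp only [pref, List.mem_map] at hc
      obtain ⟨i, -, rfl⟩ := hc
      exact h0 i
  refine ⟨{
    U := fun u => {r | ∀ c ∈ φ₂ (zipPref u (e r)), c = 0}
    Φ := fun u r => φ₁ (zipPref u (e r))
    measurable_U := fun u => measurableSet_zipPref he u fun w => ∀ c ∈ φ₂ w, c = 0
    measurable_Φ := fun u v => measurableSet_zipPref he u fun w => φ₁ w = v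
    anti_U := fun u v huv r hr c hc => hr c ((hφ₂ _ _ (zipPref_prefix _ huv)).subset hc)
    mono_Φ := fun u v r huv => hφ₁ _ _ (zipPref_prefix _ huv)
    pos := fun p x hp hx h0 => hI ?_
    correct := fun p x hp hx r hr => ?_ }⟩
  · have := (h p x hp hx).2.2.1
    have hS : {r | (fun _ => 0) ∈ F₂ (pair p (e r))} =
        ⋂ n, {r | ∀ c ∈ φ₂ (zipPref (pref p n) (e r)), c = 0} :=
      Set.ext fun r => (key p x hp hx r).symm
    rwa [hS, h0] at this
  · obtain ⟨q, hq, y, hy, hqy⟩ := (h p x hp hx).2.2.2 r ((key p x hp hx r).1 hr)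
    exact ⟨q, y, hy, hqy, approximates_zipPref hφ₁ (h₁ _ q hq)⟩

theorem measurable_cantorCode : Measurable cantorCode :=
  measurable_pi_iff.2 fun n => (measurable_of_countable Bool.toNat).comp (measurable_pi_apply n)

theorem measurable_natCantorCode : Measurable natCantorCode := by
  refine measurable_pi_iff.2 fun n => ?_
  cases n with
  | zero => exact measurable_fst
  | succ n => exact ((measurable_pi_apply n).comp measurable_cantorCode).comp measurable_snd

instance : IsProbabilityMeasure cantorMeasure := by
  unfold cantorMeasure; infer_instance

/-- Random algorithms only depend on the null sets of the measure. -/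
def RandomSolver.congr {X Y : Type} {f : Problem X Y} {R : Type} [MeasurableSpace R]
    {μ ν : Measure R} (A : RandomSolver f μ) (h : μ ≪ ν) : RandomSolver f ν :=
  { A with pos := fun p x hp hx h0 => A.pos p x hp hx (h h0) }

theorem not_lasVegasComputable {X : Type} {f : Problem X unitInterval}
    (hf : f.target = cauchyRep unitSeq denseRange_unitSeq) {T : (ℕ → ℚ × ℚ) → Baire}
    (hT : CodesNested f T) : ¬ LasVegasComputable f := fun h => by
  obtain ⟨A⟩ := exists_randomSolver_of_lasVegasOver measurable_cantorCode (by simp) h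
  exact A.false_of_codesNested hf hT

/-- The product measure is infinite, but it is absolutely continuous with respect to a finite
measure, and a random solver only needs its success sets to be non-null. -/
theorem not_lasVegasComputableFMC {X : Type} {f : Problem X unitInterval}
    (hf : f.target = cauchyRep unitSeq denseRange_unitSeq) {T : (ℕ → ℚ × ℚ) → Baire}
    (hT : CodesNested f T) : ¬ LasVegasComputableFMC f := fun h => by
  obtain ⟨A⟩ := exists_randomSolver_of_lasVegasOver measurable_natCantorCode (by simp) h
  exact (A.congr (absolutelyContinuous_toFinite _)).false_of_codesNested hf hT

/-- A reduction to a problem `g` whose solutions can be guessed with positive probability. The sets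
`V w` contain the advices that are consistent with the beginning `w` of a name. -/
theorem Reducible.exists_randomSolver {X Y Z W : Type} {f : Problem X Y} {g : Problem Z W}
    (h : Reducible f g) {R : Type} [MeasurableSpace R] {e : R → Baire} (he : Measurable e)
    {μ : Measure R} (V : List ℕ → Set R) (hV : ∀ w, MeasurableSet (V w))
    (hVanti : ∀ u v, u <+: v → V v ⊆ V u)
    (hpos : ∀ k z, g.source.IsName k z → z ∈ g.dom → μ (⋂ n, V (pref k n)) ≠ 0)
    (hsol : ∀ k z, g.source.IsName k z → z ∈ g.dom → ∀ r ∈ ⋂ n, V (pref k n),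
      ∃ y ∈ g.val z, g.target.IsName (e r) y) : Nonempty (RandomSolver f μ) := by
  obtain ⟨φ, ψ, hφ, hψ, h⟩ := h.exists_approximations
  -- Consistency with the words produced by `ψ` is the same as consistency with all prefixes of the
  -- query, as these words exhaust it.
  have key : ∀ p k, Approximates ψ p k → ⋂ n, V (ψ (pref p n)) = ⋂ n, V (pref k n) := by
    intro p k hk
    ext r
    simp only [Set.mem_iInter]
    constructor
    · intro hr n
      obtain ⟨m, hm⟩ := hk n
      exact hVanti _ _ hm (hr m)
    · intro hr n
      rw [hk.eq_pref hψ n]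
      exact hr _
  refine ⟨{
    U := fun u => V (ψ u)
    Φ := fun u r => φ (zipPref u (e r))
    measurable_U := fun u => hV _
    measurable_Φ := fun u v => measurableSet_zipPref he u fun w => φ w = v
    anti_U := fun u v huv => hVanti _ _ (hψ _ _ huv)
    mono_Φ := fun u v r huv => hφ _ _ (zipPref_prefix _ huv)
    pos := fun p x hp hx => ?_
    correct := fun p x hp hx r hr => ?_ }⟩
  · obtain ⟨k, z, hk, hkz, hz, -⟩ := h p x hp hx
    rw [key p k hk]
    exact hpos k z hkz hz
  · obtain ⟨k, z, hk, hkz, hz, hH⟩ := h p x hp hx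
    rw [key p k hk] at hr
    obtain ⟨y, hy, hey⟩ := hsol k z hkz hz r hr
    obtain ⟨o, ho, v, hv, hov⟩ := hH (e r) y hy hey
    exact ⟨o, v, hv, hov, approximates_zipPref hφ ho⟩

/-- The advice is taken as the path. It fails once the name of the tree shows the value `0` at one
of its prefixes, so the advices that never fail are exactly the paths. -/
theorem Reducible.exists_randomSolver_of_WWKL {X Y : Type} {f : Problem X Y}
    (h : Reducible f WWKL) : Nonempty (RandomSolver f cantorMeasure) := by
  have key : ∀ k T, treeRep.IsName k T →
      ⋂ n, {x : Cantor | ∀ j, (pref k n)[Encodable.encode (pref x j)]? ≠ some 0} = T.paths := by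
    intro k T hk
    ext x
    simp only [Set.mem_iInter, Set.mem_ofPred_eq, BinTree.paths]
    constructor
    · intro hx j
      by_contra hj
      refine hx (Encodable.encode (pref x j) + 1) j ?_
      rw [getElem?_pref k (Nat.lt_succ_self _), (hk _).2 hj]
    · intro hx n j h0
      have hlt := (List.getElem?_eq_some_iff.1 h0).1
      rw [length_pref] at hlt
      rw [getElem?_pref k hlt, (hk _).1 (hx j)] at h0
      simp at h0
  refine h.exists_randomSolver measurable_cantorCode
    (fun w => {x | ∀ j, w[Encodable.encode (pref x j)]? ≠ some 0}) (fun w => ?_)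
    (fun u v huv x hx j h0 => hx j (getElem?_of_prefix huv h0)) (fun k T hk hT => ?_)
    fun k T hk hT x hx => ?_
  · rw [Set.ofPred_forall]
    exact MeasurableSet.iInter fun j => measurableSet_of_countable_fibers
      (measurableSet_pref_eq measurable_id j) fun v => w[Encodable.encode v]? ≠ some 0
  · rw [key k T hk]
    obtain ⟨x, hx, -⟩ := hT
    exact hx.ne'
  · rw [key k T hk] at hx
    obtain ⟨x', hx', -⟩ := hT
    exact ⟨x, ⟨hx', hx⟩, rfl⟩

/-- A measurable choice of names of real numbers. -/
noncomputable def floorName (y : ℝ) : Baire := fun n => ratCode (⌊(2 : ℝ) ^ n * y⌋ / 2 ^ n)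

theorem measurable_floorName : Measurable floorName :=
  measurable_pi_iff.2 fun n =>
    (measurable_of_countable fun z : ℤ => ratCode ((z : ℚ) / 2 ^ n)).comp
      (Int.measurable_floor.comp (measurable_const_mul _))

theorem isName_floorName (y : ℝ) : (cauchyRep realSeq denseRange_realSeq).IsName (floorName y) y := by
  intro n
  have h1 := Int.floor_le ((2 : ℝ) ^ n * y)
  have h2 := Int.lt_floor_add_one ((2 : ℝ) ^ n * y)
  have h3 : (0 : ℝ) < 2 ^ n := by positivity
  rw [floorName, realSeq_ratCode, Real.dist_eq]
  push_cast
  have h4 : (⌊(2 : ℝ) ^ n * y⌋ : ℝ) / 2 ^ n - y = (⌊(2 : ℝ) ^ n * y⌋ - 2 ^ n * y) / 2 ^ n := by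
    field_simp
  rw [h4, abs_div, abs_of_pos h3, one_div, inv_pow, ← one_div]
  gcongr
  rw [abs_le]
  constructor <;> linarith

/-- The advice is a real number, read through the measurable choice of names `floorName`. It fails
once it lies in a listed ball. -/
theorem Reducible.exists_randomSolver_of_PCReal {X Y : Type} {f : Problem X Y}
    (h : Reducible f PCReal) : Nonempty (RandomSolver f (volume : Measure ℝ)) := by
  have key : ∀ k A, PCReal.source.IsName k A →
      ⋂ n, {y : ℝ | ∀ i ∈ pref k n, y ∉ ratBall realSeq i} = (A : Set ℝ) := by
    intro k A hk
    change (A : Set ℝ)ᶜ = _ at hk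
    rw [← compl_compl (A : Set ℝ), hk]
    ext y
    simp only [Set.mem_iInter, Set.mem_ofPred_eq, Set.mem_compl_iff, Set.mem_iUnion, not_exists,
      pref, List.mem_map, List.mem_range]
    constructor
    · exact fun hy i => hy (i + 1) _ ⟨i, Nat.lt_succ_self i, rfl⟩
    · rintro hy n _ ⟨i, -, rfl⟩
      exact hy i
  refine h.exists_randomSolver measurable_floorName
    (fun w => {y | ∀ i ∈ w, y ∉ ratBall realSeq i}) (fun w => ?_)
    (fun u v huv y hy i hi => hy i (huv.subset hi)) (fun k A hk hA => ?_) fun k A hk hA y hy => ?_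
  · have : {y : ℝ | ∀ i ∈ w, y ∉ ratBall realSeq i} =
        ⋂ i : {i // i ∈ w}, (ratBall realSeq i)ᶜ := by ext; simp
    rw [this]
    exact MeasurableSet.iInter fun i => Metric.isOpen_ball.measurableSet.compl
  · rw [key k A hk]
    obtain ⟨x, hx, -⟩ := hA
    exact hx.ne'
  · rw [key k A hk] at hy
    obtain ⟨x, hx, -⟩ := hA
    exact ⟨y, ⟨hx, hy⟩, isName_floorName y⟩

theorem not_reducible_WWKL {X : Type} {f : Problem X unitInterval}
    (hf : f.target = cauchyRep unitSeq denseRange_unitSeq) {T : (ℕ → ℚ × ℚ) → Baire}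
    (hT : CodesNested f T) : ¬ Reducible f WWKL := fun h => by
  obtain ⟨A⟩ := h.exists_randomSolver_of_WWKL
  exact A.false_of_codesNested hf hT

theorem not_reducible_PCReal {X : Type} {f : Problem X unitInterval}
    (hf : f.target = cauchyRep unitSeq denseRange_unitSeq) {T : (ℕ → ℚ × ℚ) → Baire}
    (hT : CodesNested f T) : ¬ Reducible f PCReal := fun h => by
  obtain ⟨A⟩ := h.exists_randomSolver_of_PCReal
  exact (A.congr (absolutelyContinuous_toFinite _)).false_of_codesNested hf hT

/-! ### Problems that do not reduce to problems solvable by bisection -/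

/-- `T` continuously maps sequences of tokens of total weight less than `1` to names of instances of
`f`; every possible result is excluded by some token of arbitrarily small weight. -/
structure Erodible {X Y : Type} (f : Problem X Y) {τ : Type} (o : τ) (w : τ → ENNReal)
    (T : (ℕ → τ) → Baire) : Prop where
  weight_zero : w o = 0
  lipschitz : ∀ s t n, pref s n = pref t n → pref (T s) n = pref (T t) n
  valid : ∀ s, ∑' i, w (s i) < 1 → ∃ x ∈ f.dom, f.source.IsName (T s) x
  erode : ∀ z y, f.target.IsName z y → ∀ ε > 0, ∃ t l, w t ≤ ε ∧ ∀ s x,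
    f.source.IsName (T s) x → (∃ i, s i = t) → ∀ v ∈ f.val x, ∀ z', f.target.IsName z' v →
      pref z' l ≠ pref z l

/-- `Q k a b` expresses that the instance with name `k` has a solution in `[a, b]` for a reason that
is stable under small changes of `k` and under bisection as long as no midpoint is a solution. -/
structure Bisectable {Z : Type} (g : Problem Z unitInterval) (Q : Baire → ℝ → ℝ → Prop) : Prop where
  target : g.target = cauchyRep unitSeq denseRange_unitSeq
  closed : ∀ z, IsClosed (g.val z)
  stable : ∀ k z a b, g.source.IsName k z → z ∈ g.dom → Q k a b → ∃ n, ∀ k' z',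
    g.source.IsName k' z' → z' ∈ g.dom → pref k' n = pref k n → Q k' a b
  solvable : ∀ k z a b, g.source.IsName k z → z ∈ g.dom → Q k a b →
    ∃ y ∈ g.val z, a ≤ y ∧ (y : ℝ) ≤ b
  split : ∀ k z a b, g.source.IsName k z → z ∈ g.dom → Q k a b →
    (∃ y ∈ g.val z, (y : ℝ) = (a + b) / 2) ∨ Q k a ((a + b) / 2) ∨ Q k ((a + b) / 2) b
  init : ∃ a b, a < b ∧ ∀ k z, g.source.IsName k z → z ∈ g.dom → Q k a b

/-- Every point has a name all of whose prefixes are shared by names of all nearby points. -/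
theorem exists_stable_name {Y : Type} [MetricSpace Y] {α : ℕ → Y} (hα : DenseRange α) (y : Y) :
    ∃ q, (cauchyRep α hα).IsName q y ∧ ∀ m, ∃ δ > 0, ∀ y', dist y' y < δ →
      ∃ q', (cauchyRep α hα).IsName q' y' ∧ pref q' m = pref q m := by
  -- Half of the permitted error is left unused, so that the first `m` entries also serve points at
  -- distance less than `2⁻ᵐ / 2`.
  have h : ∀ n : ℕ, ∃ k, dist y (α k) < (1 / 2 : ℝ) ^ n / 2 := fun n =>
    hα.exists_dist_lt y (by positivity)
  choose q hq using h
  refine ⟨q, fun n => ?_, fun m => ⟨(1 / 2 : ℝ) ^ m / 2, by positivity, fun y' hy' => ?_⟩⟩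
  · rw [dist_comm]
    exact (hq n).le.trans (half_le_self (by positivity))
  · obtain ⟨q₁, hq₁⟩ := (cauchyRep α hα).surj y'
    refine ⟨fun i => if i < m then q i else q₁ i, fun n => ?_, pref_eq_iff.2 fun i hi => if_pos hi⟩
    by_cases hn : n < m
    · simp only [if_pos hn]
      have h1 := dist_triangle (α (q n)) y y'
      have h2 := hq n
      have h3 : (1 / 2 : ℝ) ^ m ≤ (1 / 2 : ℝ) ^ n :=
        pow_le_pow_of_le_one (by norm_num) (by norm_num) hn.le
      rw [dist_comm y'] at hy'
      rw [dist_comm (α (q n)) y] at h1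
      linarith
    · simp only [if_neg hn]
      exact hq₁ n

/-- The sequence `s` up to position `n`, followed by `t` and then `o` forever. -/
def cutAt {τ : Type} (s : ℕ → τ) (n : ℕ) (t o : τ) : ℕ → τ :=
  fun i => if i < n then s i else if i = n then t else o

theorem tsum_cutAt_le {τ : Type} {o : τ} {w : τ → ENNReal} (ho : w o = 0) (s : ℕ → τ) (n : ℕ)
    (t : τ) : ∑' i, w (cutAt s n t o i) ≤ ∑' i, w (s i) + w t := by
  calc ∑' i, w (cutAt s n t o i) ≤ ∑' i, (w (s i) + if i = n then w t else 0) := by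
        refine ENNReal.tsum_le_tsum fun i => ?_
        unfold cutAt
        split_ifs with h1 h2 h2
        · omega
        · simp
        · exact le_add_self
        · simp [ho]
    _ = _ := by rw [ENNReal.tsum_add, tsum_ite_eq]

/-- A token that removes the result computed from a solution `y` forces all solutions of the changed
`g`-instance to stay away from `y` (`hkill`). Midpoints that are solutions are expelled in this way
and bisection goes on. In the limit the intervals shrink to a solution `y₀`. Expelling `y₀` by a
sufficiently late token contradicts stability, which still provides a solution in a tiny interval
around `y₀`. -/
theorem not_reducible_of_erodible {X Y Z : Type} {f : Problem X Y} {g : Problem Z unitInterval}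
    {τ : Type} {o : τ} {w : τ → ENNReal} {T : (ℕ → τ) → Baire} {Q : Baire → ℝ → ℝ → Prop}
    (hf : Erodible f o w T) (hg : Bisectable g Q) : ¬ Reducible f g := by
  intro hred
  obtain ⟨φ, ψ, hφ, hψ, hr⟩ := hred.exists_approximations
  have hrun : ∀ s : {s : ℕ → τ // ∑' i, w (s i) < 1}, ∃ x k z, f.source.IsName (T s.1) x ∧
      Approximates ψ (T s.1) k ∧ g.source.IsName k z ∧ z ∈ g.dom ∧
      ∀ q, ∀ y ∈ g.val z, g.target.IsName q y →
        ∃ o, Approximates φ (pair (T s.1) q) o ∧ ∃ v ∈ f.val x, f.target.IsName o v := by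
    rintro ⟨s, hs⟩
    obtain ⟨x, hx, hp⟩ := hf.valid s hs
    obtain ⟨k, z, h⟩ := hr _ x hp hx
    exact ⟨x, k, z, hp, h⟩
  choose x k z hx hk hkz hz hH using hrun
  have hcont : ∀ s n, ∃ m, ∀ s', pref s'.1 m = pref s.1 m → pref (k s') n = pref (k s) n := by
    intro s n
    obtain ⟨m, hm⟩ := (hk s).continuity hψ n
    exact ⟨m, fun s' hs' => hm _ (hf.lipschitz _ _ _ hs') _ (hk s')⟩
  have hQ : ∀ s a b, Q (k s) a b → ∃ n, ∀ s', pref s'.1 n = pref s.1 n → Q (k s') a b := by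
    intro s a b h
    obtain ⟨n, hn⟩ := hg.stable _ _ a b (hkz s) (hz s) h
    obtain ⟨m, hm⟩ := hcont s n
    exact ⟨m, fun s' hs' => hn _ _ (hkz s') (hz s') (hm s' hs')⟩
  -- The radius `δ` is fixed before the position `n`: the result on a stable name of `y` depends on
  -- `m` symbols only, and the token may be inserted at any position from `m` on.
  have hkill : ∀ s, ∀ y ∈ g.val (z s), ∀ ε > 0, ∑' i, w (s.1 i) + ε < 1 → ∃ δ > 0, ∀ n, ∃ s',
      pref s'.1 n = pref s.1 n ∧ ∑' i, w (s'.1 i) ≤ ∑' i, w (s.1 i) + ε ∧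
        ∀ y' ∈ g.val (z s'), δ ≤ dist y' y := by
    intro s y hy ε hε hsum
    obtain ⟨q, hq, hqs⟩ := exists_stable_name denseRange_unitSeq y
    rw [← hg.target] at hq hqs
    obtain ⟨u, hu, v, hv, huv⟩ := hH s q y hy hq
    obtain ⟨t, l, ht, hl⟩ := hf.erode u v huv ε hε
    obtain ⟨m, hm⟩ := hu.continuity hφ l
    obtain ⟨δ, hδ, hδy⟩ := hqs m
    refine ⟨δ, hδ, fun n => ?_⟩
    have hle : ∑' i, w (cutAt s.1 (max n m) t o i) ≤ ∑' i, w (s.1 i) + ε :=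
      (tsum_cutAt_le hf.weight_zero _ _ _).trans (by gcongr)
    have hag : pref (cutAt s.1 (max n m) t o) (max n m) = pref s.1 (max n m) :=
      pref_eq_iff.2 fun i hi => if_pos hi
    refine ⟨⟨cutAt s.1 (max n m) t o, hle.trans_lt hsum⟩, pref_eq_of_le hag (le_max_left _ _), hle,
      fun y' hy' => ?_⟩
    by_contra! hlt
    obtain ⟨q', hq', hqq⟩ := hδy y' hlt
    obtain ⟨u', hu', v', hv', huv'⟩ := hH _ q' y' hy' hq'
    refine hl _ _ (hx _) ⟨max n m, ?_⟩ v' hv' u' huv' (hm _ ?_ u' hu')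
    · simp [cutAt]
    · exact pref_eq_of_le (pref_pair_eq (hf.lipschitz _ _ _ (pref_eq_of_le hag (le_max_right _ _)))
        hqq) (by omega)
  -- A stage consists of a token sequence with a frozen prefix, an interval for which `Q` holds
  -- whenever that prefix is kept, and a remaining budget. Weight and budget together stay at most
  -- `1 / 2`, which leaves room for a final token.
  let State := {a : ({s : ℕ → τ // ∑' i, w (s i) < 1} × ℕ) × (ℝ × ℝ) × ENNReal //
    0 < a.2.2 ∧ ∑' i, w (a.1.1.1 i) + a.2.2 ≤ 1 / 2 ∧ a.2.1.1 < a.2.1.2 ∧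
      ∀ s' : {s : ℕ → τ // ∑' i, w (s i) < 1},
        pref s'.1 a.1.2 = pref a.1.1.1 a.1.2 → Q (k s') a.2.1.1 a.2.1.2}
  have hhalf : (1 / 2 : ENNReal) < 1 := by
    rw [one_div]; exact ENNReal.inv_lt_one.2 (by norm_num)
  have hstep : ∀ A : State, ∃ B : State, A.1.1.2 < B.1.1.2 ∧
      pref B.1.1.1.1 A.1.1.2 = pref A.1.1.1.1 A.1.1.2 ∧ A.1.2.1.1 ≤ B.1.2.1.1 ∧
      B.1.2.1.2 ≤ A.1.2.1.2 ∧ B.1.2.1.2 - B.1.2.1.1 = (A.1.2.1.2 - A.1.2.1.1) / 2 := by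
    rintro ⟨⟨⟨s, N⟩, ⟨a, b⟩, c⟩, hc, hsum, hab, hs⟩
    simp only at hc hsum hab hs ⊢
    have hc2 : 0 < c / 2 := ENNReal.half_pos hc.ne'
    obtain ⟨s', hs', hsum', a', b', haa, hbb, hlen, hQ'⟩ : ∃ s' : {s : ℕ → τ // ∑' i, w (s i) < 1},
        pref s'.1 N = pref s.1 N ∧ ∑' i, w (s'.1 i) ≤ ∑' i, w (s.1 i) + c / 2 ∧
        ∃ a' b', a ≤ a' ∧ b' ≤ b ∧ b' - a' = (b - a) / 2 ∧ Q (k s') a' b' := by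
      rcases hg.split _ _ a b (hkz s) (hz s) (hs s rfl) with ⟨y, hy, hym⟩ | h | h
      · obtain ⟨δ, hδ, hk⟩ := hkill s y hy (c / 2) hc2
          (((add_le_add le_rfl ENNReal.half_le_self).trans hsum).trans_lt hhalf)
        obtain ⟨s', h1, h2, h3⟩ := hk N
        refine ⟨s', h1, h2, ?_⟩
        -- After the token the midpoint is no longer a solution, so the second split must return a
        -- half.
        rcases hg.split _ _ a b (hkz s') (hz s') (hs s' h1) with ⟨y', hy', hym'⟩ | h | h
        · have : y' = y := Subtype.ext (hym'.trans hym.symm)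
          have := h3 y' hy'
          simp_all [not_le.2 hδ]
        · exact ⟨a, _, le_rfl, by linarith, by ring, h⟩
        · exact ⟨_, b, by linarith, le_rfl, by ring, h⟩
      · exact ⟨s, rfl, le_self_add, a, _, le_rfl, by linarith, by ring, h⟩
      · exact ⟨s, rfl, le_self_add, _, b, by linarith, le_rfl, by ring, h⟩
    obtain ⟨n, hn⟩ := hQ s' a' b' hQ'
    refine ⟨⟨⟨⟨s', max (N + 1) n⟩, ⟨a', b'⟩, c / 2⟩, hc2, ?_, ?_, fun s'' h => ?_⟩, ?_, hs', haa, hbb,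
      hlen⟩
    · calc _ ≤ ∑' i, w (s.1 i) + c / 2 + c / 2 := by gcongr
        _ = ∑' i, w (s.1 i) + c := by rw [add_assoc, ENNReal.add_halves]
        _ ≤ _ := hsum
    · simp only; linarith
    · exact hn s'' (pref_eq_of_le h (le_max_right _ _))
    · exact lt_of_lt_of_le (Nat.lt_succ_self N) (le_max_left _ _)
  choose next hN hpre ha hb hlen using hstep
  obtain ⟨a₀, b₀, hab₀, hinit⟩ := hg.init
  have h0 : ∑' _ : ℕ, w o = 0 := by simp [hf.weight_zero]
  let start : State := ⟨⟨⟨⟨fun _ => o, by simp only [h0]; exact one_pos⟩, 0⟩, ⟨a₀, b₀⟩, 1 / 2⟩,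
    by simp, by simp only [h0, zero_add]; exact le_rfl, hab₀, fun s' _ => hinit _ _ (hkz s') (hz s')⟩
  let st : ℕ → State := fun j => Nat.rec start (fun _ => next) j
  obtain ⟨t, ht⟩ := RandomSolver.exists_limit_sequence (s := fun j => (st j).1.1.1.1)
    (N := fun j => (st j).1.1.2) (fun j => hN (st j)) (fun j => hpre (st j))
  have hNj : ∀ j, j ≤ (st j).1.1.2 := by
    intro j
    induction j with
    | zero => exact Nat.zero_le _
    | succ j ih => exact lt_of_le_of_lt ih (hN (st j))
  -- Every partial sum of the weights of the limit is a partial sum of some stage, so the bound `1 /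
  -- 2` survives.
  have htsum : ∑' i, w (t i) ≤ 1 / 2 := by
    refine ENNReal.tsum_le_of_sum_range_le fun n => ?_
    calc ∑ i ∈ Finset.range n, w (t i) = ∑ i ∈ Finset.range n, w ((st n).1.1.1.1 i) :=
          Finset.sum_congr rfl fun i hi => by
            rw [pref_eq_iff.1 (ht n) i ((Finset.mem_range.1 hi).trans_le (hNj n))]
      _ ≤ ∑' i, w ((st n).1.1.1.1 i) := ENNReal.sum_le_tsum _
      _ ≤ _ := le_self_add.trans (st n).2.2.1
  let t' : {s : ℕ → τ // ∑' i, w (s i) < 1} := ⟨t, htsum.trans_lt hhalf⟩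
  have hlen' : ∀ j, (st j).1.2.1.2 - (st j).1.2.1.1 = (b₀ - a₀) / 2 ^ j := by
    intro j
    induction j with
    | zero => simp [st, start]
    | succ j ih => rw [show st (j + 1) = next (st j) from rfl, hlen, ih, pow_succ]; field_simp
  have hmono : Monotone fun j => (st j).1.2.1.1 := monotone_nat_of_le_succ fun j => ha (st j)
  have hanti : Antitone fun j => (st j).1.2.1.2 := antitone_nat_of_succ_le fun j => hb (st j)
  have hsol : ∀ j, ∃ y ∈ g.val (z t'), (st j).1.2.1.1 ≤ y ∧ (y : ℝ) ≤ (st j).1.2.1.2 := fun j =>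
    hg.solvable _ _ _ _ (hkz t') (hz t') ((st j).2.2.2.2 t' (ht j))
  choose y hy hya hyb using hsol
  have hbound : ∀ i j, i ≤ j → (st i).1.2.1.1 ≤ y j ∧ (y j : ℝ) ≤ (st i).1.2.1.2 := fun i j hij =>
    ⟨(hmono hij).trans (hya j), (hyb j).trans (hanti hij)⟩
  have hcauchy : CauchySeq y := by
    refine cauchySeq_of_le_geometric_two (C := 2 * (b₀ - a₀)) fun n => ?_
    have h1 := hbound n n le_rfl
    have h2 := hbound n (n + 1) (Nat.le_succ n)
    have h3 := hlen' n
    have h4 : 2 * (b₀ - a₀) / 2 / 2 ^ n = (b₀ - a₀) / 2 ^ n := by ring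
    rw [h4, Subtype.dist_eq, Real.dist_eq, abs_le]
    constructor <;> linarith
  obtain ⟨y₀, hy₀⟩ := cauchySeq_tendsto_of_complete hcauchy
  have hy₀v : y₀ ∈ g.val (z t') := (hg.closed _).mem_of_tendsto hy₀ (Eventually.of_forall hy)
  have hy₀b : ∀ i, (st i).1.2.1.1 ≤ y₀ ∧ (y₀ : ℝ) ≤ (st i).1.2.1.2 := by
    intro i
    have h : Tendsto (fun j => (y j : ℝ)) atTop (𝓝 (y₀ : ℝ)) :=
      (continuous_subtype_val.tendsto _).comp hy₀
    exact ⟨ge_of_tendsto h (eventually_atTop.2 ⟨i, fun j hj => (hbound i j hj).1⟩),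
      le_of_tendsto h (eventually_atTop.2 ⟨i, fun j hj => (hbound i j hj).2⟩)⟩
  -- The limit weighs at most `1 / 2`, so a token of weight at most `1 / 4` is affordable.
  obtain ⟨δ, hδ, hk'⟩ := hkill t' y₀ hy₀v (1 / 4) (by simp) (by
    refine (add_le_add htsum le_rfl).trans_lt ?_
    rw [← ENNReal.toReal_lt_toReal (by finiteness) (by finiteness),
      ENNReal.toReal_add (by finiteness) (by finiteness)]
    norm_num)
  obtain ⟨j, hj⟩ : ∃ j : ℕ, (1 / 2 : ℝ) ^ j < δ / (b₀ - a₀) :=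
    exists_pow_lt_of_lt_one (div_pos hδ (by linarith)) (by norm_num)
  obtain ⟨s', hs', -, hfar⟩ := hk' (st j).1.1.2
  obtain ⟨y', hy', hya', hyb'⟩ := hg.solvable _ _ _ _ (hkz s') (hz s')
    ((st j).2.2.2.2 s' (hs'.trans (ht j)))
  have h1 := hfar y' hy'
  have h2 := hy₀b j
  have h3 := hlen' j
  have h4 : (b₀ - a₀) / 2 ^ j < δ := by
    rw [lt_div_iff₀ (by linarith)] at hj
    calc (b₀ - a₀) / 2 ^ j = (1 / 2 : ℝ) ^ j * (b₀ - a₀) := by rw [one_div, inv_pow]; field_simp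
      _ < δ := hj
  rw [Subtype.dist_eq, Real.dist_eq] at h1
  have h5 : |(y' : ℝ) - y₀| ≤ (b₀ - a₀) / 2 ^ j := by
    rw [abs_le]
    constructor <;> linarith
  linarith

/-! ### Weak weak Kőnig's lemma and probabilistic choice are erodible -/

theorem cantorMeasure_cylinder (v : List Bool) :
    cantorMeasure {x | pref x v.length = v} = (1 / 2 : ENNReal) ^ v.length := by
  have hset : {x : Cantor | pref x v.length = v} =
      Set.pi (Finset.range v.length) fun i => {v.getD i false} := by
    ext x
    simp only [Set.mem_ofPred_eq, Set.mem_pi, Finset.coe_range, Set.mem_Iio, Set.mem_singleton_iff]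
    constructor
    · intro hx i hi
      have h := getElem?_pref x hi
      rw [hx] at h
      simp [List.getD, h]
    · intro h
      refine List.ext_getElem (by simp) fun i h1 h2 => ?_
      simpa [pref, h2] using h i h2
  rw [hset, cantorMeasure, Measure.infinitePi_pi _ fun i _ => measurableSet_singleton _]
  simp

theorem exists_pow_half_le {ε : ENNReal} (hε : 0 < ε) : ∃ l : ℕ, (1 / 2 : ENNReal) ^ l ≤ ε := by
  have h := ENNReal.tendsto_pow_atTop_nhds_zero_of_lt_one (r := 1 / 2) (by simp)
  obtain ⟨l, hl⟩ := (h.eventually_lt_const hε).exists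
  exact ⟨l, hl.le⟩

/-- The tree of the words that avoid the listed cylinders. -/
def avoidTree (s : ℕ → Option (List Bool)) : BinTree where
  words := {w | ∀ i < w.length, ∀ v ∈ s i, ¬ v <+: w}
  closed _ _ huv hv i hi t ht htu := hv i (hi.trans_le huv.length_le) t ht (htu.trans huv)

open Classical in
/-- The characteristic function of `avoidTree s`. -/
noncomputable def avoidName (s : ℕ → Option (List Bool)) : Baire := fun n =>
  if ∃ w ∈ (avoidTree s).words, Encodable.encode w = n then 1 else 0

theorem isName_avoidName (s : ℕ → Option (List Bool)) :
    treeRep.IsName (avoidName s) (avoidTree s) := by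
  intro w
  simp [avoidName]

/-- The measure of the cylinder that is excluded by a token. -/
noncomputable def cylinderWeight : Option (List Bool) → ENNReal
  | none => 0
  | some v => (1 / 2 : ENNReal) ^ v.length

/-- Cylinders of total measure below `1` leave a set of paths of positive measure, by the union
bound. A result `y` is removed by the cylinder of a sufficiently long prefix of `y`. -/
theorem erodible_WWKL : Erodible WWKL none cylinderWeight avoidName where
  weight_zero := rfl
  lipschitz s t n h := by
    refine pref_eq_iff.2 fun i hi => ?_
    have : (∃ w ∈ (avoidTree s).words, Encodable.encode w = i) ↔
        ∃ w ∈ (avoidTree t).words, Encodable.encode w = i := by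
      refine exists_congr fun w => and_congr_left fun hw => forall_congr' fun j =>
        forall_congr' fun hj => ?_
      -- Membership of `w` consults only tokens below `|w|`, and `|w|` is at most the code of `w`.
      have := Encodable.length_le_encode w
      rw [pref_eq_iff.1 h j (by omega)]
    unfold avoidName
    classical exact if_congr this rfl rfl
  valid s hs := by
    refine ⟨avoidTree s, ?_, isName_avoidName s⟩
    have hcov : (Set.univ : Set Cantor) ⊆
        (avoidTree s).paths ∪ ⋃ i, {x | ∃ v ∈ s i, pref x v.length = v} := by
      intro x _
      by_contra hx
      rw [Set.mem_union, not_or, Set.mem_iUnion, not_exists] at hx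
      refine hx.1 fun n i _ v hv hvx => hx.2 i ⟨v, hv, ?_⟩
      exact (eq_pref_of_prefix hvx).symm
    have hw : ∀ i, cantorMeasure {x | ∃ v ∈ s i, pref x v.length = v} ≤ cylinderWeight (s i) := by
      intro i
      cases h : s i with
      | none => simp
      | some v => simpa [cylinderWeight] using (cantorMeasure_cylinder v).le
    have hpos : 0 < cantorMeasure (avoidTree s).paths := by
      by_contra h0
      rw [not_lt, nonpos_iff_eq_zero] at h0
      refine absurd hs (not_lt.2 ?_)
      calc (1 : ENNReal) = cantorMeasure Set.univ := measure_univ.symm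
        _ ≤ _ := measure_mono hcov
        _ ≤ _ := measure_union_le _ _
        _ ≤ 0 + ∑' i, cantorMeasure {x | ∃ v ∈ s i, pref x v.length = v} := by
          rw [h0]; gcongr; exact measure_iUnion_le _
        _ ≤ _ := by rw [zero_add]; exact ENNReal.tsum_le_tsum hw
    obtain ⟨x, hx⟩ := nonempty_of_measure_ne_zero hpos.ne'
    exact ⟨x, hpos, hx⟩
  erode z y hz ε hε := by
    obtain ⟨l, hl⟩ := exists_pow_half_le hε
    refine ⟨some (pref y l), l, by simpa [cylinderWeight] using hl, ?_⟩
    rintro s T hT ⟨i, hi⟩ v ⟨-, hv⟩ z' hz' hzz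
    obtain rfl := treeRep.unique _ _ _ hT (isName_avoidName s)
    change z = cantorCode y at hz
    change z' = cantorCode v at hz'
    subst hz hz'
    have hpre : pref v l = pref y l := by
      refine pref_eq_iff.2 fun j hj => ?_
      have := pref_eq_iff.1 hzz j hj
      simp only [cantorCode] at this
      cases h1 : v j <;> cases h2 : y j <;> simp_all
    -- Token `i` acts only on words longer than `i`, and only words of length at least `l` can
    -- extend `pref y l`.
    refine hv (max (i + 1) l) i (by simp) (pref y l) (by simp [hi]) ?_
    rw [← hpre]
    exact pref_prefix _ (le_max_right _ _)

/-- The tokens are the codes of the balls, so a token sequence is already a name. Removing total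
length below `1` from the line leaves positive measure. -/
theorem erodible_PCReal :
    Erodible PCReal (Nat.pair 0 (ratCode 0)) (fun c => volume (ratBall realSeq c)) id where
  weight_zero := by simp [ratBall]
  lipschitz s t n h := h
  valid s hs := by
    let A : TopologicalSpace.Closeds ℝ :=
      ⟨(⋃ i, ratBall realSeq (s i))ᶜ, (isOpen_iUnion fun i => Metric.isOpen_ball).isClosed_compl⟩
    have hpos : 0 < volume (A : Set ℝ) := by
      by_contra h0
      rw [not_lt, nonpos_iff_eq_zero] at h0
      refine absurd hs (not_lt.2 ?_)
      calc (1 : ENNReal) ≤ volume (Set.univ : Set ℝ) := by simp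
        _ = volume ((A : Set ℝ) ∪ ⋃ i, ratBall realSeq (s i)) := by
          congr 1; exact (Set.compl_union_self _).symm
        _ ≤ _ := measure_union_le _ _
        _ ≤ _ := by rw [h0, zero_add]; exact measure_iUnion_le _
    obtain ⟨x, hx⟩ := nonempty_of_measure_ne_zero hpos.ne'
    exact ⟨A, ⟨x, hpos, hx⟩, compl_compl _⟩
  erode z y hz ε hε := by
    obtain ⟨l, hl⟩ := exists_pow_half_le hε
    -- The radius is twice the error bound `2⁻⁽ˡ⁺²⁾` of the centre, so the ball contains every point
    -- having a name with this entry. Its length is `4 * 2⁻⁽ˡ⁺²⁾ = 2⁻ˡ`.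
    refine ⟨Nat.pair (z (l + 2)) (ratCode (2 * (1 / 2) ^ (l + 2))), l + 3, ?_, ?_⟩
    · refine le_trans (le_of_eq ?_) hl
      have : (1 / 2 : ENNReal) = ENNReal.ofReal (1 / 2) := by
        rw [ENNReal.ofReal_div_of_pos (by norm_num)]; simp
      rw [this, ← ENNReal.ofReal_pow (by norm_num)]
      simp only [ratBall, Nat.unpair_pair, ratOf_ratCode, Real.volume_ball]
      congr 1
      push_cast
      ring
    · rintro s A hA ⟨i, hi⟩ v ⟨-, hv⟩ z' hz' hzz
      have h1 := hz' (l + 2)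
      rw [pref_eq_iff.1 hzz (l + 2) (by omega)] at h1
      have h2 : v ∈ ⋃ i, ratBall realSeq (s i) := by
        refine Set.mem_iUnion.2 ⟨i, ?_⟩
        rw [hi]
        simp only [ratBall, Nat.unpair_pair, ratOf_ratCode, Metric.mem_ball]
        rw [dist_comm]
        push_cast
        have : (0 : ℝ) < (1 / 2) ^ (l + 2) := by positivity
        linarith
      change (A : Set ℝ)ᶜ = _ at hA
      exact (hA ▸ h2 : v ∈ (A : Set ℝ)ᶜ) hv

/-! ### The intermediate value theorem and connected choice are bisectable -/

/-- The box with code `c` contains `x` in its base and only negative values. -/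
def NegAt (c : ℕ) (x : ℝ) : Prop :=
  realSeq c.unpair.1.unpair.1 ≤ x ∧ x ≤ realSeq c.unpair.1.unpair.2 ∧
    realSeq c.unpair.2.unpair.2 < 0

/-- The box with code `c` contains `x` in its base and only positive values. -/
def PosAt (c : ℕ) (x : ℝ) : Prop :=
  realSeq c.unpair.1.unpair.1 ≤ x ∧ x ≤ realSeq c.unpair.1.unpair.2 ∧
    0 < realSeq c.unpair.2.unpair.1

theorem NegAt.neg {c : ℕ} {x : unitInterval} (h : NegAt c x) {f : C(unitInterval, ℝ)}
    (hf : MapsBox f c) : f x < 0 := ((hf x h.1 h.2.1).2).trans h.2.2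

theorem PosAt.pos {c : ℕ} {x : unitInterval} (h : PosAt c x) {f : C(unitInterval, ℝ)}
    (hf : MapsBox f c) : 0 < f x := h.2.2.trans (hf x h.1 h.2.1).1

/-- Every strict two-sided bound for `f x` is witnessed by a box around `x`. -/
theorem exists_mapsBox {f : C(unitInterval, ℝ)} {x : unitInterval} {c d : ℚ}
    (hc : (c : ℝ) < f x) (hd : f x < d) : ∃ a b : ℚ, (a : ℝ) ≤ x ∧ (x : ℝ) ≤ b ∧
      MapsBox f (Nat.pair (Nat.pair (ratCode a) (ratCode b)) (Nat.pair (ratCode c) (ratCode d))) := by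
  have hU : IsOpen {y : unitInterval | (c : ℝ) < f y ∧ f y < d} :=
    (isOpen_lt continuous_const f.continuous).inter (isOpen_lt f.continuous continuous_const)
  obtain ⟨ε, hε, hb⟩ := Metric.isOpen_iff.mp hU x ⟨hc, hd⟩
  obtain ⟨a, ha1, ha2⟩ := exists_rat_btwn (show (x : ℝ) - ε < x by linarith)
  obtain ⟨b, hb1, hb2⟩ := exists_rat_btwn (show (x : ℝ) < x + ε by linarith)
  refine ⟨a, b, ha2.le, hb1.le, fun y hy1 hy2 => ?_⟩
  simp only [Nat.unpair_pair, realSeq_ratCode] at hy1 hy2 ⊢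
  refine hb ?_
  rw [Metric.mem_ball, Subtype.dist_eq, Real.dist_eq, abs_lt]
  constructor <;> linarith

theorem mapsBox_of_isName {k : Baire} {f : C(unitInterval, ℝ)} (hk : contRep.IsName k f) (i : ℕ) :
    MapsBox f (k i) := by
  have : k i ∈ Set.range k := Set.mem_range_self i
  rwa [show Set.range k = {k | MapsBox f k} from hk] at this

theorem exists_index_of_mapsBox {k : Baire} {f : C(unitInterval, ℝ)} (hk : contRep.IsName k f)
    {c : ℕ} (hc : MapsBox f c) : ∃ i, k i = c := by
  have : c ∈ {k | MapsBox f k} := hc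
  rwa [← show Set.range k = {k | MapsBox f k} from hk] at this

theorem exists_negAt {k : Baire} {f : C(unitInterval, ℝ)} (hk : contRep.IsName k f)
    {x : unitInterval} (hx : f x < 0) : ∃ i, NegAt (k i) x := by
  obtain ⟨d, hd1, hd2⟩ := exists_rat_btwn hx
  obtain ⟨c, hc⟩ := exists_rat_lt (f x)
  obtain ⟨a, b, ha, hb, hm⟩ := exists_mapsBox hc hd1
  obtain ⟨i, hi⟩ := exists_index_of_mapsBox hk hm
  refine ⟨i, ?_⟩
  rw [NegAt, hi]
  simpa only [Nat.unpair_pair, realSeq_ratCode] using ⟨ha, hb, hd2⟩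

theorem exists_posAt {k : Baire} {f : C(unitInterval, ℝ)} (hk : contRep.IsName k f)
    {x : unitInterval} (hx : 0 < f x) : ∃ i, PosAt (k i) x := by
  obtain ⟨c, hc1, hc2⟩ := exists_rat_btwn hx
  obtain ⟨d, hd⟩ := exists_rat_gt (f x)
  obtain ⟨a, b, ha, hb, hm⟩ := exists_mapsBox hc2 hd
  obtain ⟨i, hi⟩ := exists_index_of_mapsBox hk hm
  refine ⟨i, ?_⟩
  rw [PosAt, hi]
  simpa only [Nat.unpair_pair, realSeq_ratCode] using ⟨ha, hb, hc1⟩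

theorem exists_zero_of_mul_neg (f : C(unitInterval, ℝ)) {x y : unitInterval} (hxy : x ≤ y)
    (h : f x * f y < 0) : ∃ z, x ≤ z ∧ z ≤ y ∧ f z = 0 := by
  rcases mul_neg_iff.1 h with ⟨h1, h2⟩ | ⟨h1, h2⟩
  · obtain ⟨z, hz, h0⟩ := intermediate_value_Icc' hxy f.continuous.continuousOn ⟨h2.le, h1.le⟩
    exact ⟨z, hz.1, hz.2, h0⟩
  · obtain ⟨z, hz, h0⟩ := intermediate_value_Icc hxy f.continuous.continuousOn ⟨h1.le, h2.le⟩
    exact ⟨z, hz.1, hz.2, h0⟩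

theorem isClosed_IVT_val (f : C(unitInterval, ℝ)) : IsClosed (IVT.val f) :=
  isClosed_const.inter (isClosed_eq f.continuous continuous_const)

theorem isClosed_ConCUnit_val (A : TopologicalSpace.Closeds unitInterval) :
    IsClosed (ConCUnit.val A) :=
  isClosed_const.inter A.isClosed

/-- The function named by `k` changes its sign between `a` and `b`. -/
def SignChange (k : Baire) (a b : ℝ) : Prop :=
  ∃ f, contRep.IsName k f ∧ ∃ x y : unitInterval, (x : ℝ) = a ∧ (y : ℝ) = b ∧ x ≤ y ∧ f x * f y < 0

/-- The signs at the two end points are witnessed by two listed boxes, hence by a finite part of the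
name. If the value at the midpoint is not zero, its sign differs from that at one end point. -/
theorem bisectable_IVT : Bisectable IVT SignChange where
  target := rfl
  closed := isClosed_IVT_val
  stable := by
    rintro k f _ _ hk - ⟨f', hk', x, y, rfl, rfl, hxy, h⟩
    obtain rfl := contRep.unique _ _ _ hk hk'
    rcases mul_neg_iff.1 h with ⟨h1, h2⟩ | ⟨h1, h2⟩
    · obtain ⟨i, hi⟩ := exists_posAt hk h1
      obtain ⟨j, hj⟩ := exists_negAt hk h2
      refine ⟨max i j + 1, fun k' g hg _ hkk => ⟨g, hg, x, y, rfl, rfl, hxy, ?_⟩⟩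
      rw [pref_eq_iff] at hkk
      rw [← hkk i (by omega)] at hi
      rw [← hkk j (by omega)] at hj
      exact mul_neg_of_pos_of_neg (hi.pos (mapsBox_of_isName hg i)) (hj.neg (mapsBox_of_isName hg j))
    · obtain ⟨i, hi⟩ := exists_negAt hk h1
      obtain ⟨j, hj⟩ := exists_posAt hk h2
      refine ⟨max i j + 1, fun k' g hg _ hkk => ⟨g, hg, x, y, rfl, rfl, hxy, ?_⟩⟩
      rw [pref_eq_iff] at hkk
      rw [← hkk i (by omega)] at hi
      rw [← hkk j (by omega)] at hj
      exact mul_neg_of_neg_of_pos (hi.neg (mapsBox_of_isName hg i)) (hj.pos (mapsBox_of_isName hg j))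
  solvable := by
    rintro k f _ _ hk ⟨-, hd, -⟩ ⟨f', hk', x, y, rfl, rfl, hxy, h⟩
    obtain rfl := contRep.unique _ _ _ hk hk'
    obtain ⟨z, h1, h2, h3⟩ := exists_zero_of_mul_neg f hxy h
    exact ⟨z, ⟨hd, h3⟩, h1, h2⟩
  split := by
    rintro k f _ _ hk ⟨-, hd, -⟩ ⟨f', hk', x, y, rfl, rfl, hxy, h⟩
    obtain rfl := contRep.unique _ _ _ hk hk'
    have hxy' : (x : ℝ) ≤ y := hxy
    let m : unitInterval := ⟨((x : ℝ) + y) / 2, by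
      constructor <;> linarith [x.2.1, x.2.2, y.2.1, y.2.2]⟩
    have hxm : x ≤ m := Subtype.coe_le_coe.1 (by simp only [m]; linarith)
    have hmy : m ≤ y := Subtype.coe_le_coe.1 (by simp only [m]; linarith)
    rcases lt_trichotomy (f m) 0 with h0 | h0 | h0
    · right
      rcases mul_neg_iff.1 h with ⟨h1, h2⟩ | ⟨h1, h2⟩
      · exact Or.inl ⟨f, hk, x, m, rfl, rfl, hxm, mul_neg_of_pos_of_neg h1 h0⟩
      · exact Or.inr ⟨f, hk, m, y, rfl, rfl, hmy, mul_neg_of_neg_of_pos h0 h2⟩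
    · exact Or.inl ⟨m, ⟨hd, h0⟩, rfl⟩
    · right
      rcases mul_neg_iff.1 h with ⟨h1, h2⟩ | ⟨h1, h2⟩
      · exact Or.inr ⟨f, hk, m, y, rfl, rfl, hmy, mul_neg_of_pos_of_neg h0 h2⟩
      · exact Or.inl ⟨f, hk, x, m, rfl, rfl, hxm, mul_neg_of_neg_of_pos h1 h0⟩
  init := ⟨0, 1, one_pos, fun k f hk ⟨_, hd, _⟩ =>
    ⟨f, hk, 0, 1, by simp, by simp, unitInterval.nonneg 1, hd⟩⟩

/-! ### Bisection of connected closed sets -/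

/-- The closed set named by `k` lies strictly between `a` and `b`. -/
def LiesBetween (k : Baire) (a b : ℝ) : Prop :=
  ∀ y : unitInterval, (y : ℝ) ≤ a ∨ b ≤ y → ∃ i, y ∈ ratBall unitSeq (k i)

theorem mem_ConCUnit_iff {k : Baire} {A : TopologicalSpace.Closeds unitInterval}
    (hk : ConCUnit.source.IsName k A) (y : unitInterval) :
    y ∈ A ↔ ∀ i, y ∉ ratBall unitSeq (k i) := by
  change (A : Set unitInterval)ᶜ = _ at hk
  rw [← SetLike.mem_coe, ← not_iff_not, ← Set.mem_compl_iff, hk, Set.mem_iUnion]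
  push Not
  rfl

theorem exists_finite_cover {k : Baire} {K : Set unitInterval} (hK : IsCompact K)
    (h : ∀ y ∈ K, ∃ i, y ∈ ratBall unitSeq (k i)) :
    ∃ n, ∀ y ∈ K, ∃ i < n, y ∈ ratBall unitSeq (k i) := by
  obtain ⟨t, ht⟩ := hK.elim_finite_subcover (fun i => ratBall unitSeq (k i))
    (fun i => Metric.isOpen_ball) fun y hy => Set.mem_iUnion.2 (h y hy)
  refine ⟨t.sup id + 1, fun y hy => ?_⟩
  obtain ⟨i, hi, hyi⟩ := Set.mem_iUnion₂.1 (ht hy)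
  exact ⟨i, Nat.lt_succ_of_le (Finset.le_sup (f := id) hi), hyi⟩

/-- A connected set that avoids a point lies on one side of it. -/
theorem one_side_of_isConnected {A : Set unitInterval} (hA : IsConnected A) {c : ℝ}
    (hc : ∀ y ∈ A, (y : ℝ) ≠ c) : (∀ y ∈ A, (y : ℝ) < c) ∨ ∀ y ∈ A, c < (y : ℝ) := by
  by_contra! h
  obtain ⟨⟨y, hy, hyc⟩, ⟨y', hy', hyc'⟩⟩ := h
  have hmem : c ∈ Set.Icc (0 : ℝ) 1 := ⟨y'.2.1.trans hyc', hyc.trans y.2.2⟩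
  exact hc ⟨c, hmem⟩ (hA.isPreconnected.Icc_subset hy' hy ⟨hyc', hyc⟩) rfl

/-- The part of `[0, 1]` outside the open interval is compact, so finitely many listed balls cover
it, which gives stability. A connected set that misses the midpoint lies on one side of it, which
gives the split. -/
theorem bisectable_ConCUnit : Bisectable ConCUnit LiesBetween where
  target := rfl
  closed := isClosed_ConCUnit_val
  stable := by
    intro k A a b _ _ h
    have hK : IsCompact {y : unitInterval | (y : ℝ) ≤ a ∨ b ≤ y} :=
      ((isClosed_le continuous_subtype_val continuous_const).union
        (isClosed_le continuous_const continuous_subtype_val)).isCompact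
    obtain ⟨n, hn⟩ := exists_finite_cover hK h
    refine ⟨n, fun k' _ _ _ hkk y hy => ?_⟩
    obtain ⟨i, hi, hyi⟩ := hn y hy
    exact ⟨i, by rwa [pref_eq_iff.1 hkk i hi]⟩
  solvable := by
    rintro k A a b hk ⟨y, hc, hy⟩ h
    refine ⟨y, ⟨hc, hy⟩, ?_⟩
    by_contra hn
    obtain ⟨i, hi⟩ := h y (by
      rw [not_and_or, not_le, not_le] at hn
      exact hn.imp le_of_lt le_of_lt)
    exact (mem_ConCUnit_iff hk y).1 hy i hi
  split := by
    rintro k A a b hk ⟨-, hc, -⟩ h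
    by_cases hm : ∃ y ∈ ConCUnit.val A, (y : ℝ) = (a + b) / 2
    · exact Or.inl hm
    right
    have hmem : ∀ y, (¬ ∃ i, y ∈ ratBall unitSeq (k i)) → y ∈ A := fun y hy =>
      (mem_ConCUnit_iff hk y).2 (not_exists.1 hy)
    rcases one_side_of_isConnected hc fun y hy h => hm ⟨y, ⟨hc, hy⟩, h⟩ with hs | hs
    · refine Or.inl fun y hy => ?_
      by_contra hn
      rcases hy with hy | hy
      · exact hn (h y (Or.inl hy))
      · exact absurd (hs y (hmem y hn)) (not_lt.2 hy)
    · refine Or.inr fun y hy => ?_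
      by_contra hn
      rcases hy with hy | hy
      · exact absurd (hs y (hmem y hn)) (not_lt.2 hy)
      · exact hn (h y (Or.inr hy))
  -- No point of the unit interval lies outside this interval, so the condition is void.
  init := ⟨-1, 2, by norm_num, fun k A _ _ y hy => by
    have := y.2.1
    have := y.2.2
    rcases hy with hy | hy <;> linarith⟩

/-! ### Transducers -/

/-- Iteration of `h` along the prefixes of a word. -/
def accum {σ : Type} (a : σ) (h : List ℕ → σ → σ) (u : List ℕ) : σ :=
  Nat.rec a (fun i st => h (u.take (i + 1)) st) u.length

theorem accum_append_singleton {σ : Type} (a : σ) (h : List ℕ → σ → σ) (u : List ℕ) (c : ℕ) :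
    accum a h (u ++ [c]) = h (u ++ [c]) (accum a h u) := by
  have key : ∀ j ≤ u.length,
      (Nat.rec a (fun i st => h ((u ++ [c]).take (i + 1)) st) j : σ) =
        Nat.rec a (fun i st => h (u.take (i + 1)) st) j := by
    intro j
    induction j with
    | zero => intro _; rfl
    | succ j ih =>
      intro hj
      simp only
      rw [ih (by omega), List.take_append_of_le_length hj]
  unfold accum
  rw [List.length_append, List.length_singleton]
  simp only
  rw [key _ le_rfl, List.take_of_length_le (by simp)]

theorem pref_succ {α : Type} (p : ℕ → α) (n : ℕ) : pref p (n + 1) = pref p n ++ [p n] := by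
  simp [pref, List.range_succ]

theorem accum_pref_succ {σ : Type} (a : σ) (h : List ℕ → σ → σ) (p : Baire) (n : ℕ) :
    accum a h (pref p (n + 1)) = h (pref p (n + 1)) (accum a h (pref p n)) := by
  rw [pref_succ, accum_append_singleton]

theorem primrec_accum {σ : Type} [Primcodable σ] (a : σ) {h : List ℕ → σ → σ} (hh : Primrec₂ h) :
    Primrec (accum a h) := by
  have h1 : Primrec₂ fun (u : List ℕ) (b : ℕ × σ) => h (u.take (b.1 + 1)) b.2 :=
    hh.comp (Primrec.list_take.comp (Primrec.succ.comp (Primrec.fst.comp Primrec.snd)) Primrec.fst)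
      (Primrec.snd.comp Primrec.snd)
  exact ((Primrec.nat_rec (Primrec.const a) h1).comp Primrec.id Primrec.list_length).of_eq
    fun u => rfl

/-- The output words of the machine that waits until `g` provides the next symbol. -/
def emit (g : List ℕ → ℕ → Option ℕ) : List ℕ → List ℕ :=
  accum [] fun u acc => acc ++ (g u acc.length).toList

theorem prefixMono_emit (g : List ℕ → ℕ → Option ℕ) : PrefixMono (emit g) := by
  rintro u _ ⟨t, rfl⟩
  induction t using List.reverseRecOn with
  | nil => simp
  | append_singleton t c ih =>
    rw [← List.append_assoc, emit, accum_append_singleton]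
    exact ih.trans (List.prefix_append _ _)

theorem primrec_emit {g : List ℕ → ℕ → Option ℕ} (hg : Primrec₂ g) : Primrec (emit g) :=
  primrec_accum [] (Primrec.list_append.comp Primrec.snd (Primrec.optionToList.comp
    (hg.comp Primrec.fst (Primrec.list_length.comp Primrec.snd))))

/-- The partial function on Baire space computed by the machine that waits until `g` provides the
next symbol. -/
noncomputable def transducer (g : List ℕ → ℕ → Option ℕ) : Baire →. Baire := fun p =>
  ⟨∀ n, ∃ m, n < (emit g (pref p m)).length, fun h n => (emit g (pref p (h n).choose)).getD n 0⟩

theorem getElem?_emit_of_mem {g : List ℕ → ℕ → Option ℕ} {p q : Baire} (h : q ∈ transducer g p)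
    (n : ℕ) : ∃ m, (emit g (pref p m))[n]? = some (q n) := by
  obtain ⟨hd, rfl⟩ := h
  refine ⟨(hd n).choose, ?_⟩
  have := (hd n).choose_spec
  simp [transducer, this]

theorem approximates_emit {g : List ℕ → ℕ → Option ℕ} {p q : Baire} (h : q ∈ transducer g p) :
    Approximates (emit g) p q := by
  intro n
  choose m hm using getElem?_emit_of_mem h
  refine ⟨(Finset.range n).sup m, ?_⟩
  have hall : ∀ i < n, (emit g (pref p ((Finset.range n).sup m)))[i]? = some (q i) := fun i hi =>
    getElem?_of_prefix (prefixMono_emit g _ _ (pref_prefix p (Finset.le_sup (Finset.mem_range.2 hi))))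
      (hm i)
  rw [List.prefix_iff_eq_take]
  refine List.ext_getElem? fun i => ?_
  rw [length_pref, List.getElem?_take]
  split_ifs with hi
  · rw [getElem?_pref q hi, hall i hi]
  · exact List.getElem?_eq_none (by simpa using hi)

theorem isComputable_transducer {g : List ℕ → ℕ → Option ℕ} (hg : Primrec₂ g) :
    IsComputable (transducer g) :=
  ⟨emit g, (primrec_emit hg).to_comp, prefixMono_emit g, fun _ _ hq => approximates_emit hq⟩

theorem emit_pref_succ (g : List ℕ → ℕ → Option ℕ) (p : Baire) (n : ℕ) :
    emit g (pref p (n + 1)) = emit g (pref p n) ++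
      (g (pref p (n + 1)) (emit g (pref p n)).length).toList :=
  accum_pref_succ _ _ p n

theorem exists_of_getElem?_emit {g : List ℕ → ℕ → Option ℕ} {p : Baire} {m n v : ℕ}
    (h : (emit g (pref p m))[n]? = some v) : ∃ s, g (pref p s) n = some v := by
  induction m with
  | zero => simp [emit, accum, pref] at h
  | succ m ih =>
    rw [emit_pref_succ] at h
    rcases lt_or_ge n (emit g (pref p m)).length with hn | hn
    · rw [List.getElem?_append_left hn] at h
      exact ih h
    · rw [List.getElem?_append_right hn] at h
      cases hg : g (pref p (m + 1)) (emit g (pref p m)).length with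
      | none => simp [hg] at h
      | some w =>
        simp only [hg, Option.toList_some] at h
        have hlt := (List.getElem?_eq_some_iff.1 h).1
        simp only [List.length_singleton] at hlt
        have hn' : n = (emit g (pref p m)).length := by omega
        refine ⟨m + 1, ?_⟩
        rw [← hn'] at hg h
        simpa [hg] using h

/-- If `g` answers from some stage on, the machine never waits forever. A symbol may come from any
stage at which `g` answers, so users must show that every possible answer is correct, not only the
late ones. -/
theorem exists_mem_transducer {g : List ℕ → ℕ → Option ℕ} {p : Baire}
    (h : ∀ n, ∃ s₀, ∀ s ≥ s₀, (g (pref p s) n).isSome) :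
    ∃ q ∈ transducer g p, ∀ n, ∃ s, g (pref p s) n = some (q n) := by
  have hlen : ∀ n, ∃ m, n ≤ (emit g (pref p m)).length := by
    intro n
    induction n with
    | zero => exact ⟨0, Nat.zero_le _⟩
    | succ n ih =>
      obtain ⟨m, hm⟩ := ih
      obtain ⟨s₀, hs⟩ := h n
      have h1 := hs (max m s₀ + 1) ((le_max_right m s₀).trans (Nat.le_succ _))
      have h2 := (prefixMono_emit g _ _ (pref_prefix p (le_max_left m s₀))).length_le
      refine ⟨max m s₀ + 1, ?_⟩
      rw [emit_pref_succ, List.length_append]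
      rcases Nat.lt_or_ge n (emit g (pref p (max m s₀))).length with h3 | h3
      · omega
      · have h4 : (emit g (pref p (max m s₀))).length = n := by omega
        obtain ⟨v, hv⟩ := Option.isSome_iff_exists.1 h1
        rw [h4, hv]
        simp
  have hd : (transducer g p).Dom := fun n => hlen (n + 1)
  refine ⟨_, ⟨hd, rfl⟩, fun n => ?_⟩
  obtain ⟨m, hm⟩ := getElem?_emit_of_mem ⟨hd, rfl⟩ n
  exact exists_of_getElem?_emit hm

/-- The symbols at even positions. -/
def evens (w : List ℕ) : List ℕ := (List.range ((w.length + 1) / 2)).map fun i => w.getD (2 * i) 0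

/-- The symbols at odd positions. -/
def odds (w : List ℕ) : List ℕ := (List.range (w.length / 2)).map fun i => w.getD (2 * i + 1) 0

theorem evens_pref_pair (p q : Baire) (n : ℕ) :
    evens (pref (pair p q) n) = pref p ((n + 1) / 2) := by
  unfold evens
  rw [length_pref]
  refine List.map_congr_left fun i hi => ?_
  rw [List.mem_range] at hi
  rw [List.getD, getElem?_pref _ (by omega)]
  simp [pair]

theorem odds_pref_pair (p q : Baire) (n : ℕ) : odds (pref (pair p q) n) = pref q (n / 2) := by
  unfold odds
  rw [length_pref]
  refine List.map_congr_left fun i hi => ?_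
  rw [List.mem_range] at hi
  rw [List.getD, getElem?_pref _ (by omega), Option.getD_some, pair, if_neg (by omega)]
  congr 1
  omega

theorem primrec_evens : Primrec evens :=
  Primrec.list_map (Primrec.list_range.comp (Primrec.nat_div.comp
      (Primrec.succ.comp Primrec.list_length) (Primrec.const 2)))
    ((Primrec.list_getD 0).comp Primrec.fst
      (Primrec.nat_mul.comp (Primrec.const 2) Primrec.snd))

theorem primrec_odds : Primrec odds :=
  Primrec.list_map (Primrec.list_range.comp (Primrec.nat_div.comp
      Primrec.list_length (Primrec.const 2)))
    ((Primrec.list_getD 0).comp Primrec.fst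
      (Primrec.succ.comp (Primrec.nat_mul.comp (Primrec.const 2) Primrec.snd)))

theorem primrec_pow : Primrec₂ ((· ^ ·) : ℕ → ℕ → ℕ) := Primrec₂.unpaired'.1 Nat.Primrec.pow

theorem primrec_two_pow {α : Type} [Primcodable α] {f : α → ℕ} (hf : Primrec f) :
    Primrec fun a => 2 ^ f a := primrec_pow.comp (Primrec.const 2) hf

/-! ### Bisection with random advice about its halting -/

/-- The code of the rational number `(a - b) / 2 ^ n`. -/
def dyadicCode (a b n : ℕ) : ℕ := Nat.pair (Nat.pair a b) (2 ^ n - 1)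

theorem realSeq_dyadicCode (a b n : ℕ) :
    realSeq (dyadicCode a b n) = ((a : ℝ) - b) / 2 ^ n := by
  have h : ((2 ^ n - 1 : ℕ) : ℚ) + 1 = 2 ^ n := by
    have := Nat.one_le_two_pow (n := n)
    push_cast [this]
    ring
  simp only [realSeq, ratOf, dyadicCode, Nat.unpair_pair, h]
  push_cast
  rfl

theorem primrec_dyadicCode {α : Type} [Primcodable α] {a b n : α → ℕ} (ha : Primrec a)
    (hb : Primrec b) (hn : Primrec n) : Primrec fun x => dyadicCode (a x) (b x) (n x) :=
  Primrec₂.natPair.comp (Primrec₂.natPair.comp ha hb)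
    (Primrec.nat_sub.comp (primrec_two_pow hn) (Primrec.const 1))

/-- One step of the bisection: `(k, m)` stands for the interval `[m / 2 ^ k, (m + 1) / 2 ^ k]`. -/
def bisectStep (test : List ℕ → ℕ × ℕ → Bool) (u : List ℕ) (a : ℕ × ℕ) : ℕ × ℕ :=
  bif test u (a.1 + 1, 2 * a.2) then (a.1 + 1, 2 * a.2)
  else bif test u (a.1 + 1, 2 * a.2 + 1) then (a.1 + 1, 2 * a.2 + 1) else a

/-- The interval reached after reading the word `u`. -/
def bisect (test : List ℕ → ℕ × ℕ → Bool) : List ℕ → ℕ × ℕ := accum (0, 0) (bisectStep test)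

theorem primrec_bisect {test : List ℕ → ℕ × ℕ → Bool} (h : Primrec₂ test) :
    Primrec (bisect test) := by
  refine primrec_accum _ ?_
  have h1 : Primrec fun a : List ℕ × (ℕ × ℕ) => a.2.1 + 1 :=
    Primrec.succ.comp (Primrec.fst.comp Primrec.snd)
  have h2 : Primrec fun a : List ℕ × (ℕ × ℕ) => 2 * a.2.2 :=
    Primrec.nat_mul.comp (Primrec.const 2) (Primrec.snd.comp Primrec.snd)
  have h3 : Primrec fun a : List ℕ × (ℕ × ℕ) => 2 * a.2.2 + 1 := Primrec.succ.comp h2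
  exact Primrec.cond (h.comp Primrec.fst (h1.pair h2)) (h1.pair h2)
    (Primrec.cond (h.comp Primrec.fst (h1.pair h3)) (h1.pair h3) Primrec.snd)

/-- The test `test` on prefixes of names of `x` decides how to bisect intervals that satisfy the
predicate `Good x`, unless the midpoint is a solution. -/
structure BisectTest {X : Type} (f : Problem X unitInterval) (test : List ℕ → ℕ × ℕ → Bool)
    (Good : X → ℕ → ℕ → Prop) : Prop where
  primrec : Primrec₂ test
  target : f.target = cauchyRep unitSeq denseRange_unitSeq
  closed : ∀ x, IsClosed (f.val x)
  init : ∀ x ∈ f.dom, Good x 0 0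
  sound : ∀ p x, f.source.IsName p x → x ∈ f.dom → ∀ k m b s, b < 2 → Good x k m →
    test (pref p s) (k + 1, 2 * m + b) = true → Good x (k + 1) (2 * m + b)
  progress : ∀ p x, f.source.IsName p x → x ∈ f.dom → ∀ k m, Good x k m →
    (∃ y ∈ f.val x, (y : ℝ) = (2 * m + 1) / 2 ^ (k + 1)) ∨
      ∃ s₀, ∀ s ≥ s₀, test (pref p s) (k + 1, 2 * m) = true ∨
        test (pref p s) (k + 1, 2 * m + 1) = true
  solvable : ∀ x ∈ f.dom, ∀ k m, Good x k m →
    ∃ y ∈ f.val x, (m : ℝ) / 2 ^ k ≤ y ∧ (y : ℝ) ≤ (m + 1) / 2 ^ k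

/-- A problem `h` that transports the information at which step `k` a process gets stuck:
`enc k` is a name of an instance all of whose solutions claim `k` and no smaller number, and `enc k`
converges to a name of an instance whose solutions claim nothing. -/
structure StuckAdvice {Z W : Type} (h : Problem Z W) (enc : ℕ → ℕ → ℕ) (encLim : ℕ → ℕ)
    (claim : List ℕ → ℕ → Bool) : Prop where
  primrec_enc : Primrec₂ enc
  primrec_claim : Primrec₂ claim
  lim : ∀ e, ∃ k₀, ∀ k ≥ k₀, enc k e = encLim e
  stuck : ∀ k, ∃ z ∈ h.dom, h.source.IsName (enc k) z ∧ ∀ y ∈ h.val z, ∀ r, h.target.IsName r y →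
    (∃ s₀, ∀ s ≥ s₀, claim (pref r s) k = true) ∧ ∀ j < k, ∀ s, claim (pref r s) j = false
  unstuck : ∃ z ∈ h.dom, h.source.IsName encLim z ∧ ∀ y ∈ h.val z, ∀ r, h.target.IsName r y →
    ∀ j s, claim (pref r s) j = false

/-- The symbols of the sequence of instances `enc k` for the bisection levels `k`. -/
def adviceQuery (test : List ℕ → ℕ × ℕ → Bool) (enc : ℕ → ℕ → ℕ) (u : List ℕ) (n : ℕ) : Option ℕ :=
  bif decide (n.unpair.1 ≤ u.length) then
    some (enc (bisect test (u.take n.unpair.1)).1 n.unpair.2) else none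

/-- The `n`-th approximation of the solution: an end point of an interval of length at most `2⁻ⁿ`,
or the midpoint of an interval that is claimed to be the last one. -/
def adviceAnswer (test : List ℕ → ℕ × ℕ → Bool) (claim : List ℕ → ℕ → Bool) (w : List ℕ) (n : ℕ) :
    Option ℕ :=
  bif decide (n ≤ (bisect test (evens w)).1) then
    some (dyadicCode ((bisect test (evens w)).2 / 2 ^ ((bisect test (evens w)).1 - n)) 0 n)
  else bif claim (odds w) (bisect test (evens w)).1 then
    some (dyadicCode (2 * (bisect test (evens w)).2 + 1) 0 ((bisect test (evens w)).1 + 1))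
  else none

theorem primrec_adviceQuery {test : List ℕ → ℕ × ℕ → Bool} {enc : ℕ → ℕ → ℕ} (ht : Primrec₂ test)
    (he : Primrec₂ enc) : Primrec₂ (adviceQuery test enc) := by
  have h1 : Primrec fun a : List ℕ × ℕ => a.2.unpair := Primrec.unpair.comp Primrec.snd
  exact Primrec.cond (Primrec.nat_le.decide.comp (Primrec.fst.comp h1)
      (Primrec.list_length.comp Primrec.fst))
    (Primrec.option_some.comp (he.comp (Primrec.fst.comp ((primrec_bisect ht).comp
      (Primrec.list_take.comp (Primrec.fst.comp h1) Primrec.fst))) (Primrec.snd.comp h1)))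
    (Primrec.const none)

theorem primrec_adviceAnswer {test : List ℕ → ℕ × ℕ → Bool} {claim : List ℕ → ℕ → Bool}
    (ht : Primrec₂ test) (hc : Primrec₂ claim) : Primrec₂ (adviceAnswer test claim) := by
  have hb : Primrec fun a : List ℕ × ℕ => bisect test (evens a.1) :=
    (primrec_bisect ht).comp (primrec_evens.comp Primrec.fst)
  have hk := Primrec.fst.comp hb
  have hm := Primrec.snd.comp hb
  exact Primrec.cond (Primrec.nat_le.decide.comp Primrec.snd hk)
    (Primrec.option_some.comp (primrec_dyadicCode (Primrec.nat_div.comp hm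
      (primrec_two_pow (Primrec.nat_sub.comp hk Primrec.snd))) (Primrec.const 0) Primrec.snd))
    (Primrec.cond (hc.comp (primrec_odds.comp Primrec.fst) hk)
      (Primrec.option_some.comp (primrec_dyadicCode (Primrec.succ.comp
        (Primrec.nat_mul.comp (Primrec.const 2) hm)) (Primrec.const 0) (Primrec.succ.comp hk)))
      (Primrec.const none))

/-- The interval `b` is obtained from `a` by finitely many bisections. -/
def Refines (a b : ℕ × ℕ) : Prop := a.1 ≤ b.1 ∧ b.2 / 2 ^ (b.1 - a.1) = a.2

theorem Refines.refl (a : ℕ × ℕ) : Refines a a := by simp [Refines]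

theorem Refines.trans {a b c : ℕ × ℕ} (h1 : Refines a b) (h2 : Refines b c) : Refines a c := by
  refine ⟨h1.1.trans h2.1, ?_⟩
  have h := h1.1
  have h' := h2.1
  rw [← h1.2, ← h2.2, Nat.div_div_eq_div_mul, ← pow_add]
  congr 2
  omega

theorem Refines.eq {a b : ℕ × ℕ} (h : Refines a b) (hk : a.1 = b.1) : a = b := by
  have := h.2
  rw [hk, Nat.sub_self, pow_zero, Nat.div_one] at this
  exact Prod.ext hk this.symm

theorem bisectStep_cases (test : List ℕ → ℕ × ℕ → Bool) (u : List ℕ) (a : ℕ × ℕ) :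
    (∃ b < 2, test u (a.1 + 1, 2 * a.2 + b) = true ∧
      bisectStep test u a = (a.1 + 1, 2 * a.2 + b)) ∨
    (test u (a.1 + 1, 2 * a.2) = false ∧ test u (a.1 + 1, 2 * a.2 + 1) = false ∧
      bisectStep test u a = a) := by
  unfold bisectStep
  cases h0 : test u (a.1 + 1, 2 * a.2) with
  | true => exact Or.inl ⟨0, by norm_num, h0, rfl⟩
  | false =>
    cases h1 : test u (a.1 + 1, 2 * a.2 + 1) with
    | true => exact Or.inl ⟨1, by norm_num, h1, rfl⟩
    | false => exact Or.inr ⟨rfl, rfl, rfl⟩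

theorem refines_bisectStep (test : List ℕ → ℕ × ℕ → Bool) (u : List ℕ) (a : ℕ × ℕ) :
    Refines a (bisectStep test u a) := by
  rcases bisectStep_cases test u a with ⟨b, hb, -, h⟩ | ⟨-, -, h⟩
  · rw [h]
    refine ⟨Nat.le_succ _, ?_⟩
    simp only [Nat.add_sub_cancel_left, pow_one]
    omega
  · rw [h]
    exact Refines.refl a

theorem refines_bisect (test : List ℕ → ℕ × ℕ → Bool) (p : Baire) {m n : ℕ} (h : m ≤ n) :
    Refines (bisect test (pref p m)) (bisect test (pref p n)) := by
  induction h with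
  | refl => exact Refines.refl _
  | step _ ih =>
    refine ih.trans ?_
    rw [Nat.succ_eq_add_one, bisect, accum_pref_succ]
    exact refines_bisectStep _ _ _

/-- Membership in the dyadic interval `[m / 2 ^ k, (m + 1) / 2 ^ k]`. -/
def InDyadic (k m : ℕ) (y : ℝ) : Prop := (m : ℝ) / 2 ^ k ≤ y ∧ y ≤ (m + 1) / 2 ^ k

theorem InDyadic.ancestor {k m n : ℕ} {y : ℝ} (h : InDyadic k m y) (hn : n ≤ k) :
    InDyadic n (m / 2 ^ (k - n)) y := by
  obtain ⟨d, rfl⟩ := Nat.exists_eq_add_of_le hn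
  rw [Nat.add_sub_cancel_left]
  have h1 : ((m / 2 ^ d : ℕ) : ℝ) * 2 ^ d ≤ m := by
    exact_mod_cast Nat.div_mul_le_self m (2 ^ d)
  have h2 : (m : ℝ) + 1 ≤ ((m / 2 ^ d : ℕ) + 1) * 2 ^ d := by
    exact_mod_cast Nat.lt_succ_of_le le_rfl |>.trans_le
      (Nat.succ_le_of_lt (Nat.lt_mul_of_div_lt (Nat.lt_succ_self (m / 2 ^ d)) (by positivity)))
  obtain ⟨h3, h4⟩ := h
  rw [div_le_iff₀ (by positivity)] at h3
  rw [le_div_iff₀ (by positivity)] at h4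
  have hd : (0 : ℝ) < 2 ^ d := by positivity
  constructor
  · rw [div_le_iff₀ (by positivity)]
    rw [pow_add] at h3
    nlinarith
  · rw [le_div_iff₀ (by positivity)]
    rw [pow_add] at h4
    nlinarith

theorem coe_unitSeq_of_mem {c : ℕ} (h0 : 0 ≤ realSeq c) (h1 : realSeq c ≤ 1) :
    (unitSeq c : ℝ) = realSeq c := by
  rw [coe_unitSeq, min_eq_right h1, max_eq_right h0]

theorem dist_dyadicCode_le {n m : ℕ} {y : unitInterval} (h : InDyadic n m y) :
    dist (unitSeq (dyadicCode m 0 n)) y ≤ (1 / 2 : ℝ) ^ n := by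
  have hr : realSeq (dyadicCode m 0 n) = (m : ℝ) / 2 ^ n := by simp [realSeq_dyadicCode]
  have h1 := h.1.trans y.2.2
  rw [Subtype.dist_eq, coe_unitSeq_of_mem (by rw [hr]; positivity) (by rwa [hr]), hr, Real.dist_eq,
    abs_le]
  have h2 := h.2
  rw [add_div] at h2
  have h3 : (1 / 2 : ℝ) ^ n = 1 / 2 ^ n := by rw [one_div_pow]
  have h4 : (0 : ℝ) ≤ 1 / 2 ^ n := by positivity
  constructor <;> linarith [h.1]

namespace BisectTest

variable {X : Type} {f : Problem X unitInterval} {test : List ℕ → ℕ × ℕ → Bool}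
  {Good : X → ℕ → ℕ → Prop}

theorem good (B : BisectTest f test Good) {p : Baire} {x : X} (hp : f.source.IsName p x)
    (hx : x ∈ f.dom) (n : ℕ) : Good x (bisect test (pref p n)).1 (bisect test (pref p n)).2 := by
  induction n with
  | zero => exact B.init x hx
  | succ n ih =>
    rw [bisect, accum_pref_succ]
    rcases bisectStep_cases test (pref p (n + 1)) (bisect test (pref p n)) with
      ⟨b, hb, ht, h⟩ | ⟨-, -, h⟩
    · exact h ▸ B.sound p x hp hx _ _ b _ hb ih ht
    · exact h ▸ ih

/-- The solutions in the current interval form a decreasing sequence of nonempty compact sets. -/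
theorem exists_common_solution (B : BisectTest f test Good) {p : Baire} {x : X}
    (hp : f.source.IsName p x) (hx : x ∈ f.dom) : ∃ y ∈ f.val x,
      ∀ n, InDyadic (bisect test (pref p n)).1 (bisect test (pref p n)).2 y := by
  let C : ℕ → Set unitInterval := fun n => f.val x ∩
    {y | InDyadic (bisect test (pref p n)).1 (bisect test (pref p n)).2 y}
  have hcl : ∀ n, IsClosed (C n) := fun n => (B.closed x).inter
    ((isClosed_le continuous_const continuous_subtype_val).inter
      (isClosed_le continuous_subtype_val continuous_const))
  have hanti : ∀ n, C (n + 1) ⊆ C n := by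
    rintro n y ⟨hy, h⟩
    have hr := refines_bisect test p (Nat.le_succ n)
    have := InDyadic.ancestor h hr.1
    rw [hr.2] at this
    exact ⟨hy, this⟩
  obtain ⟨y, hy⟩ := IsCompact.nonempty_iInter_of_sequence_nonempty_isCompact_isClosed C hanti
    (fun n => B.solvable x hx _ _ (B.good hp hx n)) (hcl 0).isCompact hcl
  rw [Set.mem_iInter] at hy
  exact ⟨y, (hy 0).1, fun n => (hy n).2⟩

/-- Either the bisection ends with an interval whose midpoint is a solution, or it reaches
arbitrarily small intervals. -/
theorem stuck_or_unbounded (B : BisectTest f test Good) {p : Baire} {x : X}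
    (hp : f.source.IsName p x) (hx : x ∈ f.dom) :
    (∃ k m, (∃ s₀, ∀ s ≥ s₀, bisect test (pref p s) = (k, m)) ∧
      ∃ y ∈ f.val x, (y : ℝ) = (2 * m + 1) / 2 ^ (k + 1)) ∨
    ∀ k, ∃ s₀, ∀ s ≥ s₀, k ≤ (bisect test (pref p s)).1 := by
  by_cases h : ∃ s₀, ∀ s ≥ s₀, bisect test (pref p s) = bisect test (pref p s₀)
  · left
    obtain ⟨s₀, hs⟩ := h
    refine ⟨_, _, ⟨s₀, hs⟩, ?_⟩
    -- If the midpoint were not a solution, a test would succeed at all late stages and the next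
    -- step would leave the supposedly final interval.
    rcases B.progress p x hp hx _ _ (B.good hp hx s₀) with h | ⟨s₁, hs₁⟩
    · exact h
    · exfalso
      have h1 := hs₁ (max s₀ s₁ + 1) ((le_max_right _ _).trans (Nat.le_succ _))
      have h2 := hs (max s₀ s₁) (le_max_left _ _)
      have h3 := hs (max s₀ s₁ + 1) ((le_max_left _ _).trans (Nat.le_succ _))
      rw [bisect, accum_pref_succ, ← bisect, h2] at h3
      rcases bisectStep_cases test (pref p (max s₀ s₁ + 1)) (bisect test (pref p s₀)) with
        ⟨b, hb, ht, h⟩ | ⟨ha, hb, -⟩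
      · rw [h] at h3
        have := congrArg Prod.fst h3
        simp at this
      · rw [ha, hb] at h1
        simp at h1
  · right
    push Not at h
    intro k
    induction k with
    | zero => exact ⟨0, fun _ _ => Nat.zero_le _⟩
    | succ k ih =>
      obtain ⟨s₀, hs₀⟩ := ih
      obtain ⟨s₁, hs₁, hne⟩ := h s₀
      refine ⟨s₁, fun s hs => ?_⟩
      have h1 := refines_bisect test p hs₁
      have h2 := (refines_bisect test p hs).1
      have h3 := hs₀ s₀ le_rfl
      rcases h1.1.lt_or_eq with h4 | h4
      · omega
      · exact absurd (h1.eq h4).symm hne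

theorem isLim_of_eventually_eq {q r : Baire} (h : ∀ j, ∃ i₀, ∀ i ≥ i₀, q (Nat.pair i j) = r j) :
    IsLim q r := by
  refine tendsto_pi_nhds.2 fun j => ?_
  obtain ⟨i₀, hi⟩ := h j
  exact tendsto_const_nhds.congr' (eventually_atTop.2 ⟨i₀, fun i hi' => (hi i hi').symm⟩)

/-- Row `i` of the query is the instance for the level reached after `i` symbols. It is read off
`u.take i`, so it does not depend on the stage at which it is written. -/
theorem exists_query {p : Baire} {enc : ℕ → ℕ → ℕ} : ∃ q ∈ transducer (adviceQuery test enc) p,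
    ∀ i j, q (Nat.pair i j) = enc (bisect test (pref p i)).1 j := by
  obtain ⟨q, hq, hval⟩ := exists_mem_transducer (g := adviceQuery test enc) (p := p) fun n =>
    ⟨n.unpair.1, fun s hs => by simp [adviceQuery, hs]⟩
  refine ⟨q, hq, fun i j => ?_⟩
  obtain ⟨s, hs⟩ := hval (Nat.pair i j)
  simp only [adviceQuery, Nat.unpair_pair, length_pref] at hs
  by_cases hi : i ≤ s
  · simp only [hi, decide_true, cond_true, Option.some.injEq, take_pref p hi] at hs
    exact hs.symm
  · simp [hi] at hs

theorem exists_answer_of_unbounded {claim : List ℕ → ℕ → Bool} {p r : Baire} {y : unitInterval}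
    (hy : ∀ n, InDyadic (bisect test (pref p n)).1 (bisect test (pref p n)).2 y)
    (hub : ∀ k, ∃ s₀, ∀ s ≥ s₀, k ≤ (bisect test (pref p s)).1)
    (hr : ∀ j s, claim (pref r s) j = false) :
    ∃ q ∈ transducer (adviceAnswer test claim) (pair p r),
      (cauchyRep unitSeq denseRange_unitSeq).IsName q y := by
  obtain ⟨q, hq, hval⟩ := exists_mem_transducer (g := adviceAnswer test claim) (p := pair p r)
    fun n => by
      obtain ⟨s₀, hs₀⟩ := hub n
      refine ⟨2 * s₀, fun s hs => ?_⟩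
      have := hs₀ ((s + 1) / 2) (by omega)
      simp [adviceAnswer, evens_pref_pair, this]
  refine ⟨q, hq, fun n => ?_⟩
  obtain ⟨s, hs⟩ := hval n
  simp only [adviceAnswer, evens_pref_pair, odds_pref_pair, hr, cond_false] at hs
  by_cases hn : n ≤ (bisect test (pref p ((s + 1) / 2))).1
  · simp only [hn, decide_true, cond_true, Option.some.injEq] at hs
    rw [← hs]
    exact dist_dyadicCode_le ((hy _).ancestor hn)
  · simp [hn] at hs

/-- Every answer fits the final midpoint `y`. An ancestor of the final interval contains `y`, so its
left end point is close enough. Claims of smaller levels never occur, so a midpoint is only given at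
the final interval, where it equals `y`. -/
theorem exists_answer_of_stuck {claim : List ℕ → ℕ → Bool} {p r : Baire} {y : unitInterval}
    {k m : ℕ} (hst : ∃ s₀, ∀ s ≥ s₀, bisect test (pref p s) = (k, m))
    (hy : (y : ℝ) = (2 * m + 1) / 2 ^ (k + 1))
    (hc : ∃ s₀, ∀ s ≥ s₀, claim (pref r s) k = true)
    (hr : ∀ j < k, ∀ s, claim (pref r s) j = false) :
    ∃ q ∈ transducer (adviceAnswer test claim) (pair p r),
      (cauchyRep unitSeq denseRange_unitSeq).IsName q y := by
  obtain ⟨s₀, hs₀⟩ := hst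
  obtain ⟨s₁, hs₁⟩ := hc
  have href : ∀ s, Refines (bisect test (pref p s)) (k, m) := fun s => by
    rw [← hs₀ (max s s₀) (le_max_right _ _)]
    exact refines_bisect test p (le_max_left _ _)
  have hyk : InDyadic k m y := by
    rw [InDyadic, hy, pow_succ]
    constructor
    · rw [div_le_div_iff₀ (by positivity) (by positivity)]
      have : (0 : ℝ) < 2 ^ k := by positivity
      nlinarith
    · rw [div_le_div_iff₀ (by positivity) (by positivity)]
      have : (0 : ℝ) < 2 ^ k := by positivity
      nlinarith
  obtain ⟨q, hq, hval⟩ := exists_mem_transducer (g := adviceAnswer test claim) (p := pair p r)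
    fun n => by
      refine ⟨2 * max s₀ s₁, fun s hs => ?_⟩
      have h1 := hs₀ ((s + 1) / 2) (by omega)
      have h2 := hs₁ (s / 2) (by omega)
      rw [adviceAnswer, evens_pref_pair, odds_pref_pair, h1]
      simp only [h2, cond_true]
      cases decide (n ≤ k) <;> rfl
  refine ⟨q, hq, fun n => ?_⟩
  obtain ⟨s, hs⟩ := hval n
  simp only [adviceAnswer, evens_pref_pair, odds_pref_pair] at hs
  have hrs := href ((s + 1) / 2)
  by_cases hn : n ≤ (bisect test (pref p ((s + 1) / 2))).1
  · simp only [hn, decide_true, cond_true, Option.some.injEq] at hs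
    rw [← hs]
    refine dist_dyadicCode_le (InDyadic.ancestor ?_ hn)
    have := hyk.ancestor hrs.1
    rwa [hrs.2] at this
  · simp only [hn, decide_false, cond_false] at hs
    rcases hrs.1.lt_or_eq with hlt | heq
    · simp [hr _ hlt] at hs
    · rw [hrs.eq heq] at hs
      cases hcl : claim (pref r (s / 2)) k with
      | false => simp [hcl] at hs
      | true =>
        simp only [hcl, cond_true, Option.some.injEq] at hs
        have hz : realSeq (q n) = y := by
          rw [← hs, realSeq_dyadicCode, hy]
          push_cast
          simp
        have : unitSeq (q n) = y := Subtype.ext (by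
          rw [coe_unitSeq_of_mem (by rw [hz]; exact y.2.1) (by rw [hz]; exact y.2.2), hz])
        rw [this, dist_self]
        positivity

/-- The rows of the query converge to `enc k` if bisection stops at level `k`, and to `encLim` if it
reaches all levels. In both cases the query names a valid instance of the jump, although no stage
reveals which case holds. -/
theorem reducible_jump {Z W : Type} {h : Problem Z W} {enc : ℕ → ℕ → ℕ} {encLim : ℕ → ℕ}
    {claim : List ℕ → ℕ → Bool} (B : BisectTest f test Good) (A : StuckAdvice h enc encLim claim) :
    Reducible f h.jump := by
  refine ⟨transducer (adviceAnswer test claim), transducer (adviceQuery test enc),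
    isComputable_transducer (primrec_adviceAnswer B.primrec A.primrec_claim),
    isComputable_transducer (primrec_adviceQuery B.primrec A.primrec_enc), ?_⟩
  intro G hG p x hp hx
  obtain ⟨c, hc, hcv⟩ := exists_query (test := test) (p := p) (enc := enc)
  have finish : ∀ r ∈ G c, ∀ q ∈ transducer (adviceAnswer test claim) (pair p r),
      q ∈ reduct (transducer (adviceAnswer test claim)) (transducer (adviceQuery test enc)) G p :=
    fun r hr q hq => Part.mem_bind hc (Part.mem_bind hr hq)
  rcases B.stuck_or_unbounded hp hx with ⟨k, m, hst, y, hy, hym⟩ | hub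
  · obtain ⟨z, hz, hkz, hsol⟩ := A.stuck k
    have hlim : IsLim c (enc k) := isLim_of_eventually_eq fun j => by
      obtain ⟨s₀, hs₀⟩ := hst
      exact ⟨s₀, fun i hi => by rw [hcv, hs₀ i hi]⟩
    obtain ⟨r, hr, v, hv, hrv⟩ := hG c z ⟨_, hlim, hkz⟩ hz
    obtain ⟨h1, h2⟩ := hsol v hv r hrv
    obtain ⟨q, hq, hqy⟩ := exists_answer_of_stuck hst hym h1 h2
    exact ⟨q, finish r hr q hq, y, hy, B.target ▸ hqy⟩
  · obtain ⟨z, hz, hkz, hsol⟩ := A.unstuck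
    have hlim : IsLim c encLim := isLim_of_eventually_eq fun j => by
      obtain ⟨k₀, hk₀⟩ := A.lim j
      obtain ⟨s₀, hs₀⟩ := hub k₀
      exact ⟨s₀, fun i hi => by rw [hcv, hk₀ _ (hs₀ i hi)]⟩
    obtain ⟨r, hr, v, hv, hrv⟩ := hG c z ⟨_, hlim, hkz⟩ hz
    obtain ⟨y, hy, hyd⟩ := B.exists_common_solution hp hx
    obtain ⟨q, hq, hqy⟩ := exists_answer_of_unbounded hyd hub (hsol v hv r hrv)
    exact ⟨q, finish r hr q hq, y, hy, B.target ▸ hqy⟩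

end BisectTest

/-! ### Weak weak Kőnig's lemma as advice -/

/-- The number of leading `true`s of a binary word. -/
def lead (w : List Bool) : ℕ := w.findIdx (!·)

theorem lead_le (w : List Bool) : lead w ≤ w.length := List.findIdx_le_length

theorem lead_prefix {u w : List Bool} (h : u <+: w) : lead u = min (lead w) u.length := by
  have h1 : lead u ≤ lead w := h.findIdx_le
  have h2 := lead_le u
  rcases h2.lt_or_eq with h3 | h3
  · have h4 : lead w = lead u := h.findIdx_eq_of_findIdx_lt_length h3
    omega
  · omega

/-- A word of length `l` with `t` leading `true`s belongs to the `k`-th advice tree, whose paths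
start with exactly `k + 1` times `true`. -/
def AdviceWord (k l t : ℕ) : Prop := l ≤ k + 1 ∧ (t = l ∨ t = 0) ∨ k + 1 < l ∧ t = k + 1

instance (k l t : ℕ) : Decidable (AdviceWord k l t) := by unfold AdviceWord; infer_instance

/-- The tree of the binary words `w` that satisfy `P |w| (lead w)`. -/
def leadTree (P : ℕ → ℕ → Prop) (hP : ∀ l t l', l' ≤ l → P l t → P l' (min t l')) : BinTree where
  words := {w | P w.length (lead w)}
  closed u v huv hv := by
    change P u.length (lead u)
    rw [lead_prefix huv]
    exact hP _ _ _ huv.length_le hv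

/-- The characteristic function of `leadTree P`. -/
def leadName (P : ℕ → ℕ → Prop) [∀ l t, Decidable (P l t)] (e : ℕ) : ℕ :=
  match (Encodable.decode e : Option (List Bool)) with
  | none => 0
  | some w => if P w.length (lead w) then 1 else 0

theorem isName_leadName (P : ℕ → ℕ → Prop) [∀ l t, Decidable (P l t)]
    (hP : ∀ l t l', l' ≤ l → P l t → P l' (min t l')) :
    treeRep.IsName (leadName P) (leadTree P hP) := by
  intro w
  simp [leadName, leadTree]

/-- Once a word contains `false`, its number of leading `true`s is final. The whole cylinder of `v`
therefore consists of paths. -/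
theorem pos_paths_leadTree {P : ℕ → ℕ → Prop} {hP : ∀ l t l', l' ≤ l → P l t → P l' (min t l')}
    (v : List Bool) (hv : ∀ l, v.length ≤ l → P l (lead v))
    (hv' : lead v < v.length) : 0 < cantorMeasure (leadTree P hP).paths := by
  have hsub : {x | pref x v.length = v} ⊆ (leadTree P hP).paths := by
    intro x hx n
    have h1 : v <+: pref x (max n v.length) := by
      conv_lhs => rw [← show pref x v.length = v from hx]
      exact pref_prefix x (le_max_right _ _)
    have h2 : lead (pref x (max n v.length)) = lead v := h1.findIdx_eq_of_findIdx_lt_length hv'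
    have h3 : pref x (max n v.length) ∈ (leadTree P hP).words := by
      change P _ _
      rw [h2, length_pref]
      exact hv _ (le_max_right _ _)
    exact (leadTree P hP).closed _ _ (pref_prefix x (le_max_left _ _)) h3
  refine lt_of_lt_of_le ?_ (measure_mono hsub)
  rw [cantorMeasure_cylinder]
  exact ENNReal.pow_pos (by simp) _

/-- The beginning `v` of a sequence claims `k` if it starts with exactly `k + 1` ones. -/
def leadClaim (v : List ℕ) (k : ℕ) : Bool :=
  decide (v.findIdx (fun a => decide (a ≠ 1)) = k + 1) && decide (k + 1 < v.length)

theorem leadClaim_pref (x : Cantor) (s k : ℕ) : leadClaim (pref (cantorCode x) s) k = true ↔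
    lead (pref x s) = k + 1 ∧ k + 1 < s := by
  have h : (pref (cantorCode x) s).findIdx (fun a => decide (a ≠ 1)) = lead (pref x s) := by
    have : pref (cantorCode x) s = (pref x s).map Bool.toNat := by
      simp [pref, cantorCode, Function.comp_def]
    rw [this, List.findIdx_map, lead]
    congr 1
    funext b
    cases b <;> rfl
  rw [leadClaim, h]
  simp

theorem primrec_lead : Primrec lead :=
  Primrec.list_findIdx Primrec.id (Primrec.not.comp Primrec.snd)

/-- Paths of the `k`-th tree start with exactly `k + 1` times `true`, so they claim `k` only. Its
short words starting with `false` are dead ends: they are kept so that for `k → ∞` the trees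
converge to one that contains the cylinder of `false` and has positive measure. The limit has only
one other path, constantly `true`, where no block of `true`s ends and nothing is claimed. -/
theorem stuckAdvice_WWKL : StuckAdvice WWKL (fun k => leadName (AdviceWord k))
    (leadName fun l t => t = l ∨ t = 0) leadClaim where
  primrec_enc := by
    have hk : Primrec fun a : (ℕ × ℕ) × List Bool => a.1.1 + 1 :=
      Primrec.succ.comp (Primrec.fst.comp Primrec.fst)
    have hl : Primrec fun a : (ℕ × ℕ) × List Bool => a.2.length :=
      Primrec.list_length.comp Primrec.snd
    have ht : Primrec fun a : (ℕ × ℕ) × List Bool => lead a.2 := primrec_lead.comp Primrec.snd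
    have hP : PrimrecPred fun a : (ℕ × ℕ) × List Bool =>
        AdviceWord a.1.1 a.2.length (lead a.2) :=
      ((Primrec.nat_le.comp hl hk).and ((Primrec.eq.comp ht hl).or
        (Primrec.eq.comp ht (Primrec.const 0)))).or
          ((Primrec.nat_lt.comp hk hl).and (Primrec.eq.comp ht hk))
    refine (Primrec.option_casesOn
      (o := fun a : ℕ × ℕ => (Encodable.decode a.2 : Option (List Bool)))
      (Primrec.decode.comp Primrec.snd) (Primrec.const 0)
      (Primrec.ite hP (Primrec.const 1) (Primrec.const 0)).to₂).of_eq fun a => ?_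
    change _ = leadName (AdviceWord a.1) a.2
    unfold leadName
    cases (Encodable.decode a.2 : Option (List Bool)) <;> rfl
  primrec_claim := by
    have h1 : Primrec fun a : List ℕ × ℕ => a.1.findIdx fun c => decide (c ≠ 1) :=
      Primrec.list_findIdx Primrec.fst
        ((Primrec.eq.comp Primrec.snd (Primrec.const 1)).not.decide)
    have h2 : Primrec fun a : List ℕ × ℕ => a.2 + 1 := Primrec.succ.comp Primrec.snd
    exact Primrec.and.comp (Primrec.eq.decide.comp h1 h2)
      (Primrec.nat_lt.decide.comp h2 (Primrec.list_length.comp Primrec.fst))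
  lim e := by
    unfold leadName
    cases h : (Encodable.decode e : Option (List Bool)) with
    | none => exact ⟨0, fun _ _ => rfl⟩
    | some w =>
      -- From `k = |w|` on, `w` is short and the `k`-th tree decides it like the limit tree.
      refine ⟨w.length, fun k hk => ?_⟩
      have : AdviceWord k w.length (lead w) ↔ lead w = w.length ∨ lead w = 0 := by
        unfold AdviceWord; omega
      simp only [this]
  stuck k := by
    have hP : ∀ l t l', l' ≤ l → AdviceWord k l t → AdviceWord k l' (min t l') := by
      unfold AdviceWord
      intros
      omega
    have hlead : lead (List.replicate (k + 1) true ++ [false]) = k + 1 := by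
      have h : (List.replicate (k + 1) true).findIdx (!·) = k + 1 := by
        rw [List.findIdx_eq_length_of_false (by simp), List.length_replicate]
      simp [lead, List.findIdx_append, h]
    have hpos : 0 < cantorMeasure (leadTree (AdviceWord k) hP).paths := by
      refine pos_paths_leadTree (List.replicate (k + 1) true ++ [false]) ?_ (by rw [hlead]; simp)
      intro l hl
      rw [hlead]
      simp only [List.length_append, List.length_replicate, List.length_singleton] at hl
      exact Or.inr ⟨by omega, rfl⟩
    obtain ⟨x₀, hx₀⟩ := nonempty_of_measure_ne_zero hpos.ne'
    refine ⟨leadTree (AdviceWord k) hP, ⟨x₀, hpos, hx₀⟩, isName_leadName _ hP, ?_⟩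
    rintro x ⟨-, hx⟩ _ rfl
    have hx' : ∀ s, AdviceWord k s (lead (pref x s)) := fun s => by
      have : AdviceWord k (pref x s).length (lead (pref x s)) := hx s
      rwa [length_pref] at this
    unfold AdviceWord at hx'
    refine ⟨⟨k + 2, fun s hs => ?_⟩, fun j hj s => ?_⟩
    · rw [leadClaim_pref]
      have := hx' s
      omega
    · rw [← Bool.not_eq_true, leadClaim_pref]
      have := hx' s
      omega
  unstuck := by
    have hP : ∀ l t l', l' ≤ l → t = l ∨ t = 0 → min t l' = l' ∨ min t l' = 0 := by
      intros
      omega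
    have hpos : 0 < cantorMeasure (leadTree (fun l t => t = l ∨ t = 0) hP).paths :=
      pos_paths_leadTree [false] (fun l _ => Or.inr rfl) (by simp [lead])
    obtain ⟨x₀, hx₀⟩ := nonempty_of_measure_ne_zero hpos.ne'
    refine ⟨leadTree _ hP, ⟨x₀, hpos, hx₀⟩, isName_leadName _ hP, ?_⟩
    rintro x ⟨-, hx⟩ _ rfl j s
    have hx' : lead (pref x s) = (pref x s).length ∨ lead (pref x s) = 0 := hx s
    rw [length_pref] at hx'
    rw [← Bool.not_eq_true, leadClaim_pref]
    omega

/-! ### Probabilistic choice as advice -/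

/-- The code of a ball that consists of the points greater than `1 / 2 + 1 / 2 ^ (i + 1)`. -/
def upperBall (i : ℕ) : ℕ := Nat.pair (dyadicCode 1 0 0) (dyadicCode (2 ^ i) 1 (i + 1))

/-- The code of a ball that consists of the points less than `1 / 2 + 3 / 2 ^ (k + 3)`. -/
def lowerBall (k : ℕ) : ℕ := Nat.pair (dyadicCode 0 0 0) (dyadicCode (2 ^ (k + 2) + 3) 0 (k + 3))

theorem ratBall_unitSeq_pair (a b : ℕ) :
    ratBall unitSeq (Nat.pair a b) = {y | dist y (unitSeq a) < realSeq b} := by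
  simp only [ratBall, Nat.unpair_pair]
  rfl

theorem ratBall_upperBall (i : ℕ) : ratBall unitSeq (upperBall i) =
    {y : unitInterval | 1 / 2 + 1 / 2 ^ (i + 1) < (y : ℝ)} := by
  have h1 : (unitSeq (dyadicCode 1 0 0) : ℝ) = 1 := by
    rw [coe_unitSeq_of_mem] <;> simp [realSeq_dyadicCode]
  have h2 : realSeq (dyadicCode (2 ^ i) 1 (i + 1)) = 1 / 2 - 1 / 2 ^ (i + 1) := by
    rw [realSeq_dyadicCode, pow_succ]
    push_cast
    field_simp
  ext y
  have := y.2.2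
  rw [upperBall, ratBall_unitSeq_pair, Set.mem_ofPred_eq, Set.mem_ofPred_eq, Subtype.dist_eq, h1, h2,
    Real.dist_eq, abs_sub_comm, abs_of_nonneg (by linarith)]
  constructor <;> intro <;> linarith

theorem ratBall_lowerBall (k : ℕ) : ratBall unitSeq (lowerBall k) =
    {y : unitInterval | (y : ℝ) < 1 / 2 + 3 / 4 / 2 ^ (k + 1)} := by
  have h1 : (unitSeq (dyadicCode 0 0 0) : ℝ) = 0 := by
    rw [coe_unitSeq_of_mem] <;> simp [realSeq_dyadicCode]
  have h2 : realSeq (dyadicCode (2 ^ (k + 2) + 3) 0 (k + 3)) = 1 / 2 + 3 / 4 / 2 ^ (k + 1) := by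
    rw [realSeq_dyadicCode]
    push_cast
    field_simp
    ring
  ext y
  have := y.2.1
  rw [lowerBall, ratBall_unitSeq_pair, Set.mem_ofPred_eq, Set.mem_ofPred_eq, Subtype.dist_eq, h1, h2,
    Real.dist_eq, sub_zero, abs_of_nonneg this]

/-- A list of balls that exhausts the complement of
`[1 / 2 + 3 / 2 ^ (k + 3), 1 / 2 + 1 / 2 ^ (k + 1)]`. -/
def ballAdvice (k i : ℕ) : ℕ := if i = k + 1 then lowerBall k else upperBall (min i k)

/-- The code `c` of a rational greater than `1 / 2 + 10 / 2 ^ (k + 5)`, as an inequality between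
natural numbers. -/
def IsAbove (c k : ℕ) : Prop :=
  (2 ^ (k + 4) + 10) * (c.unpair.2 + 1) + c.unpair.1.unpair.2 * 2 ^ (k + 5) <
    c.unpair.1.unpair.1 * 2 ^ (k + 5)

instance (c k : ℕ) : Decidable (IsAbove c k) := by unfold IsAbove; infer_instance

theorem isAbove_iff (c k : ℕ) : IsAbove c k ↔ 1 / 2 + 10 / 2 ^ (k + 5) < (unitSeq c : ℝ) := by
  have h1 : (1 / 2 : ℝ) + 10 / 2 ^ (k + 5) = ((2 ^ (k + 4) + 10 : ℕ) : ℝ) / ((2 ^ (k + 5) : ℕ) : ℝ) := by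
    push_cast
    field_simp
    ring
  have h2 : (1 / 2 : ℝ) + 10 / 2 ^ (k + 5) < 1 := by
    have : (1 : ℝ) ≤ 2 ^ k := one_le_pow₀ (by norm_num)
    rw [pow_add]
    have : (10 : ℝ) / (2 ^ k * 2 ^ 5) ≤ 10 / 32 := by
      apply div_le_div_of_nonneg_left <;> nlinarith
    linarith
  have h3 : (0 : ℝ) < 1 / 2 + 10 / 2 ^ (k + 5) := by positivity
  -- The threshold lies strictly between `0` and `1`, so clamping to `[0, 1]` does not affect the
  -- comparison.
  have h4 : 1 / 2 + 10 / 2 ^ (k + 5) < (unitSeq c : ℝ) ↔ 1 / 2 + 10 / 2 ^ (k + 5) < realSeq c := by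
    rw [coe_unitSeq, lt_max_iff, lt_min_iff]
    constructor
    · rintro (h | h)
      · linarith
      · exact h.2
    · exact fun h => Or.inr ⟨h2, h⟩
  rw [h4, h1, realSeq, ratOf]
  push_cast
  rw [div_lt_div_iff₀ (by positivity) (by positivity), IsAbove, ← Nat.cast_lt (α := ℝ)]
  push_cast
  constructor <;> intro h <;> linarith

/-- The beginning `v` of a name of a real number claims `k` if its entry number `k + 5` is above
the threshold `1 / 2 + 10 / 2 ^ (k + 5)`. -/
def ballClaim (v : List ℕ) (k : ℕ) : Bool :=
  decide (k + 5 < v.length) && decide (IsAbove (v.getD (k + 5) 0) k)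

theorem ballClaim_pref (r : Baire) (s k : ℕ) : ballClaim (pref r s) k = true ↔
    k + 5 < s ∧ 1 / 2 + 10 / 2 ^ (k + 5) < (unitSeq (r (k + 5)) : ℝ) := by
  simp only [ballClaim, length_pref, Bool.and_eq_true, decide_eq_true_eq]
  refine and_congr_right fun h => ?_
  rw [List.getD, getElem?_pref r h, Option.getD_some, isAbove_iff]

theorem primrec_upperBall : Primrec upperBall :=
  Primrec₂.natPair.comp (Primrec.const _) (primrec_dyadicCode (primrec_two_pow Primrec.id)
    (Primrec.const 1) Primrec.succ)

theorem primrec_lowerBall : Primrec lowerBall :=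
  Primrec₂.natPair.comp (Primrec.const _) (primrec_dyadicCode
    (Primrec.nat_add.comp (primrec_two_pow (Primrec.nat_add.comp Primrec.id (Primrec.const 2)))
      (Primrec.const 3)) (Primrec.const 0) (Primrec.nat_add.comp Primrec.id (Primrec.const 3)))

theorem primrec_ballClaim : Primrec₂ ballClaim := by
  have hk : ∀ n, Primrec fun a : List ℕ × ℕ => a.2 + n := fun n =>
    Primrec.nat_add.comp Primrec.snd (Primrec.const n)
  have hc : Primrec fun a : List ℕ × ℕ => a.1.getD (a.2 + 5) 0 :=
    (Primrec.list_getD 0).comp Primrec.fst (hk 5)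
  have hu := Primrec.unpair.comp hc
  have hu1 := Primrec.unpair.comp (Primrec.fst.comp hu)
  have hp := primrec_two_pow (hk 5)
  have habove : PrimrecPred fun a : List ℕ × ℕ => IsAbove (a.1.getD (a.2 + 5) 0) a.2 :=
    Primrec.nat_lt.comp
      (Primrec.nat_add.comp (Primrec.nat_mul.comp
          (Primrec.nat_add.comp (primrec_two_pow (hk 4)) (Primrec.const 10))
          (Primrec.succ.comp (Primrec.snd.comp hu)))
        (Primrec.nat_mul.comp (Primrec.snd.comp hu1) hp))
      (Primrec.nat_mul.comp (Primrec.fst.comp hu1) hp)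
  exact Primrec.and.comp
    (Primrec.nat_lt.decide.comp (hk 5) (Primrec.list_length.comp Primrec.fst)) habove.decide

/-- With `d = 2⁻⁽ᵏ⁺¹⁾`, level `k` is coded by `[1/2 + 3d/4, 1/2 + d]` and "never" by `[0, 1/2]`. The
ball that removes the lower part is listed at index `k + 1` and disappears for `k → ∞`. In units of
`2⁻⁽ᵏ⁺⁵⁾ = d / 16`, points of level `k` exceed `1/2` by at least `12`, and points of higher levels
by at most `8`. With the error `1` of entry `k + 5` this is at least `11` and at most `9`, so the
threshold `10` separates them. -/
theorem stuckAdvice_PCUnit : StuckAdvice PCUnit ballAdvice upperBall ballClaim where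
  primrec_enc := Primrec.ite (Primrec.eq.comp Primrec.snd (Primrec.succ.comp Primrec.fst))
    (primrec_lowerBall.comp Primrec.fst)
    (primrec_upperBall.comp (Primrec.nat_min.comp Primrec.snd Primrec.fst))
  primrec_claim := primrec_ballClaim
  lim e := ⟨e, fun k hk => by rw [ballAdvice, if_neg (by omega), min_eq_left hk]⟩
  stuck k := by
    have hh : (0 : ℝ) < 1 / 2 ^ (k + 1) := by positivity
    have hh1 : (1 : ℝ) / 2 ^ (k + 1) ≤ 1 / 2 := by
      rw [pow_succ]
      have : (1 : ℝ) ≤ 2 ^ k := one_le_pow₀ (by norm_num)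
      apply div_le_div_of_nonneg_left <;> nlinarith
    have hq : (3 : ℝ) / 4 / 2 ^ (k + 1) = 3 / 4 * (1 / 2 ^ (k + 1)) := by ring
    set d : ℝ := 1 / 2 ^ (k + 1)
    let a : unitInterval := ⟨1 / 2 + 3 / 4 * d, by constructor <;> linarith⟩
    let b : unitInterval := ⟨1 / 2 + d, by constructor <;> linarith⟩
    have hpos : 0 < volume (Set.Icc a b) := by
      rw [unitInterval.volume_Icc, ENNReal.ofReal_pos]
      simp only [a, b]
      linarith
    have hab : a ≤ b := Subtype.coe_le_coe.1 (by simp only [a, b]; linarith)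
    refine ⟨⟨Set.Icc a b, isClosed_Icc⟩, ⟨a, hpos, Set.left_mem_Icc.2 hab⟩, ?_, ?_⟩
    · change (Set.Icc a b)ᶜ = ⋃ i, ratBall unitSeq (ballAdvice k i)
      ext y
      rw [Set.mem_compl_iff, Set.mem_Icc, not_and_or, not_le, not_le, Set.mem_iUnion]
      constructor
      · rintro (h | h)
        · refine ⟨k + 1, ?_⟩
          rw [ballAdvice, if_pos rfl, ratBall_lowerBall, Set.mem_ofPred_eq, hq]
          exact h
        · refine ⟨k, ?_⟩
          rw [ballAdvice, if_neg (by omega), min_self, ratBall_upperBall]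
          exact h
      · rintro ⟨i, hi⟩
        unfold ballAdvice at hi
        split_ifs at hi
        · rw [ratBall_lowerBall, Set.mem_ofPred_eq, hq] at hi
          exact Or.inl hi
        · rw [ratBall_upperBall, Set.mem_ofPred_eq] at hi
          right
          refine Subtype.coe_lt_coe.1 (lt_of_le_of_lt ?_ hi)
          change 1 / 2 + 1 / 2 ^ (k + 1) ≤ (_ : ℝ)
          gcongr
          · norm_num
          · exact min_le_right _ _
    · rintro y ⟨-, hy1, hy2⟩ r hr
      have hy1' : 1 / 2 + 3 / 4 * d ≤ (y : ℝ) := hy1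
      have hy2' : (y : ℝ) ≤ 1 / 2 + d := hy2
      have hname : ∀ n, |(unitSeq (r n) : ℝ) - y| ≤ (1 / 2 : ℝ) ^ n := hr
      refine ⟨⟨k + 6, fun s hs => ?_⟩, fun j hj s => ?_⟩
      · rw [ballClaim_pref]
        refine ⟨by omega, ?_⟩
        have h1 := (abs_le.1 (hname (k + 5))).1
        have h2 : (1 / 2 : ℝ) ^ (k + 5) = d / 16 := by
          simp only [d]; rw [one_div_pow]; field_simp; ring
        have h3 : (10 : ℝ) / 2 ^ (k + 5) = 10 / 16 * d := by simp only [d]; field_simp; ring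
        rw [h3]
        rw [h2] at h1
        linarith
      · rw [← Bool.not_eq_true, ballClaim_pref]
        rintro ⟨-, h⟩
        have h1 := (abs_le.1 (hname (j + 5))).2
        have h2 : (1 / 2 : ℝ) ^ (j + 5) = 1 / 2 ^ (j + 5) := one_div_pow _ _
        have h3 : d ≤ 8 * (1 / 2 ^ (j + 5)) := by
          have : 8 * (1 / 2 ^ (j + 5) : ℝ) = 1 / 2 ^ (j + 2) := by field_simp; ring
          rw [this]
          exact one_div_le_one_div_of_le (by positivity)
            (pow_le_pow_right₀ (by norm_num) (by omega))
        have h4 : (10 : ℝ) / 2 ^ (j + 5) = 10 * (1 / 2 ^ (j + 5)) := by ring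
        have h5 : (0 : ℝ) < 1 / 2 ^ (j + 5) := by positivity
        rw [h4] at h
        rw [h2] at h1
        linarith
  unstuck := by
    let b : unitInterval := ⟨1 / 2, by constructor <;> norm_num⟩
    have hpos : 0 < volume (Set.Iic b) := by
      rw [unitInterval.volume_Iic, ENNReal.ofReal_pos]
      simp only [b]
      norm_num
    refine ⟨⟨Set.Iic b, isClosed_Iic⟩, ⟨b, hpos, Set.self_mem_Iic⟩, ?_, ?_⟩
    · change (Set.Iic b)ᶜ = ⋃ i, ratBall unitSeq (upperBall i)
      ext y
      simp only [ratBall_upperBall, Set.mem_compl_iff, Set.mem_Iic, not_le, Set.mem_iUnion,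
        Set.mem_ofPred_eq]
      constructor
      · intro h
        have h' : (1 / 2 : ℝ) < y := h
        obtain ⟨i, hi⟩ : ∃ i : ℕ, (1 / 2 : ℝ) ^ i < y - 1 / 2 :=
          exists_pow_lt_of_lt_one (by linarith) (by norm_num)
        refine ⟨i, ?_⟩
        have : (1 : ℝ) / 2 ^ (i + 1) ≤ (1 / 2) ^ i := by
          rw [one_div_pow]
          gcongr
          · norm_num
          · omega
        linarith
      · rintro ⟨i, hi⟩
        refine Subtype.coe_lt_coe.1 (lt_trans ?_ hi)
        simp only [b]
        have : (0 : ℝ) < 1 / 2 ^ (i + 1) := by positivity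
        linarith
    · rintro y ⟨-, hy⟩ r hr j s
      have hy' : (y : ℝ) ≤ 1 / 2 := hy
      have hname : ∀ n, |(unitSeq (r n) : ℝ) - y| ≤ (1 / 2 : ℝ) ^ n := hr
      rw [← Bool.not_eq_true, ballClaim_pref]
      rintro ⟨-, h⟩
      have h1 := (abs_le.1 (hname (j + 5))).2
      rw [one_div_pow] at h1
      have h4 : (10 : ℝ) / 2 ^ (j + 5) = 10 * (1 / 2 ^ (j + 5)) := by ring
      have h5 : (0 : ℝ) < 1 / 2 ^ (j + 5) := by positivity
      rw [h4] at h
      linarith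

/-! ### Bisection for the intermediate value theorem -/

/-- The rational with code `c` is at most `m / 2 ^ k`, as an inequality of natural numbers. -/
def LeDyadic (c : ℕ) (a : ℕ × ℕ) : Prop :=
  c.unpair.1.unpair.1 * 2 ^ a.1 ≤ a.2 * (c.unpair.2 + 1) + c.unpair.1.unpair.2 * 2 ^ a.1

/-- The rational with code `c` is at least `m / 2 ^ k`, as an inequality of natural numbers. -/
def GeDyadic (c : ℕ) (a : ℕ × ℕ) : Prop :=
  a.2 * (c.unpair.2 + 1) + c.unpair.1.unpair.2 * 2 ^ a.1 ≤ c.unpair.1.unpair.1 * 2 ^ a.1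

theorem realSeq_eq (c : ℕ) : realSeq c =
    ((c.unpair.1.unpair.1 : ℝ) - c.unpair.1.unpair.2) / ((c.unpair.2 : ℝ) + 1) := by
  simp [realSeq, ratOf]

theorem leDyadic_iff (c k m : ℕ) : LeDyadic c (k, m) ↔ realSeq c ≤ (m : ℝ) / 2 ^ k := by
  rw [realSeq_eq, div_le_div_iff₀ (by positivity) (by positivity), LeDyadic, ← Nat.cast_le (α := ℝ)]
  push_cast
  constructor <;> intro h <;> linarith

theorem geDyadic_iff (c k m : ℕ) : GeDyadic c (k, m) ↔ (m : ℝ) / 2 ^ k ≤ realSeq c := by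
  rw [realSeq_eq, div_le_div_iff₀ (by positivity) (by positivity), GeDyadic, ← Nat.cast_le (α := ℝ)]
  push_cast
  constructor <;> intro h <;> linarith

theorem realSeq_pos_iff (c : ℕ) :
    0 < realSeq c ↔ c.unpair.1.unpair.2 < c.unpair.1.unpair.1 := by
  rw [realSeq_eq, div_pos_iff_of_pos_right (by positivity), sub_pos, Nat.cast_lt]

theorem realSeq_neg_iff (c : ℕ) :
    realSeq c < 0 ↔ c.unpair.1.unpair.1 < c.unpair.1.unpair.2 := by
  rw [realSeq_eq, div_lt_iff₀ (by positivity), zero_mul, sub_neg, Nat.cast_lt]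

section

variable {α : Type} [Primcodable α]

theorem primrec_unpair_fst {f : α → ℕ} (hf : Primrec f) : Primrec fun a => (f a).unpair.1 :=
  Primrec.fst.comp (Primrec.unpair.comp hf)

theorem primrec_unpair_snd {f : α → ℕ} (hf : Primrec f) : Primrec fun a => (f a).unpair.2 :=
  Primrec.snd.comp (Primrec.unpair.comp hf)

theorem primrecPred_leDyadic {c : α → ℕ} {a : α → ℕ × ℕ} (hc : Primrec c) (ha : Primrec a) :
    PrimrecPred fun x => LeDyadic (c x) (a x) :=
  Primrec.nat_le.comp
    (Primrec.nat_mul.comp (primrec_unpair_fst (primrec_unpair_fst hc))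
      (primrec_two_pow (Primrec.fst.comp ha)))
    (Primrec.nat_add.comp (Primrec.nat_mul.comp (Primrec.snd.comp ha)
        (Primrec.succ.comp (primrec_unpair_snd hc)))
      (Primrec.nat_mul.comp (primrec_unpair_snd (primrec_unpair_fst hc))
        (primrec_two_pow (Primrec.fst.comp ha))))

theorem primrecPred_geDyadic {c : α → ℕ} {a : α → ℕ × ℕ} (hc : Primrec c) (ha : Primrec a) :
    PrimrecPred fun x => GeDyadic (c x) (a x) :=
  Primrec.nat_le.comp
    (Primrec.nat_add.comp (Primrec.nat_mul.comp (Primrec.snd.comp ha)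
        (Primrec.succ.comp (primrec_unpair_snd hc)))
      (Primrec.nat_mul.comp (primrec_unpair_snd (primrec_unpair_fst hc))
        (primrec_two_pow (Primrec.fst.comp ha))))
    (Primrec.nat_mul.comp (primrec_unpair_fst (primrec_unpair_fst hc))
      (primrec_two_pow (Primrec.fst.comp ha)))

end

/-- `NegAt` at a dyadic point. -/
def NegAtDyadic (c : ℕ) (a : ℕ × ℕ) : Prop := NegAt c ((a.2 : ℝ) / 2 ^ a.1)

/-- `PosAt` at a dyadic point. -/
def PosAtDyadic (c : ℕ) (a : ℕ × ℕ) : Prop := PosAt c ((a.2 : ℝ) / 2 ^ a.1)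

theorem primrecRel_negAtDyadic : PrimrecRel NegAtDyadic := by
  have h1 := primrec_unpair_fst (α := ℕ × (ℕ × ℕ)) Primrec.fst
  have h2 := primrec_unpair_snd (primrec_unpair_snd (α := ℕ × (ℕ × ℕ)) Primrec.fst)
  refine ((primrecPred_leDyadic (primrec_unpair_fst h1) Primrec.snd).and
    ((primrecPred_geDyadic (primrec_unpair_snd h1) Primrec.snd).and
      (Primrec.nat_lt.comp (primrec_unpair_fst (primrec_unpair_fst h2))
        (primrec_unpair_snd (primrec_unpair_fst h2))))).of_eq ?_
  rintro ⟨c, k, m⟩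
  simp only [NegAtDyadic, NegAt, leDyadic_iff, geDyadic_iff, realSeq_neg_iff]

theorem primrecRel_posAtDyadic : PrimrecRel PosAtDyadic := by
  have h1 := primrec_unpair_fst (α := ℕ × (ℕ × ℕ)) Primrec.fst
  have h2 := primrec_unpair_fst (primrec_unpair_snd (α := ℕ × (ℕ × ℕ)) Primrec.fst)
  refine ((primrecPred_leDyadic (primrec_unpair_fst h1) Primrec.snd).and
    ((primrecPred_geDyadic (primrec_unpair_snd h1) Primrec.snd).and
      (Primrec.nat_lt.comp (primrec_unpair_snd (primrec_unpair_fst h2))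
        (primrec_unpair_fst (primrec_unpair_fst h2))))).of_eq ?_
  rintro ⟨c, k, m⟩
  simp only [PosAtDyadic, PosAt, leDyadic_iff, geDyadic_iff, realSeq_pos_iff]

/-- The boxes in the list `u` witness opposite signs at the end points of a dyadic interval. -/
def HasSignChange (u : List ℕ) (a : ℕ × ℕ) : Prop :=
  ((∃ c ∈ u, NegAtDyadic c a) ∧ ∃ c ∈ u, PosAtDyadic c (a.1, a.2 + 1)) ∨
    ((∃ c ∈ u, PosAtDyadic c a) ∧ ∃ c ∈ u, NegAtDyadic c (a.1, a.2 + 1))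

theorem primrecRel_hasSignChange : PrimrecRel HasSignChange := by
  have hs : Primrec fun x : List ℕ × (ℕ × ℕ) => (x.2.1, x.2.2 + 1) :=
    (Primrec.fst.comp Primrec.snd).pair (Primrec.succ.comp (Primrec.snd.comp Primrec.snd))
  have hn := primrecRel_negAtDyadic.exists_mem_list
  have hp := primrecRel_posAtDyadic.exists_mem_list
  exact ((hn.comp Primrec.fst Primrec.snd).and (hp.comp Primrec.fst hs)).or
    ((hp.comp Primrec.fst Primrec.snd).and (hn.comp Primrec.fst hs))

open Classical in
/-- The bisection test for sign changes. -/
noncomputable def signTest (u : List ℕ) (a : ℕ × ℕ) : Bool := decide (HasSignChange u a)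

theorem primrec_signTest : Primrec₂ signTest := by
  classical exact PrimrecPred.decide primrecRel_hasSignChange

/-- The function `f` changes its sign on a dyadic interval. -/
def GoodSign (f : C(unitInterval, ℝ)) (k m : ℕ) : Prop :=
  ∃ x y : unitInterval, (x : ℝ) = m / 2 ^ k ∧ (y : ℝ) = (m + 1) / 2 ^ k ∧ f x * f y < 0

theorem mem_pref {α : Type} (p : ℕ → α) {i n : ℕ} (h : i < n) : p i ∈ pref p n :=
  List.mem_of_getElem? (getElem?_pref p h)

theorem exists_of_mem_pref {α : Type} {p : ℕ → α} {n : ℕ} {c : α} (h : c ∈ pref p n) :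
    ∃ i < n, p i = c := by
  simpa [pref] using h

theorem hasSignChange_of_mul_neg {p : Baire} {f : C(unitInterval, ℝ)} (hp : contRep.IsName p f)
    {k m : ℕ} {x y : unitInterval} (hx : (x : ℝ) = m / 2 ^ k) (hy : (y : ℝ) = (m + 1) / 2 ^ k)
    (h : f x * f y < 0) : ∃ s₀, ∀ s ≥ s₀, HasSignChange (pref p s) (k, m) := by
  have hy' : (y : ℝ) = ((m + 1 : ℕ) : ℝ) / 2 ^ k := by rw [hy]; push_cast; rfl
  rcases mul_neg_iff.1 h with ⟨h1, h2⟩ | ⟨h1, h2⟩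
  · obtain ⟨i, hi⟩ := exists_posAt hp h1
    obtain ⟨j, hj⟩ := exists_negAt hp h2
    rw [hx] at hi
    rw [hy'] at hj
    exact ⟨max i j + 1, fun s hs => Or.inr ⟨⟨_, mem_pref p (by omega), hi⟩,
      _, mem_pref p (by omega), hj⟩⟩
  · obtain ⟨i, hi⟩ := exists_negAt hp h1
    obtain ⟨j, hj⟩ := exists_posAt hp h2
    rw [hx] at hi
    rw [hy'] at hj
    exact ⟨max i j + 1, fun s hs => Or.inl ⟨⟨_, mem_pref p (by omega), hi⟩,
      _, mem_pref p (by omega), hj⟩⟩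

theorem HasSignChange.mul_neg {p : Baire} {f : C(unitInterval, ℝ)} (hp : contRep.IsName p f)
    {k m s : ℕ} {x y : unitInterval} (hx : (x : ℝ) = m / 2 ^ k) (hy : (y : ℝ) = (m + 1) / 2 ^ k)
    (h : HasSignChange (pref p s) (k, m)) : f x * f y < 0 := by
  have hy' : (y : ℝ) = ((m + 1 : ℕ) : ℝ) / 2 ^ k := by rw [hy]; push_cast; rfl
  simp only [HasSignChange, NegAtDyadic, PosAtDyadic] at h
  rw [← hx, ← hy'] at h
  rcases h with ⟨⟨c, hc, h1⟩, d, hd, h2⟩ | ⟨⟨c, hc, h1⟩, d, hd, h2⟩ <;>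
  obtain ⟨i, -, rfl⟩ := exists_of_mem_pref hc <;>
  obtain ⟨j, -, rfl⟩ := exists_of_mem_pref hd
  · exact mul_neg_of_neg_of_pos (h1.neg (mapsBox_of_isName hp i)) (h2.pos (mapsBox_of_isName hp j))
  · exact mul_neg_of_pos_of_neg (h1.pos (mapsBox_of_isName hp i)) (h2.neg (mapsBox_of_isName hp j))

/-- A dyadic point of an interval with end points in `[0, 1]`. -/
theorem exists_midpoint {k m : ℕ} {x y : unitInterval} (hx : (x : ℝ) = m / 2 ^ k)
    (hy : (y : ℝ) = (m + 1) / 2 ^ k) :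
    ∃ z : unitInterval, (z : ℝ) = (2 * m + 1) / 2 ^ (k + 1) ∧
      (x : ℝ) = (2 * m : ℕ) / 2 ^ (k + 1) ∧ (z : ℝ) = ((2 * m : ℕ) + 1) / 2 ^ (k + 1) ∧
      (z : ℝ) = (2 * m + 1 : ℕ) / 2 ^ (k + 1) ∧
      (y : ℝ) = ((2 * m + 1 : ℕ) + 1) / 2 ^ (k + 1) := by
  have hz : ((2 * m + 1) / 2 ^ (k + 1) : ℝ) = ((x : ℝ) + y) / 2 := by
    rw [hx, hy, pow_succ]; field_simp; ring
  refine ⟨⟨(2 * m + 1) / 2 ^ (k + 1), ?_⟩, rfl, ?_, ?_, ?_, ?_⟩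
  · rw [hz]
    constructor <;> linarith [x.2.1, x.2.2, y.2.1, y.2.2]
  · rw [hx, pow_succ]; push_cast; field_simp
  · push_cast; rfl
  · push_cast; rfl
  · rw [hy, pow_succ]; push_cast; field_simp; ring

/-- A half is accepted when listed boxes witness opposite signs at its end points. This is never
wrong, and it happens eventually unless the midpoint is a zero. -/
theorem bisectTest_IVT : BisectTest IVT signTest GoodSign where
  primrec := primrec_signTest
  target := rfl
  closed := isClosed_IVT_val
  init := fun f ⟨_, hf, _⟩ => ⟨0, 1, by simp, by simp, hf⟩
  sound := by
    rintro p f hp - k m b s hb ⟨x, y, hx, hy, -⟩ ht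
    obtain ⟨z, -, h1, h2, h3, h4⟩ := exists_midpoint hx hy
    have ht' : HasSignChange (pref p s) (k + 1, 2 * m + b) := by simpa [signTest] using ht
    obtain rfl | rfl : b = 0 ∨ b = 1 := by omega
    · exact ⟨x, z, h1, h2, ht'.mul_neg hp h1 h2⟩
    · exact ⟨z, y, h3, h4, ht'.mul_neg hp h3 h4⟩
  progress := by
    rintro p f hp ⟨-, hd, -⟩ k m ⟨x, y, hx, hy, h⟩
    obtain ⟨z, hz, h1, h2, h3, h4⟩ := exists_midpoint hx hy
    by_cases h0 : f z = 0
    · exact Or.inl ⟨z, ⟨hd, h0⟩, hz⟩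
    right
    have hcase : f x * f z < 0 ∨ f z * f y < 0 := by
      by_contra! hc
      -- The product of `f x * f z` and `f z * f y` is `f x * f y` times a positive square, so one
      -- of the factors is negative.
      have h5 : 0 < f z * f z := mul_self_pos.2 h0
      nlinarith [mul_nonneg hc.1 hc.2]
    simp only [signTest, decide_eq_true_eq]
    rcases hcase with hc | hc
    · obtain ⟨s₀, hs⟩ := hasSignChange_of_mul_neg hp h1 h2 hc
      exact ⟨s₀, fun s h => Or.inl (hs s h)⟩
    · obtain ⟨s₀, hs⟩ := hasSignChange_of_mul_neg hp h3 h4 hc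
      exact ⟨s₀, fun s h => Or.inr (hs s h)⟩
  solvable := by
    rintro f ⟨-, hd, -⟩ k m ⟨x, y, hx, hy, h⟩
    have hxy : x ≤ y := Subtype.coe_le_coe.1 (by rw [hx, hy]; gcongr; linarith)
    obtain ⟨z, h1, h2, h3⟩ := exists_zero_of_mul_neg f hxy h
    exact ⟨z, ⟨hd, h3⟩, hx ▸ Subtype.coe_le_coe.2 h1, hy ▸ Subtype.coe_le_coe.2 h2⟩

/-! ### Bisection for connected choice -/

/-- The numerator of the point of `[0, 1]` with code `i`. -/
def clampNum (i : ℕ) : ℕ := min (i.unpair.1.unpair.1 - i.unpair.1.unpair.2) (i.unpair.2 + 1)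

theorem coe_unitSeq_eq (i : ℕ) : (unitSeq i : ℝ) = (clampNum i : ℝ) / ((i.unpair.2 : ℝ) + 1) := by
  have hd : (0 : ℝ) < (i.unpair.2 : ℝ) + 1 := by positivity
  rw [coe_unitSeq, realSeq_eq, clampNum]
  push_cast
  rcases le_total i.unpair.1.unpair.1 i.unpair.1.unpair.2 with h | h
  · have h' : (i.unpair.1.unpair.1 : ℝ) ≤ i.unpair.1.unpair.2 := by exact_mod_cast h
    have h1 : ((i.unpair.1.unpair.1 : ℝ) - i.unpair.1.unpair.2) / ((i.unpair.2 : ℝ) + 1) ≤ 0 :=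
      div_nonpos_of_nonpos_of_nonneg (by linarith) hd.le
    -- Truncated subtraction clamps negative numerators to `0`, just as the projection to `[0, 1]`
    -- does.
    rw [Nat.sub_eq_zero_of_le h, max_eq_left ((min_le_right _ _).trans h1)]
    simp [min_eq_left hd.le]
  · have h' : (i.unpair.1.unpair.2 : ℝ) ≤ i.unpair.1.unpair.1 := by exact_mod_cast h
    have h1 : 0 ≤ ((i.unpair.1.unpair.1 : ℝ) - i.unpair.1.unpair.2) / ((i.unpair.2 : ℝ) + 1) :=
      div_nonneg (by linarith) hd.le
    rw [Nat.cast_sub h, ← min_div_div_right hd.le, div_self hd.ne',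
      max_eq_right (le_min zero_le_one h1), min_comm]

/-- The interval `[x / 2 ^ n, (x + 1) / 2 ^ n]` lies in the ball with code `c`, as inequalities of
natural numbers. -/
def CellInBall (c : ℕ) (a : ℕ × ℕ) : Prop :=
  clampNum c.unpair.1 * (c.unpair.2.unpair.2 + 1) * 2 ^ a.1 +
      c.unpair.2.unpair.1.unpair.2 * (c.unpair.1.unpair.2 + 1) * 2 ^ a.1 <
    a.2 * (c.unpair.1.unpair.2 + 1) * (c.unpair.2.unpair.2 + 1) +
      c.unpair.2.unpair.1.unpair.1 * (c.unpair.1.unpair.2 + 1) * 2 ^ a.1 ∧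
  (a.2 + 1) * (c.unpair.1.unpair.2 + 1) * (c.unpair.2.unpair.2 + 1) +
      c.unpair.2.unpair.1.unpair.2 * (c.unpair.1.unpair.2 + 1) * 2 ^ a.1 <
    clampNum c.unpair.1 * (c.unpair.2.unpair.2 + 1) * 2 ^ a.1 +
      c.unpair.2.unpair.1.unpair.1 * (c.unpair.1.unpair.2 + 1) * 2 ^ a.1

theorem cellInBall_iff (c n x : ℕ) : CellInBall c (n, x) ↔
    (unitSeq c.unpair.1 : ℝ) - realSeq c.unpair.2 < (x : ℝ) / 2 ^ n ∧
      ((x : ℝ) + 1) / 2 ^ n < (unitSeq c.unpair.1 : ℝ) + realSeq c.unpair.2 := by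
  have h1 : (0 : ℝ) < (c.unpair.1.unpair.2 : ℝ) + 1 := by positivity
  have h2 : (0 : ℝ) < (c.unpair.2.unpair.2 : ℝ) + 1 := by positivity
  rw [coe_unitSeq_eq, realSeq_eq, div_sub_div _ _ h1.ne' h2.ne', div_add_div _ _ h1.ne' h2.ne',
    div_lt_div_iff₀ (by positivity) (by positivity), div_lt_div_iff₀ (by positivity) (by positivity),
    CellInBall, ← Nat.cast_lt (α := ℝ), ← Nat.cast_lt (α := ℝ)]
  push_cast
  refine and_congr ?_ ?_ <;> constructor <;> intro h <;> linarith

theorem primrecRel_cellInBall : PrimrecRel CellInBall := by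
  have hc : Primrec fun a : ℕ × (ℕ × ℕ) => a.1 := Primrec.fst
  have hp : Primrec fun a : ℕ × (ℕ × ℕ) => 2 ^ a.2.1 :=
    primrec_two_pow (Primrec.fst.comp Primrec.snd)
  have hx : Primrec fun a : ℕ × (ℕ × ℕ) => a.2.2 := Primrec.snd.comp Primrec.snd
  have h1 := primrec_unpair_fst hc
  have h2 := primrec_unpair_snd hc
  have hd1 := Primrec.succ.comp (primrec_unpair_snd h1)
  have hd2 := Primrec.succ.comp (primrec_unpair_snd h2)
  have hn : Primrec fun a : ℕ × (ℕ × ℕ) => clampNum a.1.unpair.1 :=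
    Primrec.nat_min.comp (Primrec.nat_sub.comp (primrec_unpair_fst (primrec_unpair_fst h1))
      (primrec_unpair_snd (primrec_unpair_fst h1))) hd1
  have hN := Primrec.nat_mul.comp (Primrec.nat_mul.comp hn hd2) hp
  have hA := Primrec.nat_mul.comp
    (Primrec.nat_mul.comp (primrec_unpair_fst (primrec_unpair_fst h2)) hd1) hp
  have hB := Primrec.nat_mul.comp
    (Primrec.nat_mul.comp (primrec_unpair_snd (primrec_unpair_fst h2)) hd1) hp
  have hX := Primrec.nat_mul.comp (Primrec.nat_mul.comp hx hd1) hd2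
  have hX' := Primrec.nat_mul.comp (Primrec.nat_mul.comp (Primrec.succ.comp hx) hd1) hd2
  exact (Primrec.nat_lt.comp (Primrec.nat_add.comp hN hB) (Primrec.nat_add.comp hX hA)).and
    (Primrec.nat_lt.comp (Primrec.nat_add.comp hX' hB) (Primrec.nat_add.comp hN hA))

/-- The other half of the parent interval. -/
def sibling (m : ℕ) : ℕ := if m % 2 = 0 then m + 1 else m - 1

theorem primrec_sibling : Primrec sibling :=
  Primrec.ite (Primrec.eq.comp (Primrec.nat_mod.comp Primrec.id (Primrec.const 2)) (Primrec.const 0))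
    Primrec.succ (Primrec.nat_sub.comp Primrec.id (Primrec.const 1))

/-- Each cell of the dyadic interval `[m / 2 ^ k, (m + 1) / 2 ^ k]` of length `2 ^ -(k + |u|)` lies in
one of the balls listed by `u`. -/
def Covered (u : List ℕ) (a : ℕ × ℕ) : Prop :=
  ∀ j < 2 ^ u.length, ∃ c ∈ u, CellInBall c (a.1 + u.length, a.2 * 2 ^ u.length + j)

open Classical in
/-- The bisection test for connected sets: the other half is covered. -/
noncomputable def coverTest (u : List ℕ) (a : ℕ × ℕ) : Bool := decide (Covered u (a.1, sibling a.2))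

theorem primrec_coverTest : Primrec₂ coverTest := by
  have hl : Primrec fun x : ℕ × (List ℕ × (ℕ × ℕ)) => x.2.1.length :=
    Primrec.list_length.comp (Primrec.fst.comp Primrec.snd)
  have hcell : Primrec fun x : ℕ × (List ℕ × (ℕ × ℕ)) =>
      (x.2.2.1 + x.2.1.length, sibling x.2.2.2 * 2 ^ x.2.1.length + x.1) :=
    (Primrec.nat_add.comp (Primrec.fst.comp (Primrec.snd.comp Primrec.snd)) hl).pair
      (Primrec.nat_add.comp (Primrec.nat_mul.comp
        (primrec_sibling.comp (Primrec.snd.comp (Primrec.snd.comp Primrec.snd)))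
        (primrec_two_pow hl)) Primrec.fst)
  have h1 : PrimrecRel fun (j : ℕ) (x : List ℕ × (ℕ × ℕ)) => ∃ c ∈ x.1,
      CellInBall c (x.2.1 + x.1.length, sibling x.2.2 * 2 ^ x.1.length + j) :=
    primrecRel_cellInBall.exists_mem_list.comp (Primrec.fst.comp Primrec.snd) hcell
  have h2 : PrimrecPred fun x : List ℕ × (ℕ × ℕ) => Covered x.1 (x.2.1, sibling x.2.2) :=
    (h1.forall_mem_list.comp (Primrec.list_range.comp (primrec_two_pow
      (Primrec.list_length.comp Primrec.fst))) Primrec.id).of_eq fun x => by simp [Covered]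
  classical exact PrimrecPred.decide h2

/-- The index is the floor of the rescaled point. At the right end point the floor is `2 ^ s`, one
too many, and the last cell is taken. -/
theorem exists_cell {k m s : ℕ} {y : ℝ} (hy : InDyadic k m y) :
    ∃ j < 2 ^ s, InDyadic (k + s) (m * 2 ^ s + j) y := by
  obtain ⟨h1, h2⟩ := hy
  have hk : (0 : ℝ) < 2 ^ k := by positivity
  have hs : (0 : ℝ) < 2 ^ s := by positivity
  rw [div_le_iff₀ hk] at h1
  rw [le_div_iff₀ hk] at h2
  have hs1 : 1 ≤ 2 ^ s := Nat.one_le_two_pow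
  have hcast : ((2 ^ s - 1 : ℕ) : ℝ) = 2 ^ s - 1 := by push_cast [hs1]; ring
  have ht0 : 0 ≤ (y * 2 ^ k - m) * 2 ^ s := mul_nonneg (by linarith) hs.le
  have key : ∀ j : ℕ, (j : ℝ) ≤ (y * 2 ^ k - m) * 2 ^ s → (y * 2 ^ k - m) * 2 ^ s ≤ j + 1 →
      InDyadic (k + s) (m * 2 ^ s + j) y := by
    intro j hj1 hj2
    rw [InDyadic, div_le_iff₀ (by positivity), le_div_iff₀ (by positivity), pow_add]
    push_cast
    constructor <;> linarith
  rcases lt_or_ge ⌊(y * 2 ^ k - m) * 2 ^ s⌋₊ (2 ^ s) with h | h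
  · exact ⟨_, h, key _ (Nat.floor_le ht0) (Nat.lt_floor_add_one _).le⟩
  · refine ⟨2 ^ s - 1, by omega, key _ ?_ ?_⟩
    · have h3 : ((2 ^ s : ℕ) : ℝ) ≤ (y * 2 ^ k - m) * 2 ^ s :=
        (Nat.cast_le.2 h).trans (Nat.floor_le ht0)
      push_cast at h3
      rw [hcast]
      linarith
    · rw [hcast]
      nlinarith

theorem Covered.exists_mem {p : Baire} {s k m : ℕ} (h : Covered (pref p s) (k, m))
    {y : unitInterval} (hy : InDyadic k m y) : ∃ i, y ∈ ratBall unitSeq (p i) := by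
  obtain ⟨j, hj, hcell⟩ := exists_cell (s := s) hy
  rw [Covered, length_pref] at h
  obtain ⟨c, hc, hcb⟩ := h j hj
  obtain ⟨i, -, rfl⟩ := exists_of_mem_pref hc
  rw [cellInBall_iff] at hcb
  refine ⟨i, ?_⟩
  change dist y (unitSeq (p i).unpair.1) < realSeq (p i).unpair.2
  rw [Subtype.dist_eq, Real.dist_eq, abs_lt]
  constructor <;> linarith [hcb.1, hcb.2, hcell.1, hcell.2]

/-- By the Lebesgue number lemma all sufficiently small cells lie in single balls. So coverage,
tested cell by cell with rational inequalities, is eventually recognised. -/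
theorem exists_covered {p : Baire} {k m : ℕ} (hm : m < 2 ^ k)
    (h : ∀ y : unitInterval, InDyadic k m y → ∃ i, y ∈ ratBall unitSeq (p i)) :
    ∃ s₀, ∀ s ≥ s₀, Covered (pref p s) (k, m) := by
  have hK : IsCompact {y : unitInterval | InDyadic k m y} :=
    ((isClosed_le continuous_const continuous_subtype_val).inter
      (isClosed_le continuous_subtype_val continuous_const)).isCompact
  obtain ⟨n, hn⟩ := exists_finite_cover hK h
  obtain ⟨δ, hδ, hleb⟩ := lebesgue_number_lemma_of_metric (c := fun i : Fin n =>
    ratBall unitSeq (p i)) hK (fun i => Metric.isOpen_ball) fun y hy => by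
      obtain ⟨i, hi, hyi⟩ := hn y hy
      exact Set.mem_iUnion.2 ⟨⟨i, hi⟩, hyi⟩
  obtain ⟨l, hl⟩ : ∃ l : ℕ, (1 / 2 : ℝ) ^ l < δ := exists_pow_lt_of_lt_one hδ (by norm_num)
  -- From stage `n` on the finite cover is listed; from stage `l` on cells are shorter than the
  -- Lebesgue number.
  refine ⟨max n l, fun s hs j hj => ?_⟩
  rw [length_pref] at hj ⊢
  have hk : (0 : ℝ) < 2 ^ k := by positivity
  have hs0 : (0 : ℝ) < 2 ^ s := by positivity
  have hmk : ((m : ℝ) + 1) ≤ 2 ^ k := by exact_mod_cast hm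
  have hjs : ((j : ℝ) + 1) ≤ 2 ^ s := by exact_mod_cast hj
  have hj0 : (0 : ℝ) ≤ j := by positivity
  have hdy : ∀ t : ℝ, 0 ≤ t → t ≤ 2 ^ s →
      (m : ℝ) / 2 ^ k ≤ (m * 2 ^ s + t) / 2 ^ (k + s) ∧
        (m * 2 ^ s + t) / 2 ^ (k + s) ≤ ((m : ℝ) + 1) / 2 ^ k := by
    intro t h0 h1
    rw [pow_add, div_le_div_iff₀ hk (by positivity), div_le_div_iff₀ (by positivity) hk]
    constructor <;> nlinarith [mul_nonneg hk.le h0, mul_nonneg hk.le (sub_nonneg.2 h1)]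
  have hend : ((m : ℝ) + 1) / 2 ^ k ≤ 1 := by rw [div_le_one hk]; exact hmk
  have hstart : (0 : ℝ) ≤ (m : ℝ) / 2 ^ k := by positivity
  have hd1 := hdy j hj0 (by linarith)
  have hd2 := hdy (j + 1) (by linarith) hjs
  let x : unitInterval := ⟨(m * 2 ^ s + j) / 2 ^ (k + s), hstart.trans hd1.1, hd1.2.trans hend⟩
  let y : unitInterval := ⟨(m * 2 ^ s + (j + 1)) / 2 ^ (k + s), hstart.trans hd2.1,
    hd2.2.trans hend⟩
  obtain ⟨i, hi⟩ := hleb x hd1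
  have hxy : dist y x < δ := by
    rw [Subtype.dist_eq, Real.dist_eq]
    have h1 : ((m : ℝ) * 2 ^ s + (j + 1)) / 2 ^ (k + s) - (m * 2 ^ s + j) / 2 ^ (k + s) =
        (1 / 2) ^ (k + s) := by rw [one_div_pow]; ring
    simp only [x, y, h1]
    rw [abs_of_pos (by positivity)]
    exact lt_of_le_of_lt (pow_le_pow_of_le_one (by norm_num) (by norm_num)
      (((le_max_right n l).trans hs).trans (Nat.le_add_left s k))) hl
  have hxi := hi (Metric.mem_ball_self hδ)
  have hyi := hi hxy
  refine ⟨p i, mem_pref p (i.2.trans_le ((le_max_left n l).trans hs)), ?_⟩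
  rw [cellInBall_iff]
  change dist x (unitSeq (p i).unpair.1) < realSeq (p i).unpair.2 at hxi
  change dist y (unitSeq (p i).unpair.1) < realSeq (p i).unpair.2 at hyi
  rw [Subtype.dist_eq, Real.dist_eq, abs_lt] at hxi hyi
  have hx' : (x : ℝ) = ((m * 2 ^ s + j : ℕ) : ℝ) / 2 ^ (k + s) := by simp only [x]; push_cast; rfl
  have hy' : (y : ℝ) = (((m * 2 ^ s + j : ℕ) : ℝ) + 1) / 2 ^ (k + s) := by
    simp only [y]; push_cast; ring
  rw [← hx', ← hy']
  constructor <;> linarith [hxi.1, hxi.2, hyi.1, hyi.2]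

/-- The set `A` is contained in a dyadic subinterval of `[0, 1]`. -/
def GoodCover (A : TopologicalSpace.Closeds unitInterval) (k m : ℕ) : Prop :=
  m < 2 ^ k ∧ ∀ y ∈ A, InDyadic k m y

theorem InDyadic.half_or_half {k m : ℕ} {y : ℝ} (h : InDyadic k m y) :
    InDyadic (k + 1) (2 * m) y ∨ InDyadic (k + 1) (2 * m + 1) y := by
  obtain ⟨j, hj, h'⟩ := exists_cell (s := 1) h
  obtain rfl | rfl : j = 0 ∨ j = 1 := by omega
  · left; rwa [pow_one, mul_comm, Nat.add_zero] at h'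
  · right; rwa [pow_one, mul_comm] at h'

theorem sibling_even (m : ℕ) : sibling (2 * m) = 2 * m + 1 := if_pos (by omega)

theorem sibling_odd (m : ℕ) : sibling (2 * m + 1) = 2 * m := if_neg (by omega)

/-- A half is accepted when its sibling is seen to be disjoint from `A`. If the midpoint is not in
`A`, connectedness puts `A` strictly on one side, so the opposite closed half is covered by the
listed balls, and this is eventually detected. -/
theorem bisectTest_ConCUnit : BisectTest ConCUnit coverTest GoodCover where
  primrec := primrec_coverTest
  target := rfl
  closed := isClosed_ConCUnit_val
  init := fun A _ => ⟨by norm_num, fun y _ => by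
    have := y.2.1
    have := y.2.2
    constructor <;> simpa⟩
  sound := by
    rintro p A hp - k m b s hb ⟨hm, hA⟩ ht
    have ht' : Covered (pref p s) (k + 1, sibling (2 * m + b)) := by simpa [coverTest] using ht
    have hout : ∀ y ∈ A, ¬ InDyadic (k + 1) (sibling (2 * m + b)) y := fun y hy h => by
      obtain ⟨i, hi⟩ := ht'.exists_mem h
      exact (mem_ConCUnit_iff hp y).1 hy i hi
    refine ⟨by rw [pow_succ]; omega, fun y hy => ?_⟩
    have h1 := hout y hy
    obtain rfl | rfl : b = 0 ∨ b = 1 := by omega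
    · change ¬ InDyadic (k + 1) (sibling (2 * m)) y at h1
      rw [sibling_even] at h1
      exact (hA y hy).half_or_half.resolve_right h1
    · rw [sibling_odd] at h1
      exact (hA y hy).half_or_half.resolve_left h1
  progress := by
    rintro p A hp ⟨-, hc, -⟩ k m ⟨hm, hA⟩
    by_cases hmid : ∃ y ∈ ConCUnit.val A, (y : ℝ) = (2 * m + 1) / 2 ^ (k + 1)
    · exact Or.inl hmid
    right
    have hcov : ∀ y : unitInterval, y ∉ A → ∃ i, y ∈ ratBall unitSeq (p i) := fun y hy => by
      by_contra h
      exact hy ((mem_ConCUnit_iff hp y).2 (not_exists.1 h))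
    simp only [coverTest, sibling_even, sibling_odd, decide_eq_true_eq]
    rcases one_side_of_isConnected hc fun y hy h => hmid ⟨y, ⟨hc, hy⟩, h⟩ with hs | hs
    · obtain ⟨s₀, h⟩ := exists_covered (p := p) (k := k + 1) (m := 2 * m + 1)
        (by rw [pow_succ]; omega) fun y hy => hcov y fun hyA => by
          have := hy.1
          push_cast at this
          exact absurd (hs y hyA) (not_lt.2 this)
      exact ⟨s₀, fun s hs => Or.inl (h s hs)⟩
    · obtain ⟨s₀, h⟩ := exists_covered (p := p) (k := k + 1) (m := 2 * m)
        (by rw [pow_succ]; omega) fun y hy => hcov y fun hyA => by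
          have := hy.2
          push_cast at this
          exact absurd (hs y hyA) (not_lt.2 this)
      exact ⟨s₀, fun s hs => Or.inr (h s hs)⟩
  solvable := by
    rintro A ⟨y, hc, hy⟩ k m ⟨-, hA⟩
    exact ⟨y, ⟨hc, hy⟩, hA y hy⟩

end Weihrauch

theorem corollary15p10 :
    Weihrauch.Incomparable Weihrauch.IVT Weihrauch.WWKL ∧
    ¬ Weihrauch.LasVegasComputable Weihrauch.IVT ∧
    ¬ Weihrauch.LasVegasComputableFMC Weihrauch.IVT ∧
    Weihrauch.Reducible Weihrauch.IVT Weihrauch.WWKL.jump ∧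
    Weihrauch.Incomparable Weihrauch.ConCUnit Weihrauch.PCReal ∧
    Weihrauch.Reducible Weihrauch.ConCUnit Weihrauch.PCUnit.jump := by
  open Weihrauch in
  exact ⟨⟨not_reducible_WWKL rfl codesNested_IVT,
      not_reducible_of_erodible erodible_WWKL bisectable_IVT⟩,
    not_lasVegasComputable rfl codesNested_IVT, not_lasVegasComputableFMC rfl codesNested_IVT,
    bisectTest_IVT.reducible_jump stuckAdvice_WWKL,
    ⟨not_reducible_PCReal rfl codesNested_ConCUnit,
      not_reducible_of_erodible erodible_PCReal bisectable_ConCUnit⟩,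
    bisectTest_ConCUnit.reducible_jump stuckAdvice_PCUnit⟩
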